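/- **Setting.** Let $\mathbb C_{-\infty}^{\infty}=\mathrm{span}\{e_i\mid i\in\mathbb Z\}$ with its standard inner product, let $\mathbb C_{-p}^{p}=\mathrm{span}\{e_i\mid -p\le i<p\}$, and let $I_k$ be the orthogonal projection onto $\mathrm{span}\{e_i\mid i<k\}$. Let $U=\bigcup_p U_{-p}^p$ be the group of unitary operators that are the identity outside some $\mathbb C_{-p}^p$. Let $\mathcal H$ be the space of Hermitian operators with eigenvalues in $[0,1]$ that agree with $I_0$ outside some $\mathbb C_{-p}^p$. Let $BU\times\mathbb Z\subset\mathcal H$ be the subspace of projections, and $\exp:\mathcal H\to U$, $\exp(h)=e^{2\pi i h}$. If $\mathrm{Im}\,P=\mathrm{span}\{e_i\mid i<-p\}\oplus V$ with $V\subset\mathbb C_{-p}^p$, put $\mathrm{rank}(P)=-p+\dim V$. For smooth paths and squares write $PU=Map([0,1],U)$ and $Map([0,1]^2,U)$, and let $\Omega U\subset PU$ be the space of smooth paths $[0,1]\to U$ with both end points equal to the identity. McDuff's map is $E:BU\times\mathbb Z\to\Omega U$, $E(P)(t)=e^{2\pi i(tP+(1-t)I_0)}$. Smoothness and real differential forms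 on these spaces, and on manifolds with corners, are defined by plots (smooth maps from convex subsets with non-empty interior of finite dimensional real vector spaces). The universal Chern forms are $$Ch=\mathrm{Tr}\sum_{n\ge0}\frac{(-1)^n}{(2\pi i)^{n+1}}\frac{n!}{(2n+1)!}(g^{-1}dg)^{2n+1}\in\Omega^{\mathrm{odd}}(U),\qquad Ch=\mathrm{Tr}\sum_{n\ge0}\frac{1}{(2\pi i)^n}\frac1{n!}P(dP)^{2n}\in\Omega^{\mathrm{even}}(BU\times\mathbb Z),$$ where the component of degree $0$ of the latter is $\mathrm{rank}(P)$. Let $CS=\int_{t\in[0,1]}ev_t^*Ch\in\Omega^{\mathrm{even}}(PU)$, restricted also to $\Omega U$. Let $H=\int_{s\in[0,1]}\int_{t\in[0,1]}ev_{(s,t)}^*Ch\in\Omega^{\mathrm{odd}}(Map([0,1]^2,U))$, where each fibre integral contracts $\partial_t$, respectively $\partial_s$, into the first slot (so that $H(v_1,\dots)=\iint Ch(\partial_t,\partial_s,v_1,\dots)\,dt\,ds$). For $k\in\mathbb Z$ let $h_k(P)(s,t)=tP+(1-t)(sI_k+(1-s)I_{k-1})$. **Lemma.** The maps $E$ and $\exp\circ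 h_k:BU\times\mathbb Z\to Map([0,1]^2,U)$ are smooth; the above $Ch$, $CS$, $H$ are real differential forms of the stated parities; and $$dH=\partial_1^*CS-\partial_2^*CS-\partial_3^*CS+\partial_4^*CS,$$ where $\partial_1,\partial_2,\partial_3,\partial_4$ restrict a square to its edges $s=1$, $s=0$, $t=1$, $t=0$. Moreover there is a real form $\beta\in\Omega^{\mathrm{odd}}(BU\times\mathbb Z)$, the locally finite sum $$\beta=\sum_{k\le0}(\exp\circ h_k)^*H$$ (on every plot, every point of the domain has a neighbourhood on which all but finitely many summands vanish), such that $$d\beta=E^*CS-Ch .$$ Consequently, for every compact manifold with corners $M$ and every smooth map $f:M\to BU\times\mathbb Z$, the map $E^\sharp f:M\times[0,1]\to U$, $(x,t)\mapsto E(f(x))(t)$, is smooth and takes equal values at $(x,0)$ and $(x,1)$, so it defines a map on $M\times S^1$ with $S^1=[0,1]/\{0,1\}$, and $$\int_{S^1}Ch(E^\sharp f)-Ch(f)=d(f^*\beta)\in\Omega^{\mathrm{even}}(M),$$ where $Ch(E^\sharp f)=(E^\sharp f)^*Ch$, $Ch(f)=f^*Ch$, and $\int_{S^1}$ is integration over the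 fibre $[0,1]$. -/

import Mathlib

open Set Filter Topology
open scoped ContDiff Manifold ComplexOrder

namespace BottForm

noncomputable section

/-! ## Spaces with plots, and differential forms on them -/

/-- The domains of plots: convex sets with non-empty interior. -/
structure IsConvexDomain {E : Type} [NormedAddCommGroup E] [NormedSpace ℝ E] (C : Set E) :
    Prop where
  convex : Convex ℝ C
  nonempty_interior : (interior C).Nonempty

/-- A space with plots in the sense of Chen. A plot is a map into `X` defined on a convex domain
`C` of a finite dimensional real vector space `E`; it is represented by a total function
`E → X`, of which only the restriction to `C` matters (`congr`). -/
class ChenSpace (X : Type*) where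
  IsPlot : ∀ {E : Type} [NormedAddCommGroup E] [NormedSpace ℝ E] [FiniteDimensional ℝ E],
    Set E → (E → X) → Prop
  congr : ∀ {E : Type} [NormedAddCommGroup E] [NormedSpace ℝ E] [FiniteDimensional ℝ E]
    {C : Set E} {f g : E → X}, EqOn f g C → IsPlot C f → IsPlot C g
  const : ∀ {E : Type} [NormedAddCommGroup E] [NormedSpace ℝ E] [FiniteDimensional ℝ E]
    (C : Set E) (x : X), IsPlot C (fun _ => x)
  comp : ∀ {E E' : Type} [NormedAddCommGroup E] [NormedSpace ℝ E] [FiniteDimensional ℝ E]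
    [NormedAddCommGroup E'] [NormedSpace ℝ E'] [FiniteDimensional ℝ E']
    {C : Set E} {C' : Set E'} {f : E → X} {θ : E' → E},
    IsConvexDomain C → IsConvexDomain C' → IsPlot C f → ContDiffOn ℝ ∞ θ C' → MapsTo θ C' C →
    IsPlot C' (f ∘ θ)
  locality : ∀ {E : Type} [NormedAddCommGroup E] [NormedSpace ℝ E] [FiniteDimensional ℝ E]
    {C : Set E} {f : E → X}, IsConvexDomain C →
    (∀ x ∈ C, ∃ V : Set E, IsOpen V ∧ Convex ℝ V ∧ x ∈ V ∧ IsPlot (C ∩ V) f) → IsPlot C f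

/-- Smooth maps are the maps that take plots to plots. -/
def IsSmooth {X Y : Type*} [ChenSpace X] [ChenSpace Y] (F : X → Y) : Prop :=
  ∀ (E : Type) [NormedAddCommGroup E] [NormedSpace ℝ E] [FiniteDimensional ℝ E]
    (C : Set E) (f : E → X), IsConvexDomain C → ChenSpace.IsPlot C f → ChenSpace.IsPlot C (F ∘ f)

/-- Raw data of an inhomogeneous complex valued form on a space with plots: the pullback of its
component of degree `k` along the plot `f` on `C`, at the point `x`, is `α k E C f x`.
Only plots `f` on convex domains `C` and points `x ∈ C` are ever used. -/
def DForm (X : Type*) : Type _ :=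
  ∀ (k : ℕ) (E : Type) [NormedAddCommGroup E] [NormedSpace ℝ E] [FiniteDimensional ℝ E],
    Set E → (E → X) → E → E [⋀^Fin k]→L[ℝ] ℂ

namespace DForm

variable {X Y : Type*}

/-- `α` is a (real) differential form on `X`: its pullback to every plot is a smooth real form,
and these pullbacks are compatible with smooth changes of parameters. -/
structure IsForm [ChenSpace X] (α : DForm X) : Prop where
  smooth : ∀ (k : ℕ) (E : Type) [NormedAddCommGroup E] [NormedSpace ℝ E] [FiniteDimensional ℝ E]
    (C : Set E) (f : E → X), IsConvexDomain C → ChenSpace.IsPlot C f →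
    ContDiffOn ℝ ∞ (α k E C f) C
  real : ∀ (k : ℕ) (E : Type) [NormedAddCommGroup E] [NormedSpace ℝ E] [FiniteDimensional ℝ E]
    (C : Set E) (f : E → X), IsConvexDomain C → ChenSpace.IsPlot C f →
    ∀ x ∈ C, ∀ v : Fin k → E, (α k E C f x v).im = 0
  natural : ∀ (k : ℕ) (E E' : Type) [NormedAddCommGroup E] [NormedSpace ℝ E]
    [FiniteDimensional ℝ E] [NormedAddCommGroup E'] [NormedSpace ℝ E'] [FiniteDimensional ℝ E']
    (C : Set E) (C' : Set E') (f : E → X) (f' : E' → X) (θ : E' → E),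
    IsConvexDomain C → IsConvexDomain C' → ChenSpace.IsPlot C f → ChenSpace.IsPlot C' f' →
    ContDiffOn ℝ ∞ θ C' → MapsTo θ C' C → EqOn f' (f ∘ θ) C' →
    ∀ x ∈ C', α k E' C' f' x =
      (α k E C f (θ x)).compContinuousLinearMap (fderivWithin ℝ θ C' x)

/-- Equality of forms: equality on all plots. -/
def Same [ChenSpace X] (α β : DForm X) : Prop :=
  ∀ (k : ℕ) (E : Type) [NormedAddCommGroup E] [NormedSpace ℝ E] [FiniteDimensional ℝ E]
    (C : Set E) (f : E → X), IsConvexDomain C → ChenSpace.IsPlot C f →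
    ∀ x ∈ C, α k E C f x = β k E C f x

/-- `α` has components of odd degree only. -/
def IsOdd [ChenSpace X] (α : DForm X) : Prop :=
  ∀ (k : ℕ) (E : Type) [NormedAddCommGroup E] [NormedSpace ℝ E] [FiniteDimensional ℝ E]
    (C : Set E) (f : E → X), IsConvexDomain C → ChenSpace.IsPlot C f →
    Even k → ∀ x ∈ C, α k E C f x = 0

/-- `α` has components of even degree only. -/
def IsEven [ChenSpace X] (α : DForm X) : Prop :=
  ∀ (k : ℕ) (E : Type) [NormedAddCommGroup E] [NormedSpace ℝ E] [FiniteDimensional ℝ E]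
    (C : Set E) (f : E → X), IsConvexDomain C → ChenSpace.IsPlot C f →
    Odd k → ∀ x ∈ C, α k E C f x = 0

/-- `β` is the locally finite sum of the sequence of forms `τ 0, τ 1, …`: on every plot, every
point of the domain has a neighbourhood on which all but finitely many of the `τ j` vanish
and `β` is the sum of the others. -/
def IsLocallyFiniteSum [ChenSpace X] (τ : ℕ → DForm X) (β : DForm X) : Prop :=
  ∀ (E : Type) [NormedAddCommGroup E] [NormedSpace ℝ E] [FiniteDimensional ℝ E]
    (C : Set E) (f : E → X), IsConvexDomain C → ChenSpace.IsPlot C f →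
    ∀ x ∈ C, ∃ N : ℕ, ∀ᶠ y in 𝓝[C] x, ∀ k : ℕ,
      (∀ j, N ≤ j → τ j k E C f y = 0) ∧
        β k E C f y = ∑ j ∈ Finset.range N, τ j k E C f y

def sub (α β : DForm X) : DForm X := fun k E _ _ _ C f x => α k E C f x - β k E C f x

instance : Sub (DForm X) := ⟨sub⟩

def add (α β : DForm X) : DForm X := fun k E _ _ _ C f x => α k E C f x + β k E C f x

instance : Add (DForm X) := ⟨add⟩

/-- The pullback `F^* α`. -/
def pullback (F : X → Y) (α : DForm Y) : DForm X := fun k E _ _ _ C f x => α k E C (F ∘ f) x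

/-- The exterior derivative. -/
def d (α : DForm X) : DForm X := fun k E _ _ _ C f x =>
  match k with
  | 0 => 0
  | m + 1 => extDerivWithin (α m E C f) C x

/-- Integration over the fibre of `X × [0,1] → X`: on the plot `f` on `C` it is
`∫₀¹ ι_{∂/∂t} α dt`, computed on the plot `(x, t) ↦ (f x, t)` on `C × [0,1]`. -/
def fiberInt (α : DForm (X × unitInterval)) : DForm X := fun k E _ _ _ C f x =>
  ∫ t in (0 : ℝ)..1,
    ((α (k + 1) (E × ℝ) (C ×ˢ Icc (0 : ℝ) 1)
        (fun y => (f y.1, projIcc (0 : ℝ) 1 zero_le_one y.2)) (x, t)).curryLeft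
      ((0, 1) : E × ℝ)).compContinuousLinearMap (ContinuousLinearMap.inl ℝ E ℝ)

end DForm

/-! ## Examples of spaces with plots -/

section Spaces

variable {E : Type} [NormedAddCommGroup E] [NormedSpace ℝ E]

theorem IsConvexDomain.inter_open {C V : Set E} (hC : IsConvexDomain C) (hV : IsOpen V)
    (hVc : Convex ℝ V) {x : E} (hxC : x ∈ C) (hxV : x ∈ V) : IsConvexDomain (C ∩ V) := by
  refine ⟨hC.convex.inter hVc, ?_⟩
  have h1 : x ∈ closure (interior C) := by
    rw [hC.convex.closure_interior_eq_closure_of_nonempty_interior hC.nonempty_interior]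
    exact subset_closure hxC
  obtain ⟨y, hyV, hyC⟩ := mem_closure_iff.1 h1 V hV hxV
  exact ⟨y, by rw [interior_inter, hV.interior_eq]; exact ⟨hyC, hyV⟩⟩

theorem contDiffOn_of_locally_inter {F : Type*} [NormedAddCommGroup F] [NormedSpace ℝ F]
    {C : Set E} {f : E → F}
    (h : ∀ x ∈ C, ∃ V : Set E, IsOpen V ∧ Convex ℝ V ∧ x ∈ V ∧ ContDiffOn ℝ ∞ f (C ∩ V)) :
    ContDiffOn ℝ ∞ f C :=
  contDiffOn_of_locally_contDiffOn fun x hx => by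
    obtain ⟨V, hV, -, hxV, hf⟩ := h x hx
    exact ⟨V, hV, hxV, hf⟩

instance : ChenSpace unitInterval where
  IsPlot C f := ContDiffOn ℝ ∞ (fun y => (f y : ℝ)) C
  congr h hf := hf.congr fun y hy => by rw [h hy]
  const _ _ := contDiffOn_const
  comp _ _ hf hθ hm := hf.comp hθ hm
  locality _ h := contDiffOn_of_locally_inter h

instance {X Y : Type*} [ChenSpace X] [ChenSpace Y] : ChenSpace (X × Y) where
  IsPlot C f := ChenSpace.IsPlot C (fun y => (f y).1) ∧ ChenSpace.IsPlot C (fun y => (f y).2)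
  congr h hf := ⟨ChenSpace.congr (fun y hy => by simp only [h hy]) hf.1,
    ChenSpace.congr (fun y hy => by simp only [h hy]) hf.2⟩
  const C x := ⟨ChenSpace.const C x.1, ChenSpace.const C x.2⟩
  comp hC hC' hf hθ hm :=
    ⟨ChenSpace.comp hC hC' hf.1 hθ hm, ChenSpace.comp hC hC' hf.2 hθ hm⟩
  locality hC h :=
    ⟨ChenSpace.locality hC fun x hx => by
      obtain ⟨V, hV, hc, hxV, hf⟩ := h x hx
      exact ⟨V, hV, hc, hxV, hf.1⟩,
    ChenSpace.locality hC fun x hx => by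
      obtain ⟨V, hV, hc, hxV, hf⟩ := h x hx
      exact ⟨V, hV, hc, hxV, hf.2⟩⟩

/-- A subset of a space with plots carries the plots that take values in it. -/
instance {X : Type*} [ChenSpace X] {p : X → Prop} : ChenSpace {x : X // p x} where
  IsPlot C f := ChenSpace.IsPlot C (fun y => (f y : X))
  congr h hf := ChenSpace.congr (fun y hy => by simp only [h hy]) hf
  const C x := ChenSpace.const C x.1
  comp hC hC' hf hθ hm := ChenSpace.comp hC hC' hf hθ hm
  locality hC h := ChenSpace.locality hC h

/-- The space `Map(X, Y)` of smooth maps. -/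
def SmoothMap (X Y : Type*) [ChenSpace X] [ChenSpace Y] : Type _ := {F : X → Y // IsSmooth F}

/-- The plots of a mapping space are the families that are jointly smooth. -/
instance {X Y : Type*} [ChenSpace X] [ChenSpace Y] : ChenSpace (SmoothMap X Y) where
  IsPlot {E} _ _ _ C φ := ∀ (E' : Type) [NormedAddCommGroup E'] [NormedSpace ℝ E']
    [FiniteDimensional ℝ E'] (C' : Set E') (θ : E' → E) (p : E' → X), IsConvexDomain C' →
    ContDiffOn ℝ ∞ θ C' → MapsTo θ C' C → ChenSpace.IsPlot C' p →
    ChenSpace.IsPlot C' (fun y => (φ (θ y)).1 (p y))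
  congr h hf E' _ _ _ C' θ p hC' hθ hm hp :=
    ChenSpace.congr (fun y hy => by simp only [h (hm hy)]) (hf E' C' θ p hC' hθ hm hp)
  const _ F E' _ _ _ C' _ p hC' _ _ hp := F.2 E' C' p hC' hp
  comp _ _ hf hθ hm E' _ _ _ C' θ' p hC' hθ' hm' hp :=
    hf E' C' _ p hC' (hθ.comp hθ' hm') (hm.comp hm') hp
  locality {E} _ _ _ C f hC h E' _ _ _ C' θ p hC' hθ hm hp := by
    refine ChenSpace.locality hC' fun y hy => ?_
    obtain ⟨V, hV, -, hyV, hf⟩ := h (θ y) (hm hy)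
    obtain ⟨ε, hε, hball⟩ := Metric.mem_nhdsWithin_iff.1
      (hθ.continuousOn y hy (hV.mem_nhds hyV))
    refine ⟨Metric.ball y ε, Metric.isOpen_ball, convex_ball y ε, Metric.mem_ball_self hε, ?_⟩
    have hD : IsConvexDomain (C' ∩ Metric.ball y ε) :=
      hC'.inter_open Metric.isOpen_ball (convex_ball y ε) hy (Metric.mem_ball_self hε)
    exact hf E' _ θ p hD (hθ.mono inter_subset_left)
      (fun z hz => ⟨hm hz.1, hball ⟨hz.2, hz.1⟩⟩)
      (ChenSpace.comp (θ := id) hC' hD hp contDiffOn_id fun z hz => hz.1)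

/-- A manifold with corners, as a space with plots. -/
def OfManifold {EM HM : Type*} [NormedAddCommGroup EM] [NormedSpace ℝ EM] [TopologicalSpace HM]
    (_I : ModelWithCorners ℝ EM HM) (M : Type*) : Type _ := M

/-- The plots of a manifold with corners are the smooth maps from convex domains; they include
the inverses of the charts, on convex pieces. -/
instance {EM HM : Type*} [NormedAddCommGroup EM] [NormedSpace ℝ EM] [TopologicalSpace HM]
    (I : ModelWithCorners ℝ EM HM) (M : Type*) [TopologicalSpace M] [ChartedSpace HM M] :
    ChenSpace (OfManifold I M) where
  IsPlot {E} _ _ _ C f := ContMDiffOn (M' := M) 𝓘(ℝ, E) I ∞ f C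
  congr h hf := ContMDiffOn.congr hf fun y hy => (h hy).symm
  const _ _ := contMDiffOn_const
  comp _ _ hf hθ hm := ContMDiffOn.comp hf hθ.contMDiffOn hm
  locality _ h := contMDiffOn_of_locally_contMDiffOn fun x hx => by
    obtain ⟨V, hV, -, hxV, hf⟩ := h x hx
    exact ⟨V, hV, hxV, hf⟩

end Spaces

/-! ## Stable matrices

Operators on `ℂ^∞_{-∞} = span {e_i | i ∈ ℤ}` are given by their matrices. -/

/-- The index set of the basis of `ℂ^p_{-p} = span {e_i | -p ≤ i < p}`. -/
abbrev Win (p : ℕ) : Type := {i : ℤ // i ∈ Finset.Ico (-(p : ℤ)) (p : ℤ)}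

/-- The block of `A` on `ℂ^p_{-p}`. -/
def window (p : ℕ) (A : Matrix ℤ ℤ ℂ) : Matrix (Win p) (Win p) ℂ :=
  A.submatrix Subtype.val Subtype.val

/-- `A` coincides with `B` outside of the block `ℂ^p_{-p}`. -/
def StableAt (B : Matrix ℤ ℤ ℂ) (p : ℕ) (A : Matrix ℤ ℤ ℂ) : Prop :=
  ∀ i j : ℤ, (i ∉ Finset.Ico (-(p : ℤ)) (p : ℤ) ∨ j ∉ Finset.Ico (-(p : ℤ)) (p : ℤ)) →
    A i j = B i j

/-- The matrix with block `X` on `ℂ^p_{-p}` that coincides with `B` outside of it. -/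
def padWin (B : Matrix ℤ ℤ ℂ) (p : ℕ) (X : Matrix (Win p) (Win p) ℂ) : Matrix ℤ ℤ ℂ := fun i j =>
  if h : i ∈ Finset.Ico (-(p : ℤ)) (p : ℤ) ∧ j ∈ Finset.Ico (-(p : ℤ)) (p : ℤ) then
    X ⟨i, h.1⟩ ⟨j, h.2⟩
  else B i j

/-- The orthogonal projection `I_k` onto `ℂ^k_{-∞} = span {e_i | i < k}`. -/
def stdProj (k : ℤ) : Matrix ℤ ℤ ℂ := Matrix.diagonal fun i => if i < k then 1 else 0

theorem window_padWin (B : Matrix ℤ ℤ ℂ) (p : ℕ) (X : Matrix (Win p) (Win p) ℂ) :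
    window p (padWin B p X) = X := by
  ext i j
  simp only [window, padWin, Matrix.submatrix_apply]
  rw [dif_pos ⟨i.2, j.2⟩]

theorem stableAt_padWin (B : Matrix ℤ ℤ ℂ) (p : ℕ) (X : Matrix (Win p) (Win p) ℂ) :
    StableAt B p (padWin B p X) := by
  intro i j h
  simp only [padWin]
  rw [dif_neg]
  tauto

theorem StableAt.mono {B A : Matrix ℤ ℤ ℂ} {p q : ℕ} (h : StableAt B p A) (hpq : p ≤ q) :
    StableAt B q A := by
  intro i j hij
  apply h
  simp only [Finset.mem_Ico] at hij ⊢
  omega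

/-- A family of matrices is stably smooth if its entries are smooth and if it is locally
contained in a finite stage. -/
def StableSmoothOn (B : Matrix ℤ ℤ ℂ) {E : Type} [NormedAddCommGroup E] [NormedSpace ℝ E]
    (C : Set E) (F : E → Matrix ℤ ℤ ℂ) : Prop :=
  (∀ x ∈ C, ∃ p : ℕ, ∀ᶠ y in 𝓝[C] x, StableAt B p (F y)) ∧
    ∀ i j : ℤ, ContDiffOn ℝ ∞ (fun y => F y i j) C

/-- The plots of a space of stable matrices. -/
abbrev ChenSpace.ofStable {X : Type*} (B : Matrix ℤ ℤ ℂ) (val : X → Matrix ℤ ℤ ℂ)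
    (hval : ∀ x, ∃ p, StableAt B p (val x)) : ChenSpace X where
  IsPlot C f := StableSmoothOn B C (fun y => val (f y))
  congr {E} _ _ _ C f g h hf := by
    refine ⟨fun x hx => ?_, fun i j => (hf.2 i j).congr fun y hy => by simp only [h hy]⟩
    obtain ⟨p, hp⟩ := hf.1 x hx
    refine ⟨p, ?_⟩
    filter_upwards [hp, self_mem_nhdsWithin] with y hy hyC
    rwa [← h hyC]
  const _ x := by
    obtain ⟨p, hp⟩ := hval x
    exact ⟨fun _ _ => ⟨p, Eventually.of_forall fun _ => hp⟩, fun _ _ => contDiffOn_const⟩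
  comp _ _ hf hθ hm := by
    refine ⟨fun x hx => ?_, fun i j => (hf.2 i j).comp hθ hm⟩
    obtain ⟨p, hp⟩ := hf.1 _ (hm hx)
    exact ⟨p, (tendsto_nhdsWithin_of_tendsto_nhds_of_eventually_within _
      (hθ.continuousOn x hx) (by filter_upwards [self_mem_nhdsWithin] with y hy using hm hy)
      ).eventually hp⟩
  locality _ h := by
    refine ⟨fun x hx => ?_, fun i j => contDiffOn_of_locally_inter fun x hx => ?_⟩
    · obtain ⟨V, hV, -, hxV, hf⟩ := h x hx
      obtain ⟨p, hp⟩ := hf.1 x ⟨hx, hxV⟩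
      refine ⟨p, ?_⟩
      rwa [nhdsWithin_inter_of_mem' (mem_nhdsWithin_of_mem_nhds (hV.mem_nhds hxV))] at hp
    · obtain ⟨V, hV, hc, hxV, hf⟩ := h x hx
      exact ⟨V, hV, hc, hxV, hf.2 i j⟩

/-- The stable unitary group: the union of the groups `U_{-p}^p` of unitary operators on
`ℂ^p_{-p}`, extended by the identity. -/
def StableU : Type :=
  {A : Matrix ℤ ℤ ℂ // ∃ p : ℕ, StableAt 1 p A ∧ window p A ∈ Matrix.unitaryGroup (Win p) ℂ}

/-- The space `H` of Hermitian operators with eigenvalues in `[0,1]` (that is, `0 ≤ A ≤ 1`) that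
differ from `I_0` on some `ℂ^p_{-p}` only. -/
def StableH : Type :=
  {A : Matrix ℤ ℤ ℂ // (∃ p : ℕ, StableAt (stdProj 0) p A) ∧ A.PosSemidef ∧ (1 - A).PosSemidef}

instance : ChenSpace StableU :=
  ChenSpace.ofStable 1 (fun A => A.1) fun A => A.2.imp fun _ h => h.1

instance : ChenSpace StableH := ChenSpace.ofStable (stdProj 0) (fun A => A.1) fun A => A.2.1

/-- The model of `BU × ℤ`: the projections in `H` (the Hermitian operators whose spectrum is
contained in `{0,1}` are the Hermitian idempotents). -/
def BUZ : Type :=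
  {h : StableH // ∃ p : ℕ, StableAt (stdProj 0) p h.1 ∧ window p h.1 * window p h.1 = window p h.1}

instance : ChenSpace BUZ :=
  inferInstanceAs (ChenSpace {h : StableH // ∃ p : ℕ, StableAt (stdProj 0) p h.1 ∧
    window p h.1 * window p h.1 = window p h.1})

/-- The least `p` such that `A` coincides with `I_0` outside of `ℂ^p_{-p}`. -/
def stage (A : Matrix ℤ ℤ ℂ) : ℕ := sInf {p : ℕ | StableAt (stdProj 0) p A}

/-- The rank of `P ∈ BU × ℤ`: if `Im P = ℂ^{-p}_{-∞} ⊕ V` with `V ⊆ ℂ^p_{-p}`, it is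
`-p + dim V`. -/
def BUZ.rank (P : BUZ) : ℤ :=
  ((window (stage P.1.1) P.1.1).rank : ℤ) - (stage P.1.1 : ℤ)

/-! ### Straight lines in `H` and the exponential map -/

/-- The point `t • a + (1 - t) • b` of the segment from `b` to `a`. -/
def StableH.seg (t : unitInterval) (a b : StableH) : StableH :=
  ⟨((t : ℝ) : ℂ) • a.1 + ((1 - (t : ℝ) : ℝ) : ℂ) • b.1, by
    have ht : (0 : ℂ) ≤ ((t : ℝ) : ℂ) := by exact_mod_cast t.2.1
    have ht' : (0 : ℂ) ≤ ((1 - (t : ℝ) : ℝ) : ℂ) := by exact_mod_cast sub_nonneg.2 t.2.2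
    refine ⟨?_, (a.2.2.1.smul ht).add (b.2.2.1.smul ht'), ?_⟩
    · obtain ⟨p, hp⟩ := a.2.1
      obtain ⟨q, hq⟩ := b.2.1
      refine ⟨max p q, fun i j hij => ?_⟩
      have h1 := hp.mono (le_max_left p q) i j hij
      have h2 := hq.mono (le_max_right p q) i j hij
      simp only [Matrix.add_apply, Matrix.smul_apply, smul_eq_mul, h1, h2]
      push_cast
      ring
    · have h := (a.2.2.2.smul ht).add (b.2.2.2.smul ht')
      convert h using 1
      ext i j
      simp only [Matrix.sub_apply, Matrix.add_apply, Matrix.smul_apply, smul_eq_mul]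
      push_cast
      ring⟩

/-- `I_k` as a point of `H`. -/
def StableH.std (k : ℤ) : StableH :=
  ⟨stdProj k, ⟨k.natAbs, fun i j hij => by
      simp only [stdProj, Matrix.diagonal_apply]
      simp only [Finset.mem_Ico] at hij
      by_cases h : i = j
      · simp only [h, if_true]
        congr 1
        subst h
        simp only [eq_iff_iff]
        omega
      · simp [h]⟩,
    Matrix.PosSemidef.diagonal fun i => by
      show (0 : ℂ) ≤ if i < k then 1 else 0
      split_ifs <;> simp,
    by
      have : (1 : Matrix ℤ ℤ ℂ) - stdProj k = Matrix.diagonal fun i => if i < k then 0 else 1 := by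
        ext i j
        simp only [stdProj, Matrix.sub_apply, Matrix.one_apply, Matrix.diagonal_apply]
        split_ifs <;> simp
      rw [this]
      exact Matrix.PosSemidef.diagonal fun i => by
        show (0 : ℂ) ≤ if i < k then 0 else 1
        split_ifs <;> simp⟩

theorem stableAt_stage (h : StableH) : StableAt (stdProj 0) (stage h.1) h.1 :=
  Nat.sInf_mem (s := {p : ℕ | StableAt (stdProj 0) p h.1}) h.2.1

section
variable {m : Type} [Fintype m] [DecidableEq m]

theorem hasSum_exp_entry (Y : Matrix m m ℂ) (i j : m) :
    HasSum (fun n : ℕ => ((n.factorial : ℂ)⁻¹) * (Y ^ n) i j) (NormedSpace.exp Y i j) := by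
  let : NormedRing (Matrix m m ℂ) := Matrix.linftyOpNormedRing
  let : NormedAlgebra ℂ (Matrix m m ℂ) := Matrix.linftyOpNormedAlgebra
  have h := NormedSpace.exp_series_hasSum_exp' (𝕂 := ℂ) Y
  exact h.map (Matrix.entryLinearMap ℂ ℂ i j) (LinearMap.continuous_of_finiteDimensional _)

theorem contDiffOn_exp_entry {E : Type} [NormedAddCommGroup E] [NormedSpace ℝ E] {C : Set E}
    {F : E → Matrix m m ℂ} (hF : ∀ i j, ContDiffOn ℝ ∞ (fun y => F y i j) C) (i j : m) :
    ContDiffOn ℝ ∞ (fun y => NormedSpace.exp (F y) i j) C := by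
  let : NormedRing (Matrix m m ℂ) := Matrix.linftyOpNormedRing
  let : NormedAlgebra ℝ (Matrix m m ℂ) := Matrix.linftyOpNormedAlgebra
  have h1 : ContDiffOn ℝ ∞ F C := by
    have : F = fun y => ∑ a, ∑ b, (fun z : ℂ => Matrix.single a b z) (F y a b) := by
      funext y
      exact Matrix.matrix_eq_sum_single (F y)
    rw [this]
    refine ContDiffOn.sum fun a _ => ContDiffOn.sum fun b _ => ?_
    exact (LinearMap.toContinuousLinearMap
      (Matrix.singleLinearMap ℝ a b : ℂ →ₗ[ℝ] Matrix m m ℂ)).contDiff.comp_contDiffOn (hF a b)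
  have h2 : ContDiff ℝ ∞ (NormedSpace.exp : Matrix m m ℂ → Matrix m m ℂ) :=
    contDiff_iff_contDiffAt.2 fun x => (NormedSpace.exp_analytic (𝕂 := ℝ) x).contDiffAt
  exact (LinearMap.toContinuousLinearMap
    (Matrix.entryLinearMap ℝ ℂ i j)).contDiff.comp_contDiffOn (h2.comp_contDiffOn h1)
end

/-- `exp (2π i X)` for a finite matrix `X`. -/
def expWin {p : ℕ} (X : Matrix (Win p) (Win p) ℂ) : Matrix (Win p) (Win p) ℂ :=
  NormedSpace.exp ((2 * Real.pi * Complex.I : ℂ) • X)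

/-- Powers of the blocks of a matrix that is stable at `p`. -/
theorem window_pow {A : Matrix ℤ ℤ ℂ} {p q : ℕ} (hA : StableAt (stdProj 0) p A) (hpq : p ≤ q)
    (c : ℂ) (n : ℕ) (i j : Win q) :
    ((c • window q A) ^ n) i j =
      if h : i.1 ∈ Finset.Ico (-(p : ℤ)) (p : ℤ) ∧ j.1 ∈ Finset.Ico (-(p : ℤ)) (p : ℤ) then
        ((c • window p A) ^ n) ⟨i.1, h.1⟩ ⟨j.1, h.2⟩
      else if i = j then (c * if i.1 < 0 then 1 else 0) ^ n else 0 := by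
  induction n generalizing j with
  | zero =>
    by_cases h : i.1 ∈ Finset.Ico (-(p : ℤ)) (p : ℤ) ∧ j.1 ∈ Finset.Ico (-(p : ℤ)) (p : ℤ)
    · rw [dif_pos h, pow_zero, pow_zero, Matrix.one_apply, Matrix.one_apply]
      simp only [Subtype.ext_iff]
    · rw [dif_neg h, pow_zero, pow_zero, Matrix.one_apply]
  | succ n ih =>
    rw [pow_succ, Matrix.mul_apply]
    simp only [ih]
    by_cases hj : j.1 ∈ Finset.Ico (-(p : ℤ)) (p : ℤ)
    · by_cases hi : i.1 ∈ Finset.Ico (-(p : ℤ)) (p : ℤ)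
      · rw [dif_pos ⟨hi, hj⟩, pow_succ, Matrix.mul_apply]
        have hinc : ∀ k : Win p, k.1 ∈ Finset.Ico (-(q : ℤ)) (q : ℤ) := fun k => by
          have := Finset.mem_Ico.1 k.2
          rw [Finset.mem_Ico]
          omega
        symm
        refine Fintype.sum_of_injective (fun k : Win p => (⟨k.1, hinc k⟩ : Win q)) ?_ _ _ ?_ ?_
        · intro a b hab
          exact Subtype.ext (congrArg (fun z : Win q => z.1) hab)
        · intro k hk
          have hk' : k.1 ∉ Finset.Ico (-(p : ℤ)) (p : ℤ) := fun hkp => hk ⟨⟨k.1, hkp⟩, rfl⟩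
          have h0 : A k.1 j.1 = 0 := by
            rw [hA _ _ (Or.inl hk'), stdProj, Matrix.diagonal_apply_ne]
            rintro h
            exact hk' (h ▸ hj)
          simp [window, h0]
        · intro k
          rw [dif_pos ⟨hi, k.2⟩]
          simp [window]
      · rw [dif_neg (fun h => hi h.1)]
        have hij : i ≠ j := fun h => hi (h ▸ hj)
        rw [if_neg hij]
        refine Finset.sum_eq_zero fun k _ => ?_
        rw [dif_neg (fun h => hi h.1)]
        by_cases hik : i = k
        · subst hik
          have h0 : A i.1 j.1 = 0 := by
            rw [hA _ _ (Or.inl hi), stdProj, Matrix.diagonal_apply_ne]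
            exact fun h => hij (Subtype.ext h)
          simp [window, h0]
        · simp [hik]
    · rw [dif_neg (fun h => hj h.2), Finset.sum_eq_single j]
      · rw [dif_neg (fun h => hj h.2)]
        by_cases hij : i = j
        · subst hij
          rw [if_pos rfl, if_pos rfl, pow_succ, Matrix.smul_apply, window, Matrix.submatrix_apply,
            hA _ _ (Or.inr hj), stdProj, Matrix.diagonal_apply_eq, smul_eq_mul]
        · simp [hij]
      · intro k _ hkj
        have h0 : A k.1 j.1 = 0 := by
          rw [hA _ _ (Or.inr hj), stdProj, Matrix.diagonal_apply_ne]
          exact fun h => hkj (Subtype.ext h)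
        simp [window, h0]
      · simp

/-- The exponential can be computed on any stage. -/
theorem padWin_expWin {A : Matrix ℤ ℤ ℂ} {p q : ℕ} (hA : StableAt (stdProj 0) p A)
    (hpq : p ≤ q) :
    padWin 1 q (expWin (window q A)) = padWin 1 p (expWin (window p A)) := by
  ext i j
  by_cases hq : i ∈ Finset.Ico (-(q : ℤ)) (q : ℤ) ∧ j ∈ Finset.Ico (-(q : ℤ)) (q : ℤ)
  · have hs := hasSum_exp_entry ((2 * Real.pi * Complex.I : ℂ) • window q A) ⟨i, hq.1⟩ ⟨j, hq.2⟩
    simp only [window_pow hA hpq] at hs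
    by_cases hp : i ∈ Finset.Ico (-(p : ℤ)) (p : ℤ) ∧ j ∈ Finset.Ico (-(p : ℤ)) (p : ℤ)
    · simp only [dif_pos hp] at hs
      simp only [padWin, dif_pos hp, dif_pos hq, expWin]
      exact hs.unique (hasSum_exp_entry _ _ _)
    · simp only [dif_neg hp] at hs
      simp only [padWin, dif_neg hp, dif_pos hq, expWin]
      refine hs.unique ?_
      by_cases hij : i = j
      · subst hij
        simp only [if_true, Matrix.one_apply_eq]
        have h := NormedSpace.exp_series_hasSum_exp' (𝕂 := ℂ)
          ((2 * Real.pi * Complex.I : ℂ) * if i < 0 then 1 else 0)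
        have h1 : NormedSpace.exp ((2 * Real.pi * Complex.I : ℂ) * if i < 0 then 1 else 0)
            = (1 : ℂ) := by
          rw [← Complex.exp_eq_exp_ℂ]
          split_ifs <;> simp [Complex.exp_two_pi_mul_I]
        rw [h1] at h
        exact h
      · simp [hij, Matrix.one_apply_ne hij, hasSum_zero]
  · have hp : ¬ (i ∈ Finset.Ico (-(p : ℤ)) (p : ℤ) ∧ j ∈ Finset.Ico (-(p : ℤ)) (p : ℤ)) := by
      simp only [Finset.mem_Ico] at hq ⊢
      omega
    simp only [padWin, dif_neg hp, dif_neg hq]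

theorem expWin_mem_unitaryGroup {p : ℕ} {X : Matrix (Win p) (Win p) ℂ} (hX : X.IsHermitian) :
    expWin X ∈ Matrix.unitaryGroup (Win p) ℂ := by
  have h : ((2 * Real.pi * Complex.I : ℂ) • X).conjTranspose
      = -((2 * Real.pi * Complex.I : ℂ) • X) := by
    rw [Matrix.conjTranspose_smul, hX.eq, ← neg_smul]
    congr 1
    simp
  rw [Matrix.mem_unitaryGroup_iff', Matrix.star_eq_conjTranspose, expWin,
    ← Matrix.exp_conjTranspose, h, ← Matrix.exp_add_of_commute (-_) _
      (Commute.neg_left (Commute.refl ((2 * Real.pi * Complex.I : ℂ) • X))),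
    neg_add_cancel, NormedSpace.exp_zero]

/-- The exponential map `exp : H → U`, `exp h = e^{2π i h}`. -/
def expU (h : StableH) : StableU :=
  ⟨padWin 1 (stage h.1) (expWin (window (stage h.1) h.1)), stage h.1, stableAt_padWin _ _ _, by
    rw [window_padWin]
    exact expWin_mem_unitaryGroup (h.2.2.1.isHermitian.submatrix _)⟩

theorem isSmooth_expU : IsSmooth expU := by
  intro E _ _ _ C f hC hf
  have hf' : StableSmoothOn (stdProj 0) C (fun y => (f y).1) := hf
  have key : ∀ x ∈ C, ∃ p : ℕ, ∀ᶠ y in 𝓝[C] x,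
      (expU (f y)).1 = padWin 1 p (expWin (window p (f y).1)) := by
    intro x hx
    obtain ⟨p, hp⟩ := hf'.1 x hx
    refine ⟨p, hp.mono fun y hy => ?_⟩
    exact (padWin_expWin (stableAt_stage (f y)) (Nat.sInf_le hy)).symm
  refine ⟨fun x hx => ?_, fun i j x hx => ?_⟩
  · obtain ⟨p, hp⟩ := key x hx
    refine ⟨p, hp.mono fun y hy => ?_⟩
    show StableAt 1 p (expU (f y)).1
    rw [hy]
    exact stableAt_padWin _ _ _
  · obtain ⟨p, hp⟩ := key x hx
    have h1 : ContDiffWithinAt ℝ ∞ (fun y => padWin 1 p (expWin (window p (f y).1)) i j) C x := by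
      by_cases h : i ∈ Finset.Ico (-(p : ℤ)) (p : ℤ) ∧ j ∈ Finset.Ico (-(p : ℤ)) (p : ℤ)
      · simp only [padWin, dif_pos h, expWin]
        refine contDiffOn_exp_entry (fun a b => ?_) _ _ x hx
        exact contDiffOn_const.mul (hf'.2 a.1 b.1)
      · simp only [padWin, dif_neg h]
        exact contDiffWithinAt_const
    refine h1.congr_of_eventuallyEq (hp.mono fun y hy => ?_) ?_
    · exact congrFun (congrFun hy i) j
    · exact congrFun (congrFun (hp.self_of_nhdsWithin hx) i) j

theorem isSmooth_seg : IsSmooth fun z : (unitInterval × StableH) × StableH =>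
    StableH.seg z.1.1 z.1.2 z.2 := by
  rintro E _ _ _ C f - ⟨⟨ht, ha⟩, hb⟩
  have ht' : ContDiffOn ℝ ∞ (fun y => ((f y).1.1 : ℝ)) C := ht
  have ha' : StableSmoothOn (stdProj 0) C (fun y => (f y).1.2.1) := ha
  have hb' : StableSmoothOn (stdProj 0) C (fun y => (f y).2.1) := hb
  refine ⟨fun x hx => ?_, fun i j => ?_⟩
  · obtain ⟨p, hp⟩ := ha'.1 x hx
    obtain ⟨q, hq⟩ := hb'.1 x hx
    refine ⟨max p q, ?_⟩
    filter_upwards [hp, hq] with y h1 h2 i j hij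
    have h1 := h1.mono (le_max_left p q) i j hij
    have h2 := h2.mono (le_max_right p q) i j hij
    simp only [Function.comp, StableH.seg, Matrix.add_apply, Matrix.smul_apply, smul_eq_mul,
      h1, h2]
    push_cast
    ring
  · have h1 : ContDiffOn ℝ ∞ (fun y => (((f y).1.1 : ℝ) : ℂ)) C :=
      Complex.ofRealCLM.contDiff.comp_contDiffOn ht'
    have h2 : ContDiffOn ℝ ∞ (fun y => (((1 - ((f y).1.1 : ℝ) : ℝ)) : ℂ)) C :=
      Complex.ofRealCLM.contDiff.comp_contDiffOn (contDiffOn_const.sub ht')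
    exact (h1.mul (ha'.2 i j)).add (h2.mul (hb'.2 i j))

theorem isSmooth_const {X Y : Type*} [ChenSpace X] [ChenSpace Y] (y : Y) :
    IsSmooth fun _ : X => y :=
  fun _ _ _ _ C _ _ _ => ChenSpace.const C y

theorem IsSmooth.comp {X Y Z : Type*} [ChenSpace X] [ChenSpace Y] [ChenSpace Z] {G : Y → Z}
    {F : X → Y} (hG : IsSmooth G) (hF : IsSmooth F) : IsSmooth (G ∘ F) :=
  fun E _ _ _ C f hC hf => hG E C _ hC (hF E C f hC hf)

theorem IsSmooth.prodMk {X Y Z : Type*} [ChenSpace X] [ChenSpace Y] [ChenSpace Z] {G : X → Z}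
    {F : X → Y} (hF : IsSmooth F) (hG : IsSmooth G) : IsSmooth fun x => (F x, G x) :=
  fun E _ _ _ C f hC hf => ⟨hF E C f hC hf, hG E C f hC hf⟩

theorem isSmooth_id {X : Type*} [ChenSpace X] : IsSmooth fun x : X => x :=
  fun _ _ _ _ _ _ _ hf => hf

theorem isSmooth_fst {X Y : Type*} [ChenSpace X] [ChenSpace Y] :
    IsSmooth fun x : X × Y => x.1 :=
  fun _ _ _ _ _ _ _ hf => hf.1

theorem isSmooth_snd {X Y : Type*} [ChenSpace X] [ChenSpace Y] :
    IsSmooth fun x : X × Y => x.2 :=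
  fun _ _ _ _ _ _ _ hf => hf.2

theorem expWin_of_idempotent {p : ℕ} {X : Matrix (Win p) (Win p) ℂ} (hX : X * X = X) :
    expWin X = 1 := by
  ext i j
  have hpow : ∀ n : ℕ, X ^ (n + 1) = X := fun n => by
    induction n with
    | zero => simp
    | succ n ih => rw [pow_succ, ih, hX]
  have h1 := hasSum_exp_entry ((2 * Real.pi * Complex.I : ℂ) • X) i j
  have h2 := (NormedSpace.exp_series_hasSum_exp' (𝕂 := ℂ)
    (2 * Real.pi * Complex.I : ℂ)).mul_right (X i j)
  have h3 := h2.add (hasSum_ite_eq (0 : ℕ) ((1 : Matrix (Win p) (Win p) ℂ) i j - X i j))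
  rw [← Complex.exp_eq_exp_ℂ, Complex.exp_two_pi_mul_I, one_mul, add_sub_cancel] at h3
  refine h1.unique (Eq.mp (congrArg (fun g : ℕ → ℂ => HasSum g _) (funext fun n => ?_)) h3)
  cases n with
  | zero => simp
  | succ n => simp [smul_pow, hpow, mul_assoc]

theorem expU_of_idempotent {h : StableH} {p : ℕ} (hs : StableAt (stdProj 0) p h.1)
    (hp : window p h.1 * window p h.1 = window p h.1) : (expU h).1 = 1 := by
  have h1 : (expU h).1 = padWin 1 p (expWin (window p h.1)) :=
    (padWin_expWin (stableAt_stage h) (Nat.sInf_le hs)).symm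
  rw [h1, expWin_of_idempotent hp]
  ext i j
  simp only [padWin, Matrix.one_apply, Subtype.mk.injEq]
  split_ifs <;> rfl

/-! ### The exponential map to the loop space -/

/-- The identity operator as a point of `U`. -/
def StableU.one : StableU := ⟨1, 0, fun _ _ _ => rfl, by
  have : window 0 1 = 1 := by
    ext i
    have := Finset.mem_Ico.1 i.2
    omega
  rw [this]
  exact one_mem _⟩

/-- The path space `PU` of smooth paths `[0,1] → U`. -/
abbrev PathU : Type := SmoothMap unitInterval StableU

/-- The space `Map([0,1] × [0,1], U)`; the coordinates are called `(s, t)`. -/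
abbrev SquareU : Type := SmoothMap (unitInterval × unitInterval) StableU

/-- The based loop space `ΩU`, as the space of paths that start and end at the identity. -/
abbrev LoopU : Type := {γ : PathU // γ.1 0 = StableU.one ∧ γ.1 1 = StableU.one}

theorem seg_zero (a b : StableH) : StableH.seg 0 a b = b :=
  Subtype.ext (by ext i j; simp [StableH.seg])

theorem seg_one (a b : StableH) : StableH.seg 1 a b = a :=
  Subtype.ext (by ext i j; simp [StableH.seg])

/-- McDuff's map `E : BU × ℤ → ΩU`, `E(P)(t) = e^{2π i (t P + (1 - t) I_0)}`. -/
def E (P : BUZ) : LoopU :=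
  ⟨⟨fun t => expU (StableH.seg t P.1 (StableH.std 0)),
    isSmooth_expU.comp (isSmooth_seg.comp
      ((isSmooth_id.prodMk (isSmooth_const P.1)).prodMk (isSmooth_const (StableH.std 0))))⟩, by
    refine ⟨Subtype.ext ?_, Subtype.ext ?_⟩
    · have h : StableAt (stdProj 0) 0 (StableH.std 0).1 := fun _ _ _ => rfl
      show (expU (StableH.seg 0 P.1 (StableH.std 0))).1 = 1
      rw [seg_zero]
      refine expU_of_idempotent h ?_
      ext i
      have := Finset.mem_Ico.1 i.2
      omega
    · obtain ⟨p, hs, hp⟩ := P.2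
      show (expU (StableH.seg 1 P.1 (StableH.std 0))).1 = 1
      rw [seg_one]
      exact expU_of_idempotent hs hp⟩

/-- The map `exp ∘ h_k : BU × ℤ → Map([0,1] × [0,1], U)`, where
`h_k(P)(s,t) = t P + (1 - t) (s I_k + (1 - s) I_{k-1})`. -/
def expSquare (k : ℤ) (P : BUZ) : SquareU :=
  ⟨fun z => expU (StableH.seg z.2 P.1 (StableH.seg z.1 (StableH.std k) (StableH.std (k - 1)))),
    isSmooth_expU.comp (isSmooth_seg.comp ((isSmooth_snd.prodMk (isSmooth_const P.1)).prodMk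
      (isSmooth_seg.comp ((isSmooth_fst.prodMk (isSmooth_const (StableH.std k))).prodMk
        (isSmooth_const (StableH.std (k - 1)))))))⟩

/-- The map `E^♯ f : M × S¹ → U` induced by `f : M → BU × ℤ`, where the circle is the interval
`[0,1]` with its end points identified. -/
def ESharp {M : Type*} (f : M → BUZ) (z : M × unitInterval) : StableU := (E (f z.1)).1.1 z.2

/-! ## The universal Chern forms -/

section Chern

variable {V : Type} [NormedAddCommGroup V] [NormedSpace ℝ V]

/-- The least `p` such that the family `F` lies in the stage `p` on a neighbourhood of `x`
in `C`. -/
def localStage (B : Matrix ℤ ℤ ℂ) (C : Set V) (F : V → Matrix ℤ ℤ ℂ) (x : V) : ℕ :=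
  sInf {p : ℕ | ∀ᶠ y in 𝓝[C] x, StableAt B p (F y)}

/-- The matrix valued `1`-form `dF` at `x`, on the block of size `p`. -/
def dMat (p : ℕ) (C : Set V) (F : V → Matrix ℤ ℤ ℂ) (x : V) :
    V →L[ℝ] Matrix (Win p) (Win p) ℂ :=
  ContinuousLinearMap.pi fun i => ContinuousLinearMap.pi fun j =>
    fderivWithin ℝ (fun y => F y i.1 j.1) C x

/-- Left multiplication by a matrix. -/
def mulLeftMat {p : ℕ} (A : Matrix (Win p) (Win p) ℂ) :
    Matrix (Win p) (Win p) ℂ →L[ℝ] Matrix (Win p) (Win p) ℂ where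
  toLinearMap := LinearMap.mulLeft ℝ A
  cont := continuous_const.mul continuous_id

/-- The trace. -/
def traceMat (p : ℕ) : Matrix (Win p) (Win p) ℂ →L[ℝ] ℂ where
  toLinearMap := Matrix.traceLinearMap (Win p) ℝ ℂ
  cont := continuous_id.matrix_trace

/-- The `k`-form `Tr (A θ ∧ ⋯ ∧ θ)` for a matrix `A` and a matrix valued `1`-form `θ`; its value
at `(v_1, …, v_k)` is `∑_σ sgn(σ) Tr (A θ(v_{σ(1)}) ⋯ θ(v_{σ(k)}))`. -/
def tracePow {p : ℕ} (k : ℕ) (A : Matrix (Win p) (Win p) ℂ)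
    (θ : V →L[ℝ] Matrix (Win p) (Win p) ℂ) : V [⋀^Fin k]→L[ℝ] ℂ :=
  ContinuousMultilinearMap.alternatization
    (((traceMat p).comp (mulLeftMat A)).compContinuousMultilinearMap
      ((ContinuousMultilinearMap.mkPiAlgebraFin ℝ k
        (Matrix (Win p) (Win p) ℂ)).compContinuousLinearMap fun _ => θ))

end Chern

/-- The universal odd Chern form on `U`,
`Ch = Tr ∑_{n ≥ 0} (-1)^n / (2π i)^{n+1} · n! / (2n+1)! · (g⁻¹ dg)^{2n+1}`. -/
def ChU : DForm StableU := fun k V _ _ _ C f x =>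
  let F : V → Matrix ℤ ℤ ℂ := fun y => (f y).1
  let p := localStage 1 C F x
  let n := k / 2
  if Odd k then
    ((-1 : ℂ) ^ n / (2 * Real.pi * Complex.I) ^ (n + 1) *
        ((n.factorial : ℂ) / ((2 * n + 1).factorial : ℂ))) •
      tracePow k 1 ((mulLeftMat (window p (F x))⁻¹).comp (dMat p C F x))
  else 0

/-- The universal even Chern form on `BU × ℤ`,
`Ch = Tr ∑_{n ≥ 0} 1 / (2π i)^n · 1 / n! · P (dP)^{2n}`, with `rank P` as component of
degree `0`. -/
def ChBU : DForm BUZ := fun k V _ _ _ C f x =>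
  let F : V → Matrix ℤ ℤ ℂ := fun y => (f y).1.1
  let p := localStage (stdProj 0) C F x
  match k with
  | 0 => ContinuousAlternatingMap.constOfIsEmpty ℝ V (Fin 0) ((f x).rank : ℂ)
  | m + 1 =>
    let n := (m + 1) / 2
    if Even (m + 1) then
      (1 / (2 * Real.pi * Complex.I : ℂ) ^ n * (1 / (n.factorial : ℂ))) •
        tracePow (m + 1) (window p (F x)) (dMat p C F x)
    else 0

/-- The universal Chern-Simons form `CS = ∫_{t ∈ [0,1]} ev_t^* Ch` on the path space of `U`. -/
def CSForm : DForm PathU :=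
  (DForm.pullback (fun z : PathU × unitInterval => z.1.1 z.2) ChU).fiberInt

/-- The restriction of the form `CS` to the based loop space. -/
def CSLoop : DForm LoopU := DForm.pullback (fun γ : LoopU => γ.1) CSForm

/-- The universal two-parameter transgression form on `Map([0,1] × [0,1], U)`: the integral of
`ev_{(s,t)}^* Ch` over the square, first over `t`, then over `s`. -/
def HForm : DForm SquareU :=
  (DForm.pullback (fun z : (SquareU × unitInterval) × unitInterval => z.1.1.1 (z.1.2, z.2))
    ChU).fiberInt.fiberInt

/-- The path `t ↦ σ(s, t)` in the square `σ`. -/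
def SquareU.vertical (s : unitInterval) (σ : SquareU) : PathU :=
  ⟨fun t => σ.1 (s, t), IsSmooth.comp σ.2 ((isSmooth_const s).prodMk isSmooth_id)⟩

/-- The path `s ↦ σ(s, t)` in the square `σ`. -/
def SquareU.horizontal (t : unitInterval) (σ : SquareU) : PathU :=
  ⟨fun s => σ.1 (s, t), IsSmooth.comp σ.2 (isSmooth_id.prodMk (isSmooth_const t))⟩

end

end BottForm

open BottForm

/-!
Why the theorem holds. The forms on spaces with plots are handled plot by plot, so that everything
reduces to calculus on convex domains and to finite blocks of matrices.

*Stokes.* For a form `α` on `X × [0,1]`, differentiation under the integral sign gives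
`d ∫ α = α|₁ - α|₀ - ∫ dα` (`DForm.IsForm.d_fiberInt`). The odd Chern form is closed
(`ChU_d_eq_zero`): by left invariance it is enough to look at the identity, and inversion acts on
a bi-invariant form of odd degree by `-1`, but on the value of its derivative at the identity,
which has even degree, by `+1`. Applying Stokes twice gives the formula for `dH` (`HForm_d`).

*The edges of the squares.* Put `L_k(P)(t) = exp (2π i (t P + (1 - t) I_k))`, so that `E = L_0`.
The edges `s = 1` and `s = 0` of `exp ∘ h_k` are `L_k` and `L_{k-1}`, the edge `t = 1` is constant
at the identity, and the edge `t = 0` is the loop `L_{k-1}(I_k)`, which does not depend on `P`;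
its `CS` is the constant `1` in degree `0` and zero otherwise. Hence
`d (exp ∘ h_k)^* H = L_k^* CS - L_{k-1}^* CS + 1` (`HForm_d_expSquare`).

*Far away.* Let `P` lie in the stage `N` near a point. On the block of size `N` the projection
`I_{-N}` vanishes, so `g = L_{-N}(P) = 1 + (z - 1) P` with `z = exp (2π i t)`. There `g⁻¹dg` sends
`∂_t` to `2π i P`, and it is `(z - 1) (1 + (z̄ - 1) P) dP` in the directions of `P`. As `P` and
`1 - P` alternate along a product of the `dP`, the trace is a multiple of `Tr P (dP)^{2n}`, and
Wallis' integral of `((z - 1)² z̄)^n = (-4 sin² (π t))^n` turns the odd coefficients into the even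
ones (`integral_oddCoeff`, `CSForm_shiftE`). For `k ≤ -N` the square `exp ∘ h_k` preserves the
splitting into the basis vector `e_{k-1}` and its complement; the derivative along `s` lives on
the former, the derivatives of `P` on the latter, so that `(exp ∘ h_k)^* H` vanishes
(`HForm_expSquare_eq_zero`).

*Telescoping.* So `β` is locally a finite sum, and
`dβ = L_0^* CS - L_{-N}^* CS + N = E^* CS - Ch` (`betaForm_d`); the `N` constants `1` in degree
`0` account for `rank P = Tr P - N` on the block of size `N`. The statement on manifolds is the
pullback of this equation along `f`.
-/

namespace BottForm

noncomputable section

/-! ### Calculus on convex domains -/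

section Calculus

variable {V : Type} [NormedAddCommGroup V] [NormedSpace ℝ V]

theorem IsConvexDomain.uniqueDiffOn {C : Set V} (hC : IsConvexDomain C) : UniqueDiffOn ℝ C :=
  uniqueDiffOn_convex hC.convex hC.nonempty_interior

theorem IsConvexDomain.mem_closure_interior {C : Set V} (hC : IsConvexDomain C) {x : V}
    (hx : x ∈ C) : x ∈ closure (interior C) := by
  rw [hC.convex.closure_interior_eq_closure_of_nonempty_interior hC.nonempty_interior]
  exact subset_closure hx

theorem isConvexDomain_Icc : IsConvexDomain (Icc (0 : ℝ) 1) :=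
  ⟨convex_Icc 0 1, by rw [interior_Icc]; exact ⟨1 / 2, by norm_num, by norm_num⟩⟩

theorem IsConvexDomain.prod_Icc {C : Set V} (hC : IsConvexDomain C) :
    IsConvexDomain (C ×ˢ Icc (0 : ℝ) 1) := by
  refine ⟨hC.convex.prod (convex_Icc 0 1), ?_⟩
  rw [interior_prod_eq]
  exact hC.nonempty_interior.prod isConvexDomain_Icc.nonempty_interior

/-- On a finite dimensional space, an alternating map is determined by its values on the tuples
of basis vectors, so that smoothness can be tested after evaluation. -/
theorem exists_clm_eval_alternating [FiniteDimensional ℝ V] (k : ℕ) :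
    ∃ (ι : Type) (_ : Fintype ι) (b : ι → Fin k → V) (L : (ι → ℂ) →L[ℝ] (V [⋀^Fin k]→L[ℝ] ℂ)),
      ∀ η : V [⋀^Fin k]→L[ℝ] ℂ, L (fun i => η (b i)) = η := by
  let b := Module.finBasis ℝ V
  let ev : (V [⋀^Fin k]→L[ℝ] ℂ) →ₗ[ℝ] ((Fin k → Fin (Module.finrank ℝ V)) → ℂ) :=
    { toFun := fun η i => η fun j => b (i j)
      map_add' := fun _ _ => rfl
      map_smul' := fun _ _ => rfl }
  have hev : Function.Injective ev := by
    intro η₁ η₂ h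
    apply ContinuousAlternatingMap.toContinuousMultilinearMap_injective
    apply ContinuousMultilinearMap.toMultilinearMap_injective
    exact Module.Basis.ext_multilinear (fun _ => b) fun i => congrFun h i
  obtain ⟨L, hL⟩ := ev.exists_leftInverse_of_injective (LinearMap.ker_eq_bot.2 hev)
  exact ⟨Fin k → Fin (Module.finrank ℝ V), inferInstance, fun i j => b (i j),
    LinearMap.toContinuousLinearMap L, fun η => LinearMap.congr_fun hL η⟩

theorem contDiffOn_alternating_iff [FiniteDimensional ℝ V] {V' : Type} [NormedAddCommGroup V']
    [NormedSpace ℝ V'] {k : ℕ} {n : WithTop ℕ∞} {C : Set V'} {η : V' → V [⋀^Fin k]→L[ℝ] ℂ} :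
    ContDiffOn ℝ n η C ↔ ∀ v, ContDiffOn ℝ n (fun y => η y v) C := by
  refine ⟨fun h v => (ContinuousAlternatingMap.apply ℝ V ℂ v).contDiff.comp_contDiffOn h,
    fun h => ?_⟩
  obtain ⟨ι, _, b, L, hL⟩ := exists_clm_eval_alternating (V := V) k
  have h1 : ContDiffOn ℝ n (fun y => L fun i => η y (b i)) C :=
    L.contDiff.comp_contDiffOn (contDiffOn_pi.2 fun i => h (b i))
  simpa only [hL] using h1

theorem continuousOn_slice {V : Type} [TopologicalSpace V] {F : Type*} [TopologicalSpace F]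
    {C : Set V} {g : V × ℝ → F}
    (hg : ContinuousOn g (C ×ˢ Icc (0 : ℝ) 1)) {x : V} (hx : x ∈ C) :
    ContinuousOn (fun t : ℝ => g (x, t)) (Icc 0 1) :=
  hg.comp (by fun_prop) fun _ ht => ⟨hx, ht⟩

theorem intervalIntegrable_slice {V : Type} [TopologicalSpace V] {F : Type*}
    [NormedAddCommGroup F] {C : Set V} {g : V × ℝ → F}
    (hg : ContinuousOn g (C ×ˢ Icc (0 : ℝ) 1)) {x : V} (hx : x ∈ C) :
    IntervalIntegrable (fun t : ℝ => g (x, t)) MeasureTheory.volume 0 1 :=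
  ContinuousOn.intervalIntegrable_of_Icc zero_le_one (continuousOn_slice hg hx)

/-- The derivative in the directions of `V` of a function on `C × [0,1]`. -/
theorem hasFDerivWithinAt_slice {F : Type*} [NormedAddCommGroup F] [NormedSpace ℝ F] {C : Set V}
    {g : V × ℝ → F} {x : V} {t : ℝ} (ht : t ∈ Icc (0 : ℝ) 1)
    (hg : DifferentiableWithinAt ℝ g (C ×ˢ Icc (0 : ℝ) 1) (x, t)) :
    HasFDerivWithinAt (fun y => g (y, t))
      ((fderivWithin ℝ g (C ×ˢ Icc (0 : ℝ) 1) (x, t)).comp (ContinuousLinearMap.inl ℝ V ℝ)) C x :=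
  HasFDerivWithinAt.comp (t := C ×ˢ Icc (0 : ℝ) 1) x hg.hasFDerivWithinAt
    (hasFDerivAt_prodMk_left x t).hasFDerivWithinAt fun _ hy => ⟨hy, ht⟩

/-- Differentiation under the integral sign. -/
theorem hasFDerivWithinAt_integral_slice {F : Type*} [NormedAddCommGroup F] [NormedSpace ℝ F]
    [CompleteSpace F] {C : Set V} (hC : IsConvexDomain C) {g : V × ℝ → F}
    (hg : ContDiffOn ℝ 1 g (C ×ˢ Icc (0 : ℝ) 1)) {x : V} (hx : x ∈ C) :
    HasFDerivWithinAt (fun y => ∫ t in (0 : ℝ)..1, g (y, t))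
      (∫ t in (0 : ℝ)..1, (fderivWithin ℝ g (C ×ˢ Icc (0 : ℝ) 1) (x, t)).comp
        (ContinuousLinearMap.inl ℝ V ℝ)) C x := by
  set D : V × ℝ → V →L[ℝ] F := fun z =>
    (fderivWithin ℝ g (C ×ˢ Icc (0 : ℝ) 1) z).comp (ContinuousLinearMap.inl ℝ V ℝ) with hD
  have hDc : ContinuousOn D (C ×ˢ Icc (0 : ℝ) 1) :=
    (hg.continuousOn_fderivWithin hC.prod_Icc.uniqueDiffOn le_rfl).clm_comp continuousOn_const
  rw [hasFDerivWithinAt_iff_isLittleO, Asymptotics.isLittleO_iff]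
  intro ε hε
  -- By compactness of `[0,1]`, `D (y, t)` tends to `D (x, t)` uniformly in `t` as `y → x`.
  obtain ⟨v, hv, hvb⟩ := isCompact_Icc.mem_uniformity_of_prod (f := fun y t => D (y, t))
    (s := C) (k := Icc (0 : ℝ) 1) hDc hx (Metric.dist_mem_uniformity hε)
  obtain ⟨δ, hδ, hball⟩ := Metric.mem_nhdsWithin_iff.1 hv
  filter_upwards [inter_mem_nhdsWithin C (Metric.ball_mem_nhds x hδ)] with y hy
  have key : ∀ t ∈ Icc (0 : ℝ) 1, ‖g (y, t) - g (x, t) - D (x, t) (y - x)‖ ≤ ε * ‖y - x‖ := by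
    intro t ht
    refine Convex.norm_image_sub_le_of_norm_hasFDerivWithin_le' (𝕜 := ℝ)
      (f := fun z => g (z, t)) (φ := D (x, t)) (s := C ∩ Metric.ball x δ)
      (f' := fun z => D (z, t)) (fun z hz => ?_) (fun z hz => ?_)
      (hC.convex.inter (convex_ball x δ)) ⟨hx, Metric.mem_ball_self hδ⟩ hy
    · exact (hasFDerivWithinAt_slice ht
        ((hg.differentiableOn one_ne_zero) (z, t) ⟨hz.1, ht⟩)).mono inter_subset_left
    · have := hvb z (hball ⟨hz.2, hz.1⟩) t ht
      exact (dist_eq_norm (D (z, t)) (D (x, t)) ▸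
        (show dist (D (z, t)) (D (x, t)) < ε from this)).le
  have hi : ∀ z ∈ C, IntervalIntegrable (fun t : ℝ => g (z, t)) MeasureTheory.volume 0 1 :=
    fun z hz => intervalIntegrable_slice hg.continuousOn hz
  have hDi := intervalIntegrable_slice hDc hx
  have h1 : (∫ t in (0 : ℝ)..1, g (y, t)) - (∫ t in (0 : ℝ)..1, g (x, t))
      - (∫ t in (0 : ℝ)..1, D (x, t)) (y - x)
      = ∫ t in (0 : ℝ)..1, (g (y, t) - g (x, t) - D (x, t) (y - x)) := by
    rw [intervalIntegral.integral_sub ((hi y hy.1).sub (hi x hx)),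
      intervalIntegral.integral_sub (hi y hy.1) (hi x hx),
      ContinuousLinearMap.intervalIntegral_apply hDi]
    exact ((ContinuousLinearMap.apply ℝ F (y - x)).continuous.comp_continuousOn
      (continuousOn_slice hDc hx)).intervalIntegrable_of_Icc zero_le_one
  rw [h1]
  refine (intervalIntegral.norm_integral_le_of_norm_le_const (C := ε * ‖y - x‖) ?_).trans
    (by simp)
  intro t ht
  rw [uIoc_of_le zero_le_one] at ht
  exact key t ⟨ht.1.le, ht.2⟩

/-- Induction on the order of differentiability: the derivative of the integral is again an integral
of a smooth function, with values in another space. -/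
theorem contDiffOn_integral_slice_nat {C : Set V} (hC : IsConvexDomain C) (n : ℕ) :
    ∀ {F : Type} [NormedAddCommGroup F] [NormedSpace ℝ F] [CompleteSpace F] {g : V × ℝ → F},
      ContDiffOn ℝ ∞ g (C ×ˢ Icc (0 : ℝ) 1) →
      ContDiffOn ℝ n (fun y => ∫ t in (0 : ℝ)..1, g (y, t)) C := by
  induction n with
  | zero =>
    intro F _ _ _ g hg
    rw [Nat.cast_zero, contDiffOn_zero]
    exact fun x hx => (hasFDerivWithinAt_integral_slice hC
      (hg.of_le (by exact_mod_cast le_top)) hx).continuousWithinAt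
  | succ n ih =>
    intro F _ _ _ g hg
    have hg1 : ContDiffOn ℝ 1 g (C ×ˢ Icc (0 : ℝ) 1) := hg.of_le (by exact_mod_cast le_top)
    rw [Nat.cast_succ, contDiffOn_succ_iff_hasFDerivWithinAt_of_uniqueDiffOn hC.uniqueDiffOn]
    refine ⟨by simp, _, ih (g := fun z =>
      (fderivWithin ℝ g (C ×ˢ Icc (0 : ℝ) 1) z).comp (ContinuousLinearMap.inl ℝ V ℝ)) ?_,
      fun x hx => hasFDerivWithinAt_integral_slice hC hg1 hx⟩
    exact ((contDiffOn_infty_iff_fderivWithin hC.prod_Icc.uniqueDiffOn).1 hg).2.clm_comp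
      contDiffOn_const

theorem contDiffOn_integral_slice {C : Set V} (hC : IsConvexDomain C) {F : Type}
    [NormedAddCommGroup F] [NormedSpace ℝ F] [CompleteSpace F] {g : V × ℝ → F}
    (hg : ContDiffOn ℝ ∞ g (C ×ˢ Icc (0 : ℝ) 1)) :
    ContDiffOn ℝ ∞ (fun y => ∫ t in (0 : ℝ)..1, g (y, t)) C :=
  contDiffOn_infty.2 fun n => contDiffOn_integral_slice_nat hC n hg

end Calculus

/-! ### Differential forms on spaces with plots, integration over the fibre -/

section FiberIntegral

variable {V : Type} [NormedAddCommGroup V] [NormedSpace ℝ V]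

theorem integral_fderivWithin_snd {C : Set V} (hC : IsConvexDomain C) {g : V × ℝ → ℂ}
    (hg : ContDiffOn ℝ 1 g (C ×ˢ Icc (0 : ℝ) 1)) {x : V} (hx : x ∈ C) :
    ∫ t in (0 : ℝ)..1, fderivWithin ℝ g (C ×ˢ Icc (0 : ℝ) 1) (x, t) (0, 1)
      = g (x, 1) - g (x, 0) := by
  have hc : ContinuousOn (fun t : ℝ => fderivWithin ℝ g (C ×ˢ Icc (0 : ℝ) 1) (x, t) (0, 1))
      (Icc 0 1) :=
    continuousOn_slice (g := fun z => fderivWithin ℝ g (C ×ˢ Icc (0 : ℝ) 1) z (0, 1))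
      ((hg.continuousOn_fderivWithin hC.prod_Icc.uniqueDiffOn le_rfl).clm_apply
        continuousOn_const) hx
  refine intervalIntegral.integral_eq_sub_of_hasDerivAt_of_le (f := fun t => g (x, t)) zero_le_one
    (continuousOn_slice hg.continuousOn hx) (fun t ht => ?_)
    (hc.intervalIntegrable_of_Icc zero_le_one)
  have h1 : HasFDerivWithinAt (fun s : ℝ => g (x, s))
      ((fderivWithin ℝ g (C ×ˢ Icc (0 : ℝ) 1) (x, t)).comp (ContinuousLinearMap.inr ℝ V ℝ))
      (Icc 0 1) t :=
    HasFDerivWithinAt.comp (t := C ×ˢ Icc (0 : ℝ) 1) t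
      ((hg.differentiableOn one_ne_zero) (x, t) ⟨hx, ht.1.le, ht.2.le⟩).hasFDerivWithinAt
      (hasFDerivAt_prodMk_right x t).hasFDerivWithinAt fun _ hy => ⟨hx, hy⟩
  have h2 := (h1.hasFDerivAt (Icc_mem_nhds ht.1 ht.2)).hasDerivAt
  simpa using h2

/-- Contraction of a form on `V × ℝ` with `∂/∂t`, restricted to `V`:
it sends `η` to `v ↦ η (∂/∂t, v)`. -/
def contractFiber (V : Type) [NormedAddCommGroup V] [NormedSpace ℝ V] (k : ℕ) :
    ((V × ℝ) [⋀^Fin (k + 1)]→L[ℝ] ℂ) →L[ℝ] (V [⋀^Fin k]→L[ℝ] ℂ) :=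
  (ContinuousAlternatingMap.compContinuousLinearMapCLM (ContinuousLinearMap.inl ℝ V ℝ)).comp
    ((ContinuousLinearMap.apply ℝ ((V × ℝ) [⋀^Fin k]→L[ℝ] ℂ) ((0, 1) : V × ℝ)).comp
      ContinuousAlternatingMap.curryLeftLI.toContinuousLinearMap)

/-- The plot `(x, t) ↦ (f x, t)`; the second coordinate is projected to `[0,1]`, so that the map is
defined on all of `V × ℝ`. -/
def cylinderPlot {X : Type*} (f : V → X) (y : V × ℝ) : X × unitInterval :=
  (f y.1, projIcc (0 : ℝ) 1 zero_le_one y.2)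

theorem isPlot_cylinderPlot {X : Type*} [ChenSpace X] [FiniteDimensional ℝ V] {C : Set V}
    {f : V → X} (hC : IsConvexDomain C) (hf : ChenSpace.IsPlot C f) :
    ChenSpace.IsPlot (C ×ˢ Icc (0 : ℝ) 1) (cylinderPlot f) := by
  refine ⟨ChenSpace.comp (θ := Prod.fst) hC hC.prod_Icc hf contDiffOn_fst fun y hy => hy.1, ?_⟩
  refine (contDiffOn_snd : ContDiffOn ℝ ∞ (Prod.snd : V × ℝ → ℝ) _).congr fun y hy => ?_
  simp only [cylinderPlot, projIcc_of_mem zero_le_one hy.2]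

theorem isPlot_prodMk_const {X Y : Type*} [ChenSpace X] [ChenSpace Y] [FiniteDimensional ℝ V]
    {C : Set V} {f : V → X} (hf : ChenSpace.IsPlot C f) (y : Y) :
    ChenSpace.IsPlot C fun x => (f x, y) :=
  ⟨hf, ChenSpace.const C y⟩

theorem fderivWithin_prodMap_id {V' : Type} [NormedAddCommGroup V'] [NormedSpace ℝ V']
    {C : Set V} (hC : IsConvexDomain C) {θ : V → V'} {x : V} {t : ℝ} (hx : x ∈ C)
    (ht : t ∈ Icc (0 : ℝ) 1) (hθ : DifferentiableWithinAt ℝ θ C x) :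
    fderivWithin ℝ (fun y : V × ℝ => (θ y.1, y.2)) (C ×ˢ Icc (0 : ℝ) 1) (x, t)
      = (fderivWithin ℝ θ C x).prodMap (ContinuousLinearMap.id ℝ ℝ) := by
  refine HasFDerivWithinAt.fderivWithin ?_ (hC.prod_Icc.uniqueDiffOn _ ⟨hx, ht⟩)
  have h1 : HasFDerivWithinAt (fun y : V × ℝ => θ y.1)
      ((fderivWithin ℝ θ C x).comp (ContinuousLinearMap.fst ℝ V ℝ)) (C ×ˢ Icc (0 : ℝ) 1) (x, t) :=
    HasFDerivWithinAt.comp (t := C) (x, t) hθ.hasFDerivWithinAt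
      hasFDerivWithinAt_fst fun _ hy => hy.1
  exact h1.prodMk hasFDerivWithinAt_snd

theorem contDiffOn_extDerivWithin {k : ℕ} {C : Set V} (hC : UniqueDiffOn ℝ C)
    {η : V → V [⋀^Fin k]→L[ℝ] ℂ} (h : ContDiffOn ℝ ∞ η C) :
    ContDiffOn ℝ ∞ (extDerivWithin η C) C :=
  (((ContinuousAlternatingMap.alternatizeUncurryFinCLM (n := k) ℝ V ℂ).contDiff.comp_contDiffOn
    ((contDiffOn_infty_iff_fderivWithin hC).1 h).2)).congr fun _ _ => rfl

/-- Cartan's formula on a product with an interval: `ι_{∂/∂t} dη` is the derivative of `η` in the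
direction of `∂/∂t` minus the exterior derivative, in the directions of `V`, of `ι_{∂/∂t} η`. -/
theorem extDerivWithin_cons_apply {k : ℕ} {C : Set V} (hC : IsConvexDomain C)
    {η : V × ℝ → (V × ℝ) [⋀^Fin k]→L[ℝ] ℂ}
    (h : ContDiffOn ℝ ∞ η (C ×ˢ Icc (0 : ℝ) 1)) {z : V × ℝ} (hz : z ∈ C ×ˢ Icc (0 : ℝ) 1)
    (v : Fin k → V) :
    extDerivWithin η (C ×ˢ Icc (0 : ℝ) 1) z (Fin.cons (0, 1) fun i => (v i, 0))
      = fderivWithin ℝ (fun y => η y fun i => (v i, 0)) (C ×ˢ Icc (0 : ℝ) 1) z (0, 1)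
        - ∑ i : Fin k, (-1 : ℂ) ^ i.val *
          fderivWithin ℝ (fun y => η y (i.succ.removeNth
            (Fin.cons (0, 1) fun i => (v i, 0) : Fin (k + 1) → V × ℝ)))
            (C ×ˢ Icc (0 : ℝ) 1) z (v i, 0) := by
  rw [extDerivWithin_apply (h.differentiableOn (by simp) z hz) (hC.prod_Icc.uniqueDiffOn z hz),
    Fin.sum_univ_succ, sub_eq_add_neg, ← Finset.sum_neg_distrib]
  congr 1
  · simp
  · refine Finset.sum_congr rfl fun i _ => ?_
    simp only [Fin.val_succ, Fin.cons_succ, pow_succ]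
    rcases Nat.even_or_odd i.val with h | h <;> simp [h.neg_one_pow]

end FiberIntegral

namespace DForm

variable {X Y : Type*} [ChenSpace X] [ChenSpace Y]

theorem IsForm.pullback {F : X → Y} (hF : IsSmooth F) {α : DForm Y} (hα : α.IsForm) :
    (α.pullback F).IsForm where
  smooth k V _ _ _ C f hC hf := hα.smooth k V C _ hC (hF V C f hC hf)
  real k V _ _ _ C f hC hf := hα.real k V C _ hC (hF V C f hC hf)
  natural k V V' _ _ _ _ _ _ C C' f f' θ hC hC' hf hf' hθ hm he x hx :=
    hα.natural k V V' C C' _ _ θ hC hC' (hF V C f hC hf) (hF V' C' f' hC' hf') hθ hm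
      (fun _ hy => congrArg F (he hy)) x hx

theorem IsOdd.pullback {F : X → Y} (hF : IsSmooth F) {α : DForm Y} (hα : α.IsOdd) :
    (α.pullback F).IsOdd :=
  fun k V _ _ _ C f hC hf => hα k V C _ hC (hF V C f hC hf)

theorem fiberInt_eq {X : Type*} (α : DForm (X × unitInterval)) (k : ℕ) {V : Type}
    [NormedAddCommGroup V] [NormedSpace ℝ V] [FiniteDimensional ℝ V] (C : Set V) (f : V → X)
    (x : V) :
    α.fiberInt k V C f x = ∫ t in (0 : ℝ)..1, contractFiber V k
      (α (k + 1) (V × ℝ) (C ×ˢ Icc (0 : ℝ) 1) (cylinderPlot f) (x, t)) := rfl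

section

variable {α : DForm (X × unitInterval)} {V : Type} [NormedAddCommGroup V] [NormedSpace ℝ V]
  [FiniteDimensional ℝ V] {C : Set V} {f : V → X}

theorem IsForm.contDiffOn_contract (hα : α.IsForm) (k : ℕ) (hC : IsConvexDomain C)
    (hf : ChenSpace.IsPlot C f) :
    ContDiffOn ℝ ∞ (fun z => contractFiber V k
      (α (k + 1) (V × ℝ) (C ×ˢ Icc (0 : ℝ) 1) (cylinderPlot f) z)) (C ×ˢ Icc (0 : ℝ) 1) :=
  (contractFiber V k).contDiff.comp_contDiffOn
    (hα.smooth (k + 1) _ _ _ hC.prod_Icc (isPlot_cylinderPlot hC hf))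

theorem IsForm.fiberInt_apply (hα : α.IsForm) (k : ℕ) (hC : IsConvexDomain C)
    (hf : ChenSpace.IsPlot C f) {x : V} (hx : x ∈ C) (v : Fin k → V) :
    α.fiberInt k V C f x v = ∫ t in (0 : ℝ)..1,
      α (k + 1) (V × ℝ) (C ×ˢ Icc (0 : ℝ) 1) (cylinderPlot f) (x, t)
        (Fin.cons (0, 1) fun i => (v i, 0)) := by
  rw [fiberInt_eq]
  exact ((ContinuousAlternatingMap.apply ℝ V ℂ v).intervalIntegral_comp_comm
    (intervalIntegrable_slice (hα.contDiffOn_contract k hC hf).continuousOn hx)).symm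

end

theorem IsForm.fiberInt {α : DForm (X × unitInterval)} (hα : α.IsForm) : α.fiberInt.IsForm where
  smooth k V _ _ _ C f hC hf := contDiffOn_integral_slice hC (hα.contDiffOn_contract k hC hf)
  real k V _ _ _ C f hC hf x hx v := by
    rw [hα.fiberInt_apply k hC hf hx]
    have hi : IntervalIntegrable (fun t => α (k + 1) (V × ℝ) (C ×ˢ Icc (0 : ℝ) 1)
        (cylinderPlot f) (x, t) (Fin.cons (0, 1) fun i => (v i, 0))) MeasureTheory.volume 0 1 :=
      intervalIntegrable_slice ((contDiffOn_alternating_iff.1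
        (hα.smooth (k + 1) _ _ _ hC.prod_Icc (isPlot_cylinderPlot hC hf)) _).continuousOn) hx
    rw [← Complex.imCLM_apply, ← Complex.imCLM.intervalIntegral_comp_comm hi]
    refine (intervalIntegral.integral_congr (g := fun _ => 0) fun t ht => ?_).trans (by simp)
    rw [uIcc_of_le zero_le_one] at ht
    exact hα.real (k + 1) _ _ _ hC.prod_Icc (isPlot_cylinderPlot hC hf) _ ⟨hx, ht⟩ _
  natural k V V' _ _ _ _ _ _ C C' f f' θ hC hC' hf hf' hθ hm he x hx := by
    ext v
    rw [ContinuousAlternatingMap.compContinuousLinearMap_apply, hα.fiberInt_apply k hC' hf' hx,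
      hα.fiberInt_apply k hC hf (hm hx)]
    refine intervalIntegral.integral_congr fun t ht => ?_
    rw [uIcc_of_le zero_le_one] at ht
    have hθ' : ContDiffOn ℝ ∞ (fun y : V' × ℝ => (θ y.1, y.2)) (C' ×ˢ Icc (0 : ℝ) 1) :=
      (hθ.comp contDiffOn_fst fun _ hy => hy.1).prodMk contDiffOn_snd
    have h := hα.natural (k + 1) (V × ℝ) (V' × ℝ) _ _ _ (cylinderPlot f') _ hC.prod_Icc
      hC'.prod_Icc (isPlot_cylinderPlot hC hf) (isPlot_cylinderPlot hC' hf') hθ'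
      (fun _ hy => ⟨hm hy.1, hy.2⟩)
      (fun _ hy => by simp only [cylinderPlot, Function.comp, he hy.1]) (x, t) ⟨hx, ht⟩
    simp only [h]
    rw [ContinuousAlternatingMap.compContinuousLinearMap_apply,
      fderivWithin_prodMap_id hC' hx ht ((hθ.differentiableOn (by simp)) x hx)]
    congr 1
    funext i
    refine Fin.cases ?_ (fun i => ?_) i <;> simp

theorem IsEven.fiberInt {α : DForm (X × unitInterval)} (hα : α.IsEven) : α.fiberInt.IsOdd := by
  intro k V _ _ _ C f hC hf hk x hx
  rw [fiberInt_eq]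
  refine (intervalIntegral.integral_congr (g := fun _ => 0) fun t ht => ?_).trans (by simp)
  rw [uIcc_of_le zero_le_one] at ht
  simp only
  rw [hα (k + 1) _ _ _ hC.prod_Icc (isPlot_cylinderPlot hC hf) hk.add_one _ ⟨hx, ht⟩, map_zero]

theorem IsOdd.fiberInt {α : DForm (X × unitInterval)} (hα : α.IsOdd) : α.fiberInt.IsEven := by
  intro k V _ _ _ C f hC hf hk x hx
  rw [fiberInt_eq]
  refine (intervalIntegral.integral_congr (g := fun _ => 0) fun t ht => ?_).trans (by simp)
  rw [uIcc_of_le zero_le_one] at ht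
  simp only
  rw [hα (k + 1) _ _ _ hC.prod_Icc (isPlot_cylinderPlot hC hf) hk.add_one _ ⟨hx, ht⟩, map_zero]

theorem IsForm.fiberInt_sub {α β : DForm (X × unitInterval)} (hα : α.IsForm) (hβ : β.IsForm) :
    (α - β).fiberInt.Same (α.fiberInt - β.fiberInt) := by
  intro k V _ _ _ C f hC hf x hx
  show (α - β).fiberInt k V C f x = α.fiberInt k V C f x - β.fiberInt k V C f x
  rw [fiberInt_eq, fiberInt_eq, fiberInt_eq, ← intervalIntegral.integral_sub
    (intervalIntegrable_slice (hα.contDiffOn_contract k hC hf).continuousOn hx)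
    (intervalIntegrable_slice (hβ.contDiffOn_contract k hC hf).continuousOn hx)]
  exact intervalIntegral.integral_congr fun t _ => map_sub (contractFiber V k) _ _

theorem Same.fiberInt {α β : DForm (X × unitInterval)} (h : α.Same β) :
    α.fiberInt.Same β.fiberInt := by
  intro k V _ _ _ C f hC hf x hx
  rw [fiberInt_eq, fiberInt_eq]
  refine intervalIntegral.integral_congr fun t ht => ?_
  rw [uIcc_of_le zero_le_one] at ht
  show contractFiber V k _ = contractFiber V k _
  rw [h (k + 1) _ _ _ hC.prod_Icc (isPlot_cylinderPlot hC hf) _ ⟨hx, ht⟩]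

/-- The restriction of a form on `X × [0,1]` to a slice `X × {t}`, on plots. -/
theorem IsForm.slice_apply {α : DForm (X × unitInterval)} (hα : α.IsForm) (k : ℕ) {V : Type}
    [NormedAddCommGroup V] [NormedSpace ℝ V] [FiniteDimensional ℝ V] {C : Set V} {f : V → X}
    (hC : IsConvexDomain C) (hf : ChenSpace.IsPlot C f) {x : V} (hx : x ∈ C) (t : unitInterval)
    (v : Fin k → V) :
    α.pullback (fun z : X => (z, t)) k V C f x v =
      α k (V × ℝ) (C ×ˢ Icc (0 : ℝ) 1) (cylinderPlot f) (x, t) fun i => (v i, 0) := by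
  have h := hα.natural k (V × ℝ) V (C ×ˢ Icc (0 : ℝ) 1) C (cylinderPlot f) (fun y => (f y, t))
    (fun y => (y, (t : ℝ))) hC.prod_Icc hC (isPlot_cylinderPlot hC hf) (isPlot_prodMk_const hf t)
    (contDiffOn_id.prodMk contDiffOn_const) (fun y hy => ⟨hy, t.2⟩)
    (fun _ _ => by simp [cylinderPlot]) x hx
  rw [(hasFDerivAt_prodMk_left x (t : ℝ)).hasFDerivWithinAt.fderivWithin
    (hC.uniqueDiffOn x hx)] at h
  exact congrArg (fun η : V [⋀^Fin k]→L[ℝ] ℂ => η v) h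

/-- Stokes' theorem for integration over the fibre `[0,1]`: integrate Cartan's formula over the
fibre. -/
theorem IsForm.d_fiberInt {α : DForm (X × unitInterval)} (hα : α.IsForm) :
    α.fiberInt.d.Same (α.pullback (fun z : X => (z, (1 : unitInterval)))
      - α.pullback (fun z : X => (z, (0 : unitInterval))) - α.d.fiberInt) := by
  intro k V _ _ _ C f hC hf x hx
  ext v
  show _ = α.pullback (fun z : X => (z, (1 : unitInterval))) k V C f x v
      - α.pullback (fun z : X => (z, (0 : unitInterval))) k V C f x v - α.d.fiberInt k V C f x v
  rw [hα.slice_apply k hC hf hx, hα.slice_apply k hC hf hx, fiberInt_eq]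
  have hs := fun m => hα.smooth m _ _ _ hC.prod_Icc (isPlot_cylinderPlot hC hf)
  have hu := hC.prod_Icc.uniqueDiffOn
  have hd : ContDiffOn ℝ ∞ (fun z => contractFiber V k
      (α.d (k + 1) (V × ℝ) (C ×ˢ Icc (0 : ℝ) 1) (cylinderPlot f) z)) (C ×ˢ Icc (0 : ℝ) 1) :=
    (contractFiber V k).contDiff.comp_contDiffOn
      (contDiffOn_extDerivWithin hu (hs k))
  have hint : (∫ t in (0 : ℝ)..1, contractFiber V k
      (α.d (k + 1) (V × ℝ) (C ×ˢ Icc (0 : ℝ) 1) (cylinderPlot f) (x, t))) v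
      = ∫ t in (0 : ℝ)..1, extDerivWithin (α k (V × ℝ) (C ×ˢ Icc (0 : ℝ) 1) (cylinderPlot f))
        (C ×ˢ Icc (0 : ℝ) 1) (x, t) (Fin.cons (0, 1) fun i => (v i, 0)) :=
    ((ContinuousAlternatingMap.apply ℝ V ℂ v).intervalIntegral_comp_comm
      (intervalIntegrable_slice hd.continuousOn hx)).symm
  have hg : ∀ w : Fin k → V × ℝ, ContDiffOn ℝ 1 (fun z =>
      α k (V × ℝ) (C ×ˢ Icc (0 : ℝ) 1) (cylinderPlot f) z w) (C ×ˢ Icc (0 : ℝ) 1) :=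
    fun w => (contDiffOn_alternating_iff.1 (hs k) w).of_le (by exact_mod_cast le_top)
  have hI : ∀ (w : Fin k → V × ℝ) (u : V × ℝ), IntervalIntegrable (fun t =>
      fderivWithin ℝ (fun z => α k (V × ℝ) (C ×ˢ Icc (0 : ℝ) 1) (cylinderPlot f) z w)
        (C ×ˢ Icc (0 : ℝ) 1) (x, t) u) MeasureTheory.volume 0 1 := fun w u =>
    intervalIntegrable_slice (g := fun z => fderivWithin ℝ (fun z =>
      α k (V × ℝ) (C ×ˢ Icc (0 : ℝ) 1) (cylinderPlot f) z w) (C ×ˢ Icc (0 : ℝ) 1) z u)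
      (((hg w).continuousOn_fderivWithin hu le_rfl).clm_apply continuousOn_const) hx
  have hS : ∀ (c : Fin k → ℂ) (w : Fin k → Fin k → V × ℝ) (u : Fin k → V × ℝ),
      IntervalIntegrable (fun t => ∑ i, c i * fderivWithin ℝ (fun z =>
        α k (V × ℝ) (C ×ˢ Icc (0 : ℝ) 1) (cylinderPlot f) z (w i)) (C ×ˢ Icc (0 : ℝ) 1) (x, t)
          (u i)) MeasureTheory.volume 0 1 := fun c w u => by
    have h := IntervalIntegrable.sum (Finset.univ : Finset (Fin k))
      fun i _ => (hI (w i) (u i)).const_mul (c i)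
    simpa only [Finset.sum_fn] using h
  rw [hint, intervalIntegral.integral_congr (fun t ht => extDerivWithin_cons_apply hC (hs k)
      (z := (x, t)) ⟨hx, by rwa [uIcc_of_le zero_le_one] at ht⟩ v),
    intervalIntegral.integral_sub (hI _ _) (hS _ _ _),
    integral_fderivWithin_snd hC (hg _) hx, Set.Icc.coe_one, Set.Icc.coe_zero, sub_sub_cancel,
    intervalIntegral.integral_finsetSum fun i _ => (hI _ _).const_mul _]
  cases k with
  | zero => simp [d]
  | succ m =>
    show extDerivWithin (α.fiberInt m V C f) C x v = _
    rw [extDerivWithin_apply ((hα.fiberInt.smooth m V C f hC hf).differentiableOn (by simp) x hx)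
      (hC.uniqueDiffOn x hx)]
    refine Finset.sum_congr rfl fun i _ => ?_
    have hr : (i.succ.removeNth (Fin.cons (0, 1) fun i => (v i, 0) : Fin (m + 1 + 1) → V × ℝ))
        = Fin.cons (0, 1) fun j => (i.removeNth v j, (0 : ℝ)) := by
      funext j
      refine Fin.cases ?_ (fun j => ?_) j <;> simp [Fin.removeNth]
    have h1 := hasFDerivWithinAt_integral_slice hC
      (hg (Fin.cons (0, 1) fun j => (i.removeNth v j, (0 : ℝ)))) hx
    have h2 := h1.congr (fun y hy => hα.fiberInt_apply m hC hf hy (i.removeNth v))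
      (hα.fiberInt_apply m hC hf hx (i.removeNth v))
    rw [h2.fderivWithin (hC.uniqueDiffOn x hx), hr, intervalIntegral.integral_const_mul,
      ContinuousLinearMap.intervalIntegral_apply]
    · rcases Nat.even_or_odd i.val with h | h <;> simp [h.neg_one_pow]
    · exact intervalIntegrable_slice (g := fun z => (fderivWithin ℝ (fun z =>
        α (m + 1) (V × ℝ) (C ×ˢ Icc (0 : ℝ) 1) (cylinderPlot f) z _) (C ×ˢ Icc (0 : ℝ) 1) z).comp
          (ContinuousLinearMap.inl ℝ V ℝ))
        (((hg _).continuousOn_fderivWithin hu le_rfl).clm_comp continuousOn_const) hx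

end DForm

/-! ### Antisymmetrised traces -/

section AltTrace

open Equiv

/-- Reversing a list of `n` elements takes `⌊n/2⌋` transpositions. -/
theorem sign_revPerm (n : ℕ) : Perm.sign (Fin.revPerm : Perm (Fin n)) = (-1) ^ (n / 2) := by
  induction n with
  | zero => rw [Subsingleton.elim (Fin.revPerm : Perm (Fin 0)) 1]; simp
  | succ n ih =>
    have h : (Fin.revPerm : Perm (Fin (n + 1)))
        = (finRotate (n + 1))⁻¹ * Perm.decomposeFin.symm (0, Fin.revPerm) := by
      rw [eq_inv_mul_iff_mul_eq]
      ext i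
      refine Fin.cases ?_ (fun i => ?_) i
      · simp
      · rw [Perm.mul_apply, Perm.decomposeFin_symm_apply_succ, Fin.revPerm_apply, Fin.rev_succ]
        simp
    rw [h, map_mul, Perm.sign_inv, sign_finRotate, Perm.decomposeFin.symm_sign, ih]
    rcases Nat.even_or_odd' n with ⟨m, rfl | rfl⟩
    · have h1 : (2 * m + 1) / 2 = m := by omega
      simp [h1]
    · have h1 : (2 * m + 1) / 2 = m := by omega
      have h2 : (2 * m + 1 + 1) / 2 = m + 1 := by omega
      rw [h1, h2]
      simp [pow_add, pow_mul]

variable {m : Type} [Fintype m] [DecidableEq m]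

/-- The antisymmetrised trace `∑_σ sgn(σ) Tr (A X_{σ(1)} ⋯ X_{σ(k)})`. -/
def altTrace {k : ℕ} (A : Matrix m m ℂ) (X : Fin k → Matrix m m ℂ) : ℂ :=
  ∑ σ : Perm (Fin k), ((Perm.sign σ : ℤ) : ℂ) *
    (A * (List.ofFn fun i => X (σ i)).prod).trace

theorem prod_ofFn_rotate {k : ℕ} (X : Fin (k + 1) → Matrix m m ℂ) :
    (List.ofFn fun i => X (finRotate (k + 1) i)).prod.trace = (List.ofFn X).prod.trace := by
  have h : ∀ i : Fin k, finRotate (k + 1) i.castSucc = i.succ := fun i => by simp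
  rw [List.ofFn_succ', List.concat_eq_append, List.prod_append, List.ofFn_succ, List.prod_cons,
    Matrix.trace_mul_comm]
  simp only [h, finRotate_last, List.prod_cons, List.prod_nil, mul_one]

theorem finRotate_pow_zero {k : ℕ} (j : Fin (k + 1)) :
    (finRotate (k + 1) ^ (j : ℕ)) 0 = j := by
  have h : ∀ i : ℕ, i ≤ k → (((finRotate (k + 1) ^ i) 0 : Fin (k + 1)) : ℕ) = i := by
    intro i
    induction i with
    | zero => simp
    | succ i ih =>
      intro hi
      have h1 := ih (by omega)
      rw [pow_succ', Perm.mul_apply, coe_finRotate_of_ne_last, h1]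
      intro h2
      rw [h2, Fin.val_last] at h1
      omega
  exact Fin.ext (h j (Nat.lt_succ_iff.1 j.2))

/-- By cyclicity of the trace, a distinguished argument of an antisymmetrised trace with an odd
number of arguments can be rotated to the first place. -/
theorem altTrace_one_cons {k : ℕ} (hk : Even k) (T : Matrix m m ℂ) (X : Fin k → Matrix m m ℂ) :
    altTrace 1 (Fin.cons T X : Fin (k + 1) → Matrix m m ℂ) = (k + 1) * altTrace T X := by
  set Y : Fin (k + 1) → Matrix m m ℂ := Fin.cons T X with hY
  set g : Perm (Fin (k + 1)) → ℂ := fun τ => ((Perm.sign τ : ℤ) : ℂ) *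
    (List.ofFn fun i => Y (τ i)).prod.trace with hg
  have hrot : ∀ τ, g (τ * finRotate (k + 1)) = g τ := fun τ => by
    simp only [hg, Perm.sign_mul, sign_finRotate, Nat.add_sub_cancel, hk.neg_one_pow, mul_one]
    exact congrArg _ (prod_ofFn_rotate fun i => Y (τ i))
  have hrot' : ∀ (j : ℕ) τ, g (τ * finRotate (k + 1) ^ j) = g τ := fun j => by
    induction j with
    | zero => simp
    | succ j ih => intro τ; rw [pow_succ, ← mul_assoc, hrot, ih]
  have h0 : ∑ τ : Perm (Fin (k + 1)), (if τ 0 = 0 then g τ else 0) = altTrace T X := by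
    rw [← Perm.decomposeFin.symm.sum_comp, Fintype.sum_prod_type,
      Finset.sum_eq_single (0 : Fin (k + 1)) (fun p _ hp => by simp [hp]) (by simp)]
    refine Finset.sum_congr rfl fun σ _ => ?_
    simp [hg, hY, Perm.decomposeFin.symm_sign, List.ofFn_succ]
  have h1 : ∀ τ : Perm (Fin (k + 1)), ∑ j : Fin (k + 1), (if τ j = 0 then g τ else 0) = g τ :=
    fun τ => by
    rw [Finset.sum_eq_single (τ⁻¹ 0) (fun b _ hb => if_neg fun h => hb (by simp [← h])) (by simp)]
    simp
  calc altTrace 1 Y = ∑ τ, g τ := Finset.sum_congr rfl fun τ _ => by simp [hg]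
    _ = ∑ j : Fin (k + 1), ∑ τ : Perm (Fin (k + 1)), (if τ j = 0 then g τ else 0) := by
        rw [Finset.sum_comm]
        exact Finset.sum_congr rfl fun τ _ => (h1 τ).symm
    _ = ∑ j : Fin (k + 1), altTrace T X := by
        refine Finset.sum_congr rfl fun j _ => ?_
        rw [← h0, ← Equiv.sum_comp (Equiv.mulRight (finRotate (k + 1) ^ (j : ℕ)))
          fun τ : Perm (Fin (k + 1)) => if τ 0 = 0 then g τ else 0]
        refine Finset.sum_congr rfl fun τ _ => ?_
        simp only [Equiv.coe_mulRight, hrot', Perm.mul_apply, finRotate_pow_zero]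
    _ = (k + 1) * altTrace T X := by simp

/-- If the conjugate of the trace of a product is, up to the factor `c`, the trace of the reversed
product, then the antisymmetrised trace picks up the sign of the reversal. -/
theorem star_altTrace {k : ℕ} {A : Matrix m m ℂ} {X : Fin k → Matrix m m ℂ} {c : ℂ}
    (h : ∀ σ : Perm (Fin k), star (A * (List.ofFn fun i => X (σ i)).prod).trace
      = c * (A * (List.ofFn fun i => X (σ i.rev)).prod).trace) :
    star (altTrace A X) = c * (-1) ^ (k / 2) * altTrace A X := by
  have h1 : altTrace A X = ∑ σ : Perm (Fin k), ((Perm.sign (σ * Fin.revPerm) : ℤ) : ℂ) *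
      (A * (List.ofFn fun i => X (σ i.rev)).prod).trace :=
    (Equiv.sum_comp (Equiv.mulRight (Fin.revPerm : Perm (Fin k))) fun σ : Perm (Fin k) =>
      ((Perm.sign σ : ℤ) : ℂ) * (A * (List.ofFn fun i => X (σ i)).prod).trace).symm
  conv_rhs => rw [h1]
  rw [altTrace, star_sum, Finset.mul_sum]
  refine Finset.sum_congr rfl fun σ _ => ?_
  rw [star_mul', h, Perm.sign_mul, sign_revPerm]
  have h2 : ((-1 : ℂ) ^ (k / 2)) * (-1) ^ (k / 2) = 1 := by
    rw [← mul_pow]; simp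
  have h3 : star (((Perm.sign σ : ℤ) : ℂ)) = ((Perm.sign σ : ℤ) : ℂ) := by simp
  rw [h3]
  push_cast
  linear_combination (-(c * ((Perm.sign σ : ℤ) : ℂ) *
    (A * (List.ofFn fun i => X (σ i.rev)).prod).trace)) * h2

theorem conjTranspose_prod_ofFn {k : ℕ} (X : Fin k → Matrix m m ℂ) :
    (List.ofFn X).prod.conjTranspose
      = (List.ofFn fun i : Fin k => (X i.rev).conjTranspose).prod := by
  induction k with
  | zero => simp
  | succ k ih =>
    rw [List.ofFn_succ, List.prod_cons, Matrix.conjTranspose_mul, ih, List.ofFn_succ',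
      List.concat_eq_append, List.prod_append]
    simp [Fin.rev_castSucc]

theorem prod_ofFn_smul {k : ℕ} (c : ℂ) (X : Fin k → Matrix m m ℂ) :
    (List.ofFn fun i => c • X i).prod = c ^ k • (List.ofFn X).prod := by
  induction k with
  | zero => simp
  | succ k ih => simp [List.ofFn_succ, ih, pow_succ, smul_smul, mul_comm]

/-- An antisymmetrised trace of `2n + 1` skew-Hermitian matrices is real or imaginary, depending on
the parity of `n`. -/
theorem star_altTrace_skew {n : ℕ} {X : Fin (2 * n + 1) → Matrix m m ℂ}
    (hX : ∀ i, (X i).conjTranspose = -X i) :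
    star (altTrace 1 X) = (-1) ^ (n + 1) * altTrace 1 X := by
  have h2 : (2 * n + 1) / 2 = n := by omega
  rw [star_altTrace (c := -1), h2]
  · ring
  · intro σ
    rw [← Matrix.trace_conjTranspose, one_mul, one_mul, conjTranspose_prod_ofFn]
    have h1 : (fun i : Fin (2 * n + 1) => (X (σ i.rev)).conjTranspose)
        = fun i => (-1 : ℂ) • X (σ i.rev) := by
      funext i
      rw [hX, neg_one_smul]
    rw [h1, prod_ofFn_smul, Matrix.trace_smul, smul_eq_mul]
    simp [pow_succ, pow_mul]

/-- The condition `P X + X P = X` says that `X` is off-diagonal with respect to the images of `P`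
and `1 - P`, so that an even number of such factors is diagonal. -/
theorem mul_prod_ofFn_comm {n : ℕ} {P : Matrix m m ℂ} {X : Fin (2 * n) → Matrix m m ℂ}
    (hX : ∀ i, P * X i + X i * P = X i) :
    P * (List.ofFn X).prod = (List.ofFn X).prod * P := by
  induction n with
  | zero => simp
  | succ n ih =>
    change Fin (2 * n + 1 + 1) → Matrix m m ℂ at X
    have h : ∀ i, P * X i = X i * (1 - P) := fun i => by
      rw [mul_sub, mul_one, eq_sub_iff_add_eq, hX]
    have h' : ∀ i, (1 - P) * X i = X i * P := fun i => by
      rw [sub_mul, one_mul, sub_eq_iff_eq_add, add_comm, hX]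
    show P * (List.ofFn (n := 2 * n + 1 + 1) X).prod = (List.ofFn (n := 2 * n + 1 + 1) X).prod * P
    rw [List.ofFn_succ, List.ofFn_succ, List.prod_cons, List.prod_cons, ← mul_assoc, h, mul_assoc,
      ← mul_assoc (1 - P), h', mul_assoc (X _) P, ih (X := fun i => X i.succ.succ) fun i => hX _]
    simp only [mul_assoc]

/-- An antisymmetrised trace `Tr P X_1 ⋯ X_{2n}` of Hermitian matrices that are off-diagonal for the
projection `P` is real or imaginary, depending on the parity of `n`. -/
theorem star_altTrace_projection {n : ℕ} {P : Matrix m m ℂ} {X : Fin (2 * n) → Matrix m m ℂ}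
    (hP : P.conjTranspose = P) (hX : ∀ i, (X i).conjTranspose = X i)
    (hPX : ∀ i, P * X i + X i * P = X i) :
    star (altTrace P X) = (-1) ^ n * altTrace P X := by
  have h2 : (2 * n) / 2 = n := by omega
  rw [star_altTrace (c := 1), h2, one_mul]
  intro σ
  rw [← Matrix.trace_conjTranspose, Matrix.conjTranspose_mul, hP, conjTranspose_prod_ofFn, one_mul]
  simp only [hX]
  rw [mul_prod_ofFn_comm (X := fun i => X (σ i.rev)) fun i => hPX _]

/-- For off-diagonal `X_i`, the factor `c X + d P X` is `(c + d) X` on the image of `1 - P` and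
`c X` on the image of `P`; in a product these two alternate. -/
theorem mul_prod_ofFn_twisted {n : ℕ} {P : Matrix m m ℂ} (hP : P * P = P) (c d : ℂ)
    {X : Fin (2 * n) → Matrix m m ℂ} (hX : ∀ i, P * X i + X i * P = X i) :
    P * (List.ofFn fun i => c • X i + d • (P * X i)).prod
      = ((c + d) * c) ^ n • (P * (List.ofFn X).prod) := by
  induction n with
  | zero => simp
  | succ n ih =>
    have h : ∀ i, P * X i = X i * (1 - P) := fun i => by
      rw [mul_sub, mul_one, eq_sub_iff_add_eq, hX]
    have h' : ∀ i, (1 - P) * X i = X i * P := fun i => by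
      rw [sub_mul, one_mul, sub_eq_iff_eq_add, add_comm, hX]
    have h1 : ∀ i, P * (c • X i + d • (P * X i)) = (c + d) • (X i * (1 - P)) := fun i => by
      rw [mul_add, mul_smul_comm, mul_smul_comm, ← mul_assoc, hP, ← add_smul, h]
    have h2 : ∀ i, (1 - P) * (c • X i + d • (P * X i)) = c • (X i * P) := fun i => by
      rw [mul_add, mul_smul_comm, mul_smul_comm, ← mul_assoc (1 - P), sub_mul 1 P P, hP, one_mul,
        sub_self, zero_mul, smul_zero, add_zero, h']
    show P * (List.ofFn (n := 2 * n + 1 + 1) fun i => c • X i + d • (P * X i)).prod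
      = ((c + d) * c) ^ (n + 1) • (P * (List.ofFn (n := 2 * n + 1 + 1) X).prod)
    rw [List.ofFn_succ, List.ofFn_succ, List.ofFn_succ, List.ofFn_succ]
    simp only [List.prod_cons]
    rw [← mul_assoc, h1, smul_mul_assoc, mul_assoc, ← mul_assoc (1 - P), h2, smul_mul_assoc,
      mul_assoc (X _) P, ih (X := fun i => X i.succ.succ) fun i => hX _, ← mul_assoc P, h,
      mul_assoc, ← mul_assoc (1 - P), h']
    simp only [mul_smul_comm, smul_smul, mul_assoc]
    congr 1
    ring

theorem altTrace_twisted {n : ℕ} {P : Matrix m m ℂ} (hP : P * P = P) (c d a : ℂ)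
    {X : Fin (2 * n) → Matrix m m ℂ} (hX : ∀ i, P * X i + X i * P = X i) :
    altTrace (a • P) (fun i => c • X i + d • (P * X i))
      = a * ((c + d) * c) ^ n * altTrace P X := by
  rw [altTrace, altTrace, Finset.mul_sum]
  refine Finset.sum_congr rfl fun σ _ => ?_
  rw [smul_mul_assoc, mul_prod_ofFn_twisted hP c d (X := fun i => X (σ i)) fun i => hX _,
    Matrix.trace_smul, Matrix.trace_smul, smul_eq_mul, smul_eq_mul]
  ring

theorem altTrace_eq_zero {k : ℕ} {A : Matrix m m ℂ} {X : Fin k → Matrix m m ℂ}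
    (h : ∀ σ : Perm (Fin k), (List.ofFn fun i => X (σ i)).prod = 0) : altTrace A X = 0 :=
  Finset.sum_eq_zero fun σ _ => by rw [h, mul_zero, Matrix.trace_zero, mul_zero]

theorem altTrace_eq_zero_of_apply {k : ℕ} {A : Matrix m m ℂ} {X : Fin k → Matrix m m ℂ} (i : Fin k)
    (h : X i = 0) : altTrace A X = 0 :=
  altTrace_eq_zero fun σ => List.prod_eq_zero (by
    rw [List.mem_ofFn]
    exact ⟨σ⁻¹ i, by simp [h]⟩)

/-- If the `X_i` commute with `e`, and if one of them is fixed by multiplication with `e` and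
another one is annihilated by it, then every product of the `X_i` vanishes. -/
theorem altTrace_eq_zero_of_commute {k : ℕ} {A e : Matrix m m ℂ} {X : Fin k → Matrix m m ℂ}
    (hc : ∀ i, Commute (X i) e) {a b : Fin k} (ha : X a * e = X a) (hb : X b * e = 0) :
    altTrace A X = 0 := by
  have hl : ∀ l : List (Matrix m m ℂ), (∀ Y ∈ l, Commute Y e) →
      (X a ∈ l → l.prod * e = l.prod) ∧ (X b ∈ l → l.prod * e = 0) := by
    intro l
    induction l with
    | nil => simp
    | cons Y l ih =>
      intro hY
      obtain ⟨h1, h2⟩ := ih fun Z hZ => hY Z (List.mem_cons_of_mem _ hZ)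
      have hcl : Commute l.prod e :=
        Commute.list_prod_left _ _ fun Z hZ => hY Z (List.mem_cons_of_mem _ hZ)
      rw [List.prod_cons]
      constructor
      · intro h
        rcases List.mem_cons.1 h with h | h
        · rw [mul_assoc, hcl.eq, ← mul_assoc, ← h, ha]
        · rw [mul_assoc, h1 h]
      · intro h
        rcases List.mem_cons.1 h with h | h
        · rw [mul_assoc, hcl.eq, ← mul_assoc, ← h, hb, zero_mul]
        · rw [mul_assoc, h2 h, mul_zero]
  refine altTrace_eq_zero fun σ => ?_
  have hmem : ∀ i, X i ∈ List.ofFn fun i => X (σ i) := fun i => by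
    rw [List.mem_ofFn]
    exact ⟨σ⁻¹ i, by simp⟩
  obtain ⟨h1, h2⟩ := hl (List.ofFn fun i => X (σ i)) fun Y hY => by
    obtain ⟨i, rfl⟩ := (List.mem_ofFn' _ _).1 hY
    exact hc _
  rw [← h1 (hmem a), h2 (hmem b)]

/-- Antisymmetrised traces are compatible with multiplicative maps that preserve the trace. -/
theorem altTrace_map {m' : Type} [Fintype m'] [DecidableEq m'] {k : ℕ} (hk : k ≠ 0)
    {ι : Matrix m m ℂ → Matrix m' m' ℂ} (hmul : ∀ X Y, ι (X * Y) = ι X * ι Y)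
    (htr : ∀ X, (ι X).trace = X.trace) {A : Matrix m m ℂ} {A' : Matrix m' m' ℂ}
    (hA : ∀ X, A' * ι X = ι (A * X)) (X : Fin k → Matrix m m ℂ) :
    altTrace A' (fun i => ι (X i)) = altTrace A X := by
  have hp : ∀ (j : ℕ) (Y : Fin (j + 1) → Matrix m m ℂ),
      (List.ofFn fun i => ι (Y i)).prod = ι (List.ofFn Y).prod := by
    intro j
    induction j with
    | zero => simp
    | succ j ih =>
      intro Y
      rw [List.ofFn_succ, List.prod_cons, ih, List.ofFn_succ (f := Y), List.prod_cons, hmul]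
  obtain ⟨j, rfl⟩ := Nat.exists_eq_succ_of_ne_zero hk
  refine Finset.sum_congr rfl fun σ _ => ?_
  rw [hp j fun i => X (σ i), hA, htr]

theorem contDiffOn_prod_ofFn_entry {V : Type} [NormedAddCommGroup V] [NormedSpace ℝ V] {C : Set V}
    {k : ℕ} {X : Fin k → V → Matrix m m ℂ} (hX : ∀ i a b, ContDiffOn ℝ ∞ (fun y => X i y a b) C)
    (a b : m) : ContDiffOn ℝ ∞ (fun y => (List.ofFn fun i => X i y).prod a b) C := by
  induction k generalizing a b with
  | zero => simpa using contDiffOn_const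
  | succ k ih =>
    simp only [List.ofFn_succ, List.prod_cons, Matrix.mul_apply]
    exact ContDiffOn.sum fun c _ => (hX _ _ _).mul (ih (fun i => hX _) _ _)

theorem contDiffOn_altTrace {V : Type} [NormedAddCommGroup V] [NormedSpace ℝ V] {C : Set V}
    {k : ℕ} {A : V → Matrix m m ℂ} {X : Fin k → V → Matrix m m ℂ}
    (hA : ∀ a b, ContDiffOn ℝ ∞ (fun y => A y a b) C)
    (hX : ∀ i a b, ContDiffOn ℝ ∞ (fun y => X i y a b) C) :
    ContDiffOn ℝ ∞ (fun y => altTrace (A y) fun i => X i y) C := by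
  simp only [altTrace, Matrix.trace, Matrix.diag, Matrix.mul_apply]
  exact ContDiffOn.sum fun σ _ => contDiffOn_const.mul (ContDiffOn.sum fun a _ =>
    ContDiffOn.sum fun b _ => (hA _ _).mul (contDiffOn_prod_ofFn_entry (fun i => hX _) _ _))

end AltTrace

section TracePow

variable {V : Type} [NormedAddCommGroup V] [NormedSpace ℝ V] {p k : ℕ}

theorem tracePow_apply (A : Matrix (Win p) (Win p) ℂ) (θ : V →L[ℝ] Matrix (Win p) (Win p) ℂ)
    (v : Fin k → V) : tracePow k A θ v = altTrace A fun i => θ (v i) := by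
  rw [tracePow, ContinuousMultilinearMap.alternatization_apply_apply, altTrace]
  refine Finset.sum_congr rfl fun σ _ => ?_
  rw [Units.smul_def, zsmul_eq_mul]
  rfl

end TracePow

/-! ### Blocks of stable matrices -/

section Windows

/-- The inclusion of the index set of a block into that of a larger block. -/
def Win.incl {p q : ℕ} (hpq : p ≤ q) (i : Win p) : Win q :=
  ⟨i.1, by
    have := Finset.mem_Ico.1 i.2
    rw [Finset.mem_Ico]
    omega⟩

theorem Win.sum_eq {p q : ℕ} (hpq : p ≤ q) {f : Win q → ℂ}
    (hf : ∀ i : Win q, i.1 ∉ Finset.Ico (-(p : ℤ)) (p : ℤ) → f i = 0) :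
    ∑ i, f i = ∑ i : Win p, f (i.incl hpq) := by
  symm
  refine Fintype.sum_of_injective (Win.incl hpq) (fun a b h => ?_) _ _ (fun i hi => ?_)
    fun _ => rfl
  · exact Subtype.ext (congrArg (fun z : Win q => z.1) h)
  · exact hf i fun h => hi ⟨⟨i.1, h⟩, rfl⟩

variable {p q : ℕ} {b b' : ℤ → ℂ} {A A' : Matrix ℤ ℤ ℂ}

theorem StableAt.apply_eq_zero_left (hA : StableAt (Matrix.diagonal b) p A) {i j : ℤ}
    (hi : i ∉ Finset.Ico (-(p : ℤ)) (p : ℤ)) (hij : i ≠ j) : A i j = 0 := by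
  rw [hA i j (Or.inl hi), Matrix.diagonal_apply_ne _ hij]

theorem StableAt.apply_eq_zero_right (hA : StableAt (Matrix.diagonal b) p A) {i j : ℤ}
    (hj : j ∉ Finset.Ico (-(p : ℤ)) (p : ℤ)) (hij : i ≠ j) : A i j = 0 := by
  rw [hA i j (Or.inr hj), Matrix.diagonal_apply_ne _ hij]

/-- The product of matrices that are diagonal outside of the block of size `p`, computed on a larger
block. -/
theorem window_mul_apply (hA : StableAt (Matrix.diagonal b) p A)
    (hA' : StableAt (Matrix.diagonal b') p A') (hpq : p ≤ q) (i j : Win q) :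
    (window q A * window q A') i j =
      if h : i.1 ∈ Finset.Ico (-(p : ℤ)) (p : ℤ) ∧ j.1 ∈ Finset.Ico (-(p : ℤ)) (p : ℤ) then
        (window p A * window p A') ⟨i.1, h.1⟩ ⟨j.1, h.2⟩
      else if i = j then b i.1 * b' i.1 else 0 := by
  simp only [Matrix.mul_apply, window, Matrix.submatrix_apply]
  by_cases hj : j.1 ∈ Finset.Ico (-(p : ℤ)) (p : ℤ)
  · rw [Win.sum_eq hpq fun k hk => by
      rw [hA'.apply_eq_zero_left (j := j.1) hk (fun h => hk (by rw [h]; exact hj)), mul_zero]]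
    by_cases hi : i.1 ∈ Finset.Ico (-(p : ℤ)) (p : ℤ)
    · rw [dif_pos ⟨hi, hj⟩]
      rfl
    · rw [dif_neg fun h => hi h.1, if_neg fun h => hi (by rw [h]; exact hj)]
      refine Finset.sum_eq_zero fun k _ => ?_
      have h0 : A i.1 (k.incl hpq).1 = 0 :=
        hA.apply_eq_zero_left hi fun h => hi (by rw [h]; exact k.2)
      rw [h0, zero_mul]
  · rw [dif_neg fun h => hj h.2, Finset.sum_eq_single j]
    · rw [hA _ _ (Or.inr hj), hA' _ _ (Or.inr hj), Matrix.diagonal_apply_eq]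
      by_cases hij : i = j
      · rw [if_pos hij, hij, Matrix.diagonal_apply_eq]
      · rw [if_neg hij, Matrix.diagonal_apply_ne _ fun h => hij (Subtype.ext h), zero_mul]
    · intro k _ hk
      rw [hA'.apply_eq_zero_right hj (fun h => hk (Subtype.ext h)), mul_zero]
    · simp

/-- The extension by zero of a matrix to a larger block. -/
def extendZero (q : ℕ) {p : ℕ} (X : Matrix (Win p) (Win p) ℂ) : Matrix (Win q) (Win q) ℂ :=
  window q (padWin 0 p X)

theorem extendZero_apply (q : ℕ) (X : Matrix (Win p) (Win p) ℂ) (i j : Win q) :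
    extendZero q X i j =
      if h : i.1 ∈ Finset.Ico (-(p : ℤ)) (p : ℤ) ∧ j.1 ∈ Finset.Ico (-(p : ℤ)) (p : ℤ) then
        X ⟨i.1, h.1⟩ ⟨j.1, h.2⟩
      else 0 := rfl

theorem stableAt_padWin_zero (X : Matrix (Win p) (Win p) ℂ) :
    StableAt (Matrix.diagonal fun _ => 0) p (padWin 0 p X) := by
  rw [Matrix.diagonal_zero]
  exact stableAt_padWin 0 p X

theorem window_mul_extendZero (hA : StableAt (Matrix.diagonal b) p A) (hpq : p ≤ q)
    (X : Matrix (Win p) (Win p) ℂ) :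
    window q A * extendZero q X = extendZero q (window p A * X) := by
  ext i j
  rw [extendZero, window_mul_apply hA (stableAt_padWin_zero X) hpq, extendZero_apply,
    window_padWin]
  simp

theorem extendZero_mul (hpq : p ≤ q) (X Y : Matrix (Win p) (Win p) ℂ) :
    extendZero q (X * Y) = extendZero q X * extendZero q Y := by
  have h := window_mul_extendZero (stableAt_padWin_zero X) hpq Y
  rw [window_padWin] at h
  exact h.symm

theorem trace_extendZero (hpq : p ≤ q) (X : Matrix (Win p) (Win p) ℂ) :
    (extendZero q X).trace = X.trace := by
  simp only [Matrix.trace, Matrix.diag]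
  rw [Win.sum_eq hpq fun i hi => by rw [extendZero_apply, dif_neg fun h => hi h.1]]
  refine Finset.sum_congr rfl fun i _ => ?_
  rw [extendZero_apply, dif_pos ⟨i.2, i.2⟩]
  rfl

theorem StableAt.conjTranspose (hA : StableAt (Matrix.diagonal b) p A) :
    StableAt (Matrix.diagonal fun i => star (b i)) p A.conjTranspose := by
  intro i j hij
  rw [Matrix.conjTranspose_apply, hA j i hij.symm]
  by_cases h : i = j
  · rw [h, Matrix.diagonal_apply_eq, Matrix.diagonal_apply_eq]
  · rw [Matrix.diagonal_apply_ne _ h, Matrix.diagonal_apply_ne _ (Ne.symm h), star_zero]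

theorem window_conjTranspose (p : ℕ) (A : Matrix ℤ ℤ ℂ) :
    window p A.conjTranspose = (window p A).conjTranspose := rfl

theorem stableAt_one_iff : StableAt 1 p A ↔ StableAt (Matrix.diagonal fun _ => 1) p A := by
  rw [Matrix.diagonal_one]

/-- For matrices that are diagonal outside of the block of size `p`, with diagonals that satisfy the
equation, an equation `A A' = A''` on that block is equivalent to the one on any larger block. -/
theorem window_mul_eq_iff {b'' : ℤ → ℂ} {A'' : Matrix ℤ ℤ ℂ}
    (hA : StableAt (Matrix.diagonal b) p A) (hA' : StableAt (Matrix.diagonal b') p A')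
    (hA'' : StableAt (Matrix.diagonal b'') p A'') (hb : ∀ i, b i * b' i = b'' i) (hpq : p ≤ q) :
    window q A * window q A' = window q A'' ↔ window p A * window p A' = window p A'' := by
  constructor
  · intro h
    ext i j
    have h1 := window_mul_apply hA hA' hpq (i.incl hpq) (j.incl hpq)
    rw [h, dif_pos ⟨i.2, j.2⟩] at h1
    exact h1.symm
  · intro h
    ext i j
    rw [window_mul_apply hA hA' hpq]
    split_ifs with h1 h2
    · rw [h]
      rfl
    · have h3 : i.1 ∉ Finset.Ico (-(p : ℤ)) (p : ℤ) := fun h => h1 ⟨h, h2 ▸ h⟩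
      rw [hb, ← h2, window, Matrix.submatrix_apply, hA'' _ _ (Or.inl h3), Matrix.diagonal_apply_eq]
    · rw [window, Matrix.submatrix_apply, hA'' _ _ (by tauto),
        Matrix.diagonal_apply_ne _ fun h => h2 (Subtype.ext h)]

theorem window_mul_eq_of_window_mul_eq {b'' : ℤ → ℂ} {A'' : Matrix ℤ ℤ ℂ} {r : ℕ}
    (hA : StableAt (Matrix.diagonal b) p A) (hA' : StableAt (Matrix.diagonal b') p A')
    (hA'' : StableAt (Matrix.diagonal b'') p A'') (hb : ∀ i, b i * b' i = b'' i)
    (hr : StableAt (Matrix.diagonal b) r A) (hr' : StableAt (Matrix.diagonal b') r A')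
    (hr'' : StableAt (Matrix.diagonal b'') r A'')
    (h : window r A * window r A' = window r A'') : window p A * window p A' = window p A'' :=
  (window_mul_eq_iff hA hA' hA'' hb (le_max_left p r)).1
    ((window_mul_eq_iff hr hr' hr'' hb (le_max_right p r)).2 h)

theorem window_one (p : ℕ) : window p (1 : Matrix ℤ ℤ ℂ) = 1 := by
  ext i j
  rw [window, Matrix.submatrix_apply, Matrix.one_apply, Matrix.one_apply]
  simp only [Subtype.ext_iff]

theorem StableU.conjTranspose_mul (u : StableU) (hp : StableAt 1 p u.1) :
    (window p u.1).conjTranspose * window p u.1 = 1 := by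
  obtain ⟨r, hr, hu⟩ := u.2
  rw [Matrix.mem_unitaryGroup_iff', Matrix.star_eq_conjTranspose] at hu
  rw [stableAt_one_iff] at hp hr
  have h1 : ∀ s : ℕ, StableAt (Matrix.diagonal fun _ => 1) s (1 : Matrix ℤ ℤ ℂ) := fun s => by
    rw [Matrix.diagonal_one]
    exact fun _ _ _ => rfl
  have h := window_mul_eq_of_window_mul_eq hp.conjTranspose hp (h1 p) (by simp) hr.conjTranspose hr
    (h1 r) (by rw [window_conjTranspose, hu, window_one])
  rwa [window_conjTranspose, window_one] at h

theorem StableU.inv_window (u : StableU) (hp : StableAt 1 p u.1) :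
    (window p u.1)⁻¹ = (window p u.1).conjTranspose :=
  Matrix.inv_eq_left_inv (u.conjTranspose_mul hp)

theorem BUZ.window_mul_self (P : BUZ) (hp : StableAt (stdProj 0) p P.1.1) :
    window p P.1.1 * window p P.1.1 = window p P.1.1 := by
  obtain ⟨r, hr, hP⟩ := P.2
  exact window_mul_eq_of_window_mul_eq hp hp hp (by simp) hr hr hr hP

theorem BUZ.conjTranspose_window (P : BUZ) (p : ℕ) :
    (window p P.1.1).conjTranspose = window p P.1.1 :=
  P.1.2.2.1.isHermitian.submatrix _

/-- Enlarging the block by one on both sides adds one diagonal entry `1` and one entry `0`. -/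
theorem trace_window_stdProj {P : Matrix ℤ ℤ ℂ} (hp : StableAt (stdProj 0) p P) (hpq : p ≤ q) :
    (window q P).trace - q = (window p P).trace - p := by
  obtain ⟨n, rfl⟩ := Nat.exists_eq_add_of_le hpq
  clear hpq
  induction n with
  | zero => simp
  | succ n ih =>
    rw [← ih, ← add_assoc]
    have hs : StableAt (stdProj 0) (p + n) P := hp.mono (Nat.le_add_right _ _)
    set r := p + n
    have h1 : ∀ s : ℕ, (window s P).trace = ∑ i ∈ Finset.Ico (-(s : ℤ)) s, P i i := fun s =>
      Finset.sum_coe_sort (Finset.Ico (-(s : ℤ)) (s : ℤ)) fun i => P i i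
    have h2 : Finset.Ico (-((r + 1 : ℕ) : ℤ)) ((r + 1 : ℕ) : ℤ)
        = insert (-(r : ℤ) - 1) (insert (r : ℤ) (Finset.Ico (-(r : ℤ)) (r : ℤ))) := by
      ext i
      simp only [Finset.mem_insert, Finset.mem_Ico]
      push_cast
      omega
    have h3 : P (-(r : ℤ) - 1) (-(r : ℤ) - 1) = 1 := by
      rw [hs _ _ (Or.inl (by simp)), stdProj, Matrix.diagonal_apply_eq, if_pos (by omega)]
    have h4 : P (r : ℤ) (r : ℤ) = 0 := by
      rw [hs _ _ (Or.inl (by simp)), stdProj, Matrix.diagonal_apply_eq, if_neg (by omega)]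
    rw [h1, h1, h2, Finset.sum_insert, Finset.sum_insert, h3, h4]
    · push_cast
      ring
    · simp
    · simp only [Finset.mem_insert, Finset.mem_Ico]
      omega

theorem rank_eq_trace {m : Type} [Fintype m] [DecidableEq m] {X : Matrix m m ℂ}
    (hX : X * X = X) : (X.rank : ℂ) = X.trace := by
  have h : IsIdempotentElem (Matrix.toLin' X) := by
    show (Matrix.toLin' X).comp (Matrix.toLin' X) = Matrix.toLin' X
    rw [← Matrix.toLin'_mul, hX]
  have h1 := (LinearMap.IsIdempotentElem.isProj_range _ h).trace
  rw [Matrix.trace_toLin'_eq] at h1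
  rw [h1]
  rfl

theorem BUZ.rank_eq_trace (P : BUZ) (hp : StableAt (stdProj 0) p P.1.1) :
    (P.rank : ℂ) = (window p P.1.1).trace - p := by
  rw [trace_window_stdProj (stableAt_stage P.1) (Nat.sInf_le hp), BUZ.rank]
  push_cast
  rw [BottForm.rank_eq_trace (P.window_mul_self (stableAt_stage P.1))]

end Windows

/-! ### Stable families and their derivatives -/

section Families

variable {V : Type} [NormedAddCommGroup V] [NormedSpace ℝ V] {p q : ℕ} {b : ℤ → ℂ}
  {B : Matrix ℤ ℤ ℂ} {C : Set V} {F : V → Matrix ℤ ℤ ℂ} {x : V}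

theorem localStage_spec {V : Type} [NormedAddCommGroup V] {C : Set V}
    {F : V → Matrix ℤ ℤ ℂ} {x : V} (h : ∀ᶠ y in 𝓝[C] x, StableAt B p (F y)) :
    localStage B C F x ≤ p ∧ ∀ᶠ y in 𝓝[C] x, StableAt B (localStage B C F x) (F y) :=
  ⟨Nat.sInf_le h, Nat.sInf_mem (s := {p : ℕ | ∀ᶠ y in 𝓝[C] x, StableAt B p (F y)}) ⟨p, h⟩⟩

theorem dMat_apply_apply (p : ℕ) (v : V) (i j : Win p) :
    dMat p C F x v i j = fderivWithin ℝ (fun y => F y i.1 j.1) C x v := rfl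

theorem dMat_eq_extendZero (h : ∀ᶠ y in 𝓝[C] x, StableAt B p (F y)) (hx : x ∈ C) (q : ℕ)
    (v : V) : dMat q C F x v = extendZero q (dMat p C F x v) := by
  ext i j
  rw [dMat_apply_apply, extendZero_apply]
  split_ifs with hij
  · rfl
  · have h1 : (fun y => F y i.1 j.1) =ᶠ[𝓝[C] x] fun _ => B i.1 j.1 :=
      h.mono fun y hy => hy _ _ (by tauto)
    rw [h1.fderivWithin_eq (h1.self_of_nhdsWithin hx)]
    simp

theorem dMat_comp {V' : Type} [NormedAddCommGroup V'] [NormedSpace ℝ V'] {C' : Set V'}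
    {F' : V' → Matrix ℤ ℤ ℂ} {θ : V' → V} {x : V'} (hC' : UniqueDiffOn ℝ C')
    (hF : ∀ i j, DifferentiableWithinAt ℝ (fun y => F y i j) C (θ x))
    (hθ : DifferentiableWithinAt ℝ θ C' x) (hm : MapsTo θ C' C) (he : EqOn F' (F ∘ θ) C')
    (hx : x ∈ C') (p : ℕ) (v : V') :
    dMat p C' F' x v = dMat p C F (θ x) (fderivWithin ℝ θ C' x v) := by
  ext i j
  rw [dMat_apply_apply, dMat_apply_apply]
  have h1 : EqOn (fun y => F' y i.1 j.1) ((fun y => F y i.1 j.1) ∘ θ) C' := fun y hy => by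
    simp only [Function.comp, he hy]
  rw [fderivWithin_congr h1 (h1 hx), fderivWithin_comp x (hF _ _) hθ hm (hC' x hx)]
  rfl

theorem contDiffOn_dMat (hC : UniqueDiffOn ℝ C) (hF : ∀ i j, ContDiffOn ℝ ∞ (fun y => F y i j) C)
    (p : ℕ) (v : V) (i j : Win p) : ContDiffOn ℝ ∞ (fun y => dMat p C F y v i j) C :=
  ((contDiffOn_infty_iff_fderivWithin hC).1 (hF i.1 j.1)).2.clm_apply contDiffOn_const

end Families

/-! ### Derivatives of unitary matrices and projections -/

section Families

variable {V : Type} [NormedAddCommGroup V] [NormedSpace ℝ V] {p : ℕ}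
  {C : Set V} {F G : V → Matrix ℤ ℤ ℂ} {x : V}

theorem StableSmoothOn.differentiableWithinAt {B : Matrix ℤ ℤ ℂ}
    (hF : StableSmoothOn B C F) (hx : x ∈ C) (i j : ℤ) :
    DifferentiableWithinAt ℝ (fun y => F y i j) C x :=
  (hF.2 i j).differentiableOn (by simp) x hx

theorem contDiffOn_conj {g : V → ℂ} (hg : ContDiffOn ℝ ∞ g C) :
    ContDiffOn ℝ ∞ (fun y => star (g y)) C :=
  Complex.conjCLE.toContinuousLinearMap.contDiff.comp_contDiffOn hg

/-- The Leibniz rule for blocks. -/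
theorem fderivWithin_window_mul (hC : UniqueDiffWithinAt ℝ C x)
    (hF : ∀ i j, DifferentiableWithinAt ℝ (fun y => F y i j) C x)
    (hG : ∀ i j, DifferentiableWithinAt ℝ (fun y => G y i j) C x) (v : V) (i j : Win p) :
    fderivWithin ℝ (fun y => (window p (F y) * window p (G y)) i j) C x v
      = (dMat p C F x v * window p (G x) + window p (F x) * dMat p C G x v) i j := by
  have h : HasFDerivWithinAt (fun y => (window p (F y) * window p (G y)) i j)
      (∑ c : Win p, (F x i.1 c.1 • fderivWithin ℝ (fun y => G y c.1 j.1) C x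
        + G x c.1 j.1 • fderivWithin ℝ (fun y => F y i.1 c.1) C x)) C x := by
    simp only [Matrix.mul_apply, window, Matrix.submatrix_apply]
    exact HasFDerivWithinAt.fun_sum fun c _ =>
      (hF _ _).hasFDerivWithinAt.mul (hG _ _).hasFDerivWithinAt
  rw [h.fderivWithin hC, sum_apply, Matrix.add_apply, Matrix.mul_apply,
    Matrix.mul_apply, ← Finset.sum_add_distrib]
  refine Finset.sum_congr rfl fun c _ => ?_
  simp only [add_apply, smul_apply, smul_eq_mul,
    dMat_apply_apply, window, Matrix.submatrix_apply]
  ring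

theorem dMat_conjTranspose (hC : UniqueDiffWithinAt ℝ C x)
    (hF : ∀ i j, DifferentiableWithinAt ℝ (fun y => F y i j) C x) (v : V) :
    dMat p C (fun y => (F y).conjTranspose) x v = (dMat p C F x v).conjTranspose := by
  ext i j
  have h := (Complex.conjCLE.toContinuousLinearMap.hasFDerivAt.comp_hasFDerivWithinAt x
    (hF j.1 i.1).hasFDerivWithinAt).fderivWithin hC
  exact congrArg (fun L : V →L[ℝ] ℂ => L v) h

/-- `(g* dg)* = - g* dg` for unitary `g`. -/
theorem conjTranspose_maurerCartan {f : V → StableU} (hC : UniqueDiffWithinAt ℝ C x)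
    (hF : ∀ i j, DifferentiableWithinAt ℝ (fun y => (f y).1 i j) C x) (hx : x ∈ C)
    (hp : ∀ᶠ y in 𝓝[C] x, StableAt 1 p (f y).1) (v : V) :
    ((window p (f x).1).conjTranspose * dMat p C (fun y => (f y).1) x v).conjTranspose
      = -((window p (f x).1).conjTranspose * dMat p C (fun y => (f y).1) x v) := by
  have hF' : ∀ i j, DifferentiableWithinAt ℝ (fun y => (f y).1.conjTranspose i j) C x :=
    fun i j => Complex.conjCLE.toContinuousLinearMap.differentiableAt.comp_differentiableWithinAt
      x (hF j i)
  rw [Matrix.conjTranspose_mul, Matrix.conjTranspose_conjTranspose, eq_neg_iff_add_eq_zero]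
  ext i j
  have h := fderivWithin_window_mul (p := p) hC hF' hF v i j
  rw [dMat_conjTranspose hC hF] at h
  refine h.symm.trans ?_
  have h1 : (fun y => (window p (f y).1.conjTranspose * window p (f y).1) i j) =ᶠ[𝓝[C] x]
      fun _ => (1 : Matrix (Win p) (Win p) ℂ) i j := hp.mono fun y hy => by
    simp only [window_conjTranspose, (f y).conjTranspose_mul hy]
  rw [h1.fderivWithin_eq (h1.self_of_nhdsWithin hx)]
  simp

/-- `P dP + dP P = dP` for projections `P`. -/
theorem projection_mul_dMat {f : V → BUZ} (hC : UniqueDiffWithinAt ℝ C x)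
    (hF : ∀ i j, DifferentiableWithinAt ℝ (fun y => (f y).1.1 i j) C x) (hx : x ∈ C)
    (hp : ∀ᶠ y in 𝓝[C] x, StableAt (stdProj 0) p (f y).1.1) (v : V) :
    window p (f x).1.1 * dMat p C (fun y => (f y).1.1) x v
      + dMat p C (fun y => (f y).1.1) x v * window p (f x).1.1
      = dMat p C (fun y => (f y).1.1) x v := by
  ext i j
  have h := fderivWithin_window_mul (p := p) hC hF hF v i j
  rw [add_comm, ← h]
  have h1 : (fun y => (window p (f y).1.1 * window p (f y).1.1) i j) =ᶠ[𝓝[C] x]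
      fun y => (f y).1.1 i.1 j.1 := hp.mono fun y hy => by
    simp only [(f y).window_mul_self hy]
    rfl
  rw [h1.fderivWithin_eq (h1.self_of_nhdsWithin hx)]
  rfl

theorem conjTranspose_dMat_projection {f : V → BUZ} (hC : UniqueDiffWithinAt ℝ C x)
    (hF : ∀ i j, DifferentiableWithinAt ℝ (fun y => (f y).1.1 i j) C x) (v : V) :
    (dMat p C (fun y => (f y).1.1) x v).conjTranspose = dMat p C (fun y => (f y).1.1) x v := by
  rw [← dMat_conjTranspose hC hF]
  have h : (fun y => (f y).1.1.conjTranspose) = fun y => (f y).1.1 :=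
    funext fun y => (f y).1.2.2.1.isHermitian
  rw [h]

end Families

/-! ### The universal Chern forms -/

section ChernForms

variable {V : Type} [NormedAddCommGroup V] [NormedSpace ℝ V] [FiniteDimensional ℝ V]
  {p : ℕ} {C : Set V} {x : V}

/-- The coefficient of `Tr (g⁻¹dg)^{2n+1}` in the odd Chern form. -/
def oddCoeff (n : ℕ) : ℂ :=
  (-1 : ℂ) ^ n / (2 * Real.pi * Complex.I) ^ (n + 1) *
    ((n.factorial : ℂ) / ((2 * n + 1).factorial : ℂ))

/-- The coefficient of `Tr P(dP)^{2n}` in the even Chern form. -/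
def evenCoeff (n : ℕ) : ℂ :=
  1 / (2 * Real.pi * Complex.I : ℂ) ^ n * (1 / (n.factorial : ℂ))

/-- The parity of the odd coefficients matches `star_altTrace_skew`, so that the odd Chern form is
real. -/
theorem star_oddCoeff (n : ℕ) : star (oddCoeff n) = (-1) ^ (n + 1) * oddCoeff n := by
  have h : ((-1 : ℂ) ^ (n + 1)) * (-1) ^ (n + 1) = 1 := by
    rw [← mul_pow]; simp
  simp only [oddCoeff, Complex.star_def, map_mul, map_div₀, map_pow, map_neg, map_one,
    Complex.conj_I, Complex.conj_ofReal, map_natCast, map_ofNat, mul_neg]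
  rw [neg_pow (2 * (Real.pi : ℂ) * Complex.I)]
  have h1 : (2 * (Real.pi : ℂ) * Complex.I) ^ (n + 1) ≠ 0 := pow_ne_zero _ Complex.two_pi_I_ne_zero
  have h2 : (-1 : ℂ) ^ (n + 1) ≠ 0 := pow_ne_zero _ (by simp)
  field_simp
  linear_combination -h

/-- The parity of the even coefficients matches `star_altTrace_projection`, so that the even Chern
form is real. -/
theorem star_evenCoeff (n : ℕ) : star (evenCoeff n) = (-1) ^ n * evenCoeff n := by
  have h : ((-1 : ℂ) ^ n) * (-1) ^ n = 1 := by
    rw [← mul_pow]; simp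
  simp only [evenCoeff, Complex.star_def, map_mul, map_div₀, map_pow, map_one,
    Complex.conj_I, Complex.conj_ofReal, map_natCast, map_ofNat, mul_neg]
  rw [neg_pow (2 * (Real.pi : ℂ) * Complex.I)]
  have h1 : (2 * (Real.pi : ℂ) * Complex.I) ^ n ≠ 0 := pow_ne_zero _ Complex.two_pi_I_ne_zero
  have h2 : (-1 : ℂ) ^ n ≠ 0 := pow_ne_zero _ (by simp)
  field_simp
  linear_combination -h

/-- The odd Chern form can be computed on any stage that contains the family locally; on unitary
matrices the inverse is the adjoint. -/
theorem ChU_apply {f : V → StableU} (hx : x ∈ C) (hp : ∀ᶠ y in 𝓝[C] x, StableAt 1 p (f y).1)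
    {k : ℕ} (hk : Odd k) (v : Fin k → V) :
    ChU k V C f x v = oddCoeff (k / 2) * altTrace 1 fun i =>
      (window p (f x).1).conjTranspose * dMat p C (fun y => (f y).1) x (v i) := by
  obtain ⟨hle, hq⟩ := localStage_spec hp
  simp only [ChU, if_pos hk]
  rw [ContinuousAlternatingMap.smul_apply, tracePow_apply, smul_eq_mul]
  congr 1
  set q := localStage 1 C (fun y => (f y).1) x
  have hqx := hq.self_of_nhdsWithin hx
  have hk0 : k ≠ 0 := fun h => by simp [h] at hk
  rw [← altTrace_map hk0 (ι := extendZero p) (extendZero_mul hle) (trace_extendZero hle)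
    (A' := 1) (fun X => by rw [one_mul, one_mul])]
  congr 1
  funext i
  show extendZero p ((window q (f x).1)⁻¹ * dMat q C (fun y => (f y).1) x (v i)) = _
  rw [(f x).inv_window hqx, dMat_eq_extendZero hq hx p, ← window_conjTranspose,
    ← window_conjTranspose, window_mul_extendZero (stableAt_one_iff.1 hqx).conjTranspose hle]

theorem ChU_of_not_odd {f : V → StableU} {k : ℕ} (hk : ¬ Odd k) : ChU k V C f x = 0 := by
  simp only [ChU, if_neg hk]

/-- The components of positive degree of the even Chern form can be computed on any stage that
contains the family locally. -/
theorem ChBU_apply {f : V → BUZ} (hx : x ∈ C)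
    (hp : ∀ᶠ y in 𝓝[C] x, StableAt (stdProj 0) p (f y).1.1) {k : ℕ} (hk : Even k) (hk0 : k ≠ 0)
    (v : Fin k → V) :
    ChBU k V C f x v = evenCoeff (k / 2) * altTrace (window p (f x).1.1) fun i =>
      dMat p C (fun y => (f y).1.1) x (v i) := by
  obtain ⟨hle, hq⟩ := localStage_spec hp
  obtain ⟨m, rfl⟩ := Nat.exists_eq_succ_of_ne_zero hk0
  simp only [ChBU, Nat.succ_eq_add_one] at hk ⊢
  rw [if_pos hk, ContinuousAlternatingMap.smul_apply, tracePow_apply, smul_eq_mul]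
  congr 1
  set q := localStage (stdProj 0) C (fun y => (f y).1.1) x
  rw [← altTrace_map (Nat.succ_ne_zero m) (ι := extendZero p) (extendZero_mul hle)
    (trace_extendZero hle) (window_mul_extendZero (hq.self_of_nhdsWithin hx) hle)]
  congr 1
  funext i
  exact (dMat_eq_extendZero hq hx p _).symm

theorem ChBU_zero_apply {f : V → BUZ} (hx : x ∈ C)
    (hp : ∀ᶠ y in 𝓝[C] x, StableAt (stdProj 0) p (f y).1.1) (v : Fin 0 → V) :
    ChBU 0 V C f x v = (window p (f x).1.1).trace - p := by
  rw [← (f x).rank_eq_trace (hp.self_of_nhdsWithin hx)]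
  rfl

theorem ChBU_of_not_even {f : V → BUZ} {k : ℕ} (hk : ¬ Even k) : ChBU k V C f x = 0 := by
  cases k with
  | zero => simp at hk
  | succ m => simp only [ChBU, if_neg hk]

theorem ChU_isOdd : ChU.IsOdd := fun _ _ _ _ _ _ _ _ _ hk _ _ =>
  ChU_of_not_odd (Nat.not_odd_iff_even.2 hk)

theorem ChBU_isEven : ChBU.IsEven := fun _ _ _ _ _ _ _ _ _ hk _ _ =>
  ChBU_of_not_even (Nat.not_even_iff_odd.2 hk)

theorem isPlot_stableU_iff {f : V → StableU} :
    ChenSpace.IsPlot C f ↔ StableSmoothOn 1 C fun y => (f y).1 := Iff.rfl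

theorem isPlot_buz_iff {f : V → BUZ} :
    ChenSpace.IsPlot C f ↔ StableSmoothOn (stdProj 0) C fun y => (f y).1.1 := Iff.rfl

theorem ChU_isForm : ChU.IsForm where
  smooth k V _ _ _ C f hC hf := by
    rw [isPlot_stableU_iff] at hf
    by_cases hk : Odd k
    · refine contDiffOn_alternating_iff.2 fun v x hx => ?_
      obtain ⟨p, hp⟩ := hf.1 x hx
      have h : ContDiffOn ℝ ∞ (fun y => oddCoeff (k / 2) * altTrace 1 fun i =>
          (window p (f y).1).conjTranspose * dMat p C (fun y => (f y).1) y (v i)) C := by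
        refine contDiffOn_const.mul (contDiffOn_altTrace (fun _ _ => contDiffOn_const)
          fun i a b => ?_)
        simp only [Matrix.mul_apply]
        exact ContDiffOn.sum fun c _ => (contDiffOn_conj (hf.2 c.1 a.1)).mul
          (contDiffOn_dMat hC.uniqueDiffOn hf.2 p (v i) c b)
      refine (h x hx).congr_of_eventuallyEq_of_mem ?_ hx
      filter_upwards [eventually_eventually_nhdsWithin.2 hp, self_mem_nhdsWithin] with y hy hyC
      exact ChU_apply hyC hy hk v
    · exact (contDiffOn_const (c := 0)).congr fun y _ => ChU_of_not_odd hk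
  real k V _ _ _ C f hC hf x hx v := by
    rw [isPlot_stableU_iff] at hf
    by_cases hk : Odd k
    · obtain ⟨p, hp⟩ := hf.1 x hx
      rw [← Complex.conj_eq_iff_im, ChU_apply hx hp hk]
      obtain ⟨n, rfl⟩ := hk
      have h2 : (2 * n + 1) / 2 = n := by omega
      have h := star_altTrace_skew fun i => conjTranspose_maurerCartan (hC.uniqueDiffOn x hx)
        (hf.differentiableWithinAt hx) hx hp (v i)
      rw [map_mul, ← Complex.star_def, h2, star_oddCoeff, h]
      have h3 : ((-1 : ℂ) ^ (n + 1)) * (-1) ^ (n + 1) = 1 := by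
        rw [← mul_pow]; simp
      linear_combination (oddCoeff n * altTrace 1 fun i =>
        (window p (f x).1).conjTranspose * dMat p C (fun y => (f y).1) x (v i)) * h3
    · rw [ChU_of_not_odd hk]
      simp
  natural k V V' _ _ _ _ _ _ C C' f f' θ hC hC' hf hf' hθ hm he x hx := by
    rw [isPlot_stableU_iff] at hf
    by_cases hk : Odd k
    · ext v
      obtain ⟨p, hp⟩ := hf.1 _ (hm hx)
      have hp' : ∀ᶠ y in 𝓝[C'] x, StableAt 1 p (f' y).1 := by
        have ht : Tendsto θ (𝓝[C'] x) (𝓝[C] (θ x)) :=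
          (hθ.continuousOn x hx).tendsto_nhdsWithin hm
        filter_upwards [ht.eventually hp, self_mem_nhdsWithin] with y hy hyC
        rw [he hyC]
        exact hy
      rw [ContinuousAlternatingMap.compContinuousLinearMap_apply, ChU_apply hx hp' hk,
        ChU_apply (hm hx) hp hk]
      congr 2
      funext i
      rw [dMat_comp hC'.uniqueDiffOn (hf.differentiableWithinAt (hm hx))
        (hθ.differentiableOn (by simp) x hx) hm (fun y hy => by simp only [he hy]; rfl) hx, he hx]
      rfl
    · rw [ChU_of_not_odd hk, ChU_of_not_odd hk]
      rfl

theorem ChBU_isForm : ChBU.IsForm where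
  smooth k V _ _ _ C f hC hf := by
    rw [isPlot_buz_iff] at hf
    by_cases hk : Even k
    · refine contDiffOn_alternating_iff.2 fun v x hx => ?_
      obtain ⟨p, hp⟩ := hf.1 x hx
      by_cases hk0 : k = 0
      · subst hk0
        have h : ContDiffOn ℝ ∞ (fun y => (window p (f y).1.1).trace - (p : ℂ)) C :=
          (ContDiffOn.sum fun a _ => hf.2 a.1 a.1).sub contDiffOn_const
        refine (h x hx).congr_of_eventuallyEq_of_mem ?_ hx
        filter_upwards [eventually_eventually_nhdsWithin.2 hp, self_mem_nhdsWithin] with y hy hyC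
        exact ChBU_zero_apply hyC hy v
      have h : ContDiffOn ℝ ∞ (fun y => evenCoeff (k / 2) * altTrace (window p (f y).1.1) fun i =>
          dMat p C (fun y => (f y).1.1) y (v i)) C :=
        contDiffOn_const.mul (contDiffOn_altTrace (fun a b => hf.2 a.1 b.1)
          fun i a b => contDiffOn_dMat hC.uniqueDiffOn hf.2 p (v i) a b)
      refine (h x hx).congr_of_eventuallyEq_of_mem ?_ hx
      filter_upwards [eventually_eventually_nhdsWithin.2 hp, self_mem_nhdsWithin] with y hy hyC
      exact ChBU_apply hyC hy hk hk0 v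
    · exact (contDiffOn_const (c := 0)).congr fun y _ => ChBU_of_not_even hk
  real k V _ _ _ C f hC hf x hx v := by
    by_cases hk0 : k = 0
    · subst hk0
      show ((((f x).rank : ℤ) : ℂ)).im = 0
      simp
    rw [isPlot_buz_iff] at hf
    by_cases hk : Even k
    · obtain ⟨p, hp⟩ := hf.1 x hx
      rw [← Complex.conj_eq_iff_im, ChBU_apply hx hp hk hk0]
      obtain ⟨n, rfl⟩ := (even_iff_exists_two_mul).1 hk
      have h2 : (2 * n) / 2 = n := by omega
      have h := star_altTrace_projection ((f x).conjTranspose_window p)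
        (fun i => conjTranspose_dMat_projection (hC.uniqueDiffOn x hx)
          (hf.differentiableWithinAt hx) (v i))
        fun i => projection_mul_dMat (hC.uniqueDiffOn x hx)
          (hf.differentiableWithinAt hx) hx hp (v i)
      rw [map_mul, ← Complex.star_def, h2, star_evenCoeff, h]
      have h3 : ((-1 : ℂ) ^ n) * (-1) ^ n = 1 := by
        rw [← mul_pow]; simp
      linear_combination (evenCoeff n * altTrace (window p (f x).1.1) fun i =>
        dMat p C (fun y => (f y).1.1) x (v i)) * h3
    · rw [ChBU_of_not_even hk]
      simp
  natural k V V' _ _ _ _ _ _ C C' f f' θ hC hC' hf hf' hθ hm he x hx := by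
    by_cases hk0 : k = 0
    · subst hk0
      ext v
      show (((f' x).rank : ℤ) : ℂ) = (((f (θ x)).rank : ℤ) : ℂ)
      rw [he hx]
      rfl
    rw [isPlot_buz_iff] at hf
    by_cases hk : Even k
    · ext v
      obtain ⟨p, hp⟩ := hf.1 _ (hm hx)
      have hp' : ∀ᶠ y in 𝓝[C'] x, StableAt (stdProj 0) p (f' y).1.1 := by
        have ht : Tendsto θ (𝓝[C'] x) (𝓝[C] (θ x)) :=
          (hθ.continuousOn x hx).tendsto_nhdsWithin hm
        filter_upwards [ht.eventually hp, self_mem_nhdsWithin] with y hy hyC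
        rw [he hyC]
        exact hy
      rw [ContinuousAlternatingMap.compContinuousLinearMap_apply, ChBU_apply hx hp' hk hk0,
        ChBU_apply (hm hx) hp hk hk0]
      rw [he hx]
      congr 2
      funext i
      rw [dMat_comp hC'.uniqueDiffOn (hf.differentiableWithinAt (hm hx))
        (hθ.differentiableOn (by simp) x hx) hm (fun y hy => by simp only [he hy]; rfl) hx]
      rfl
    · rw [ChBU_of_not_even hk, ChBU_of_not_even hk]
      rfl

end ChernForms

/-! ### Invariant forms on groups of units -/

theorem minSmoothness_two_le_infty : minSmoothness ℝ 2 ≤ ∞ := by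
  rw [minSmoothness_of_isRCLikeNormedField]
  exact WithTop.coe_le_coe.2 (le_top : (2 : ℕ∞) ≤ ⊤)

section UnitForm

variable {A : Type} [NormedRing A] [NormedAlgebra ℝ A] (τ : A →L[ℝ] ℂ)

/-- The left invariant form `τ (g⁻¹dg)^k` on the group of units of a normed algebra, without a
factor `1 / k!` in the antisymmetrisation. It is extended to all of `A` by `Ring.inverse`. -/
def unitForm (k : ℕ) (g : A) : A [⋀^Fin k]→L[ℝ] ℂ :=
  ContinuousMultilinearMap.alternatization (τ.compContinuousMultilinearMap
    ((ContinuousMultilinearMap.mkPiAlgebraFin ℝ k A).compContinuousLinearMap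
      fun _ => ContinuousLinearMap.mul ℝ A (Ring.inverse g)))

theorem unitForm_apply (k : ℕ) (g : A) (v : Fin k → A) :
    unitForm τ k g v = ∑ σ : Equiv.Perm (Fin k), Equiv.Perm.sign σ •
      τ (List.ofFn fun i => Ring.inverse g * v (σ i)).prod := by
  rw [unitForm, ContinuousMultilinearMap.alternatization_apply_apply]
  rfl

/-- Left invariance. -/
theorem unitForm_mul (k : ℕ) (u : Aˣ) {g : A} (hg : IsUnit g) :
    (unitForm τ k (u * g)).compContinuousLinearMap (ContinuousLinearMap.mul ℝ A u)
      = unitForm τ k g := by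
  obtain ⟨w, rfl⟩ := hg
  ext v
  rw [ContinuousAlternatingMap.compContinuousLinearMap_apply, unitForm_apply, unitForm_apply]
  refine Finset.sum_congr rfl fun σ _ => ?_
  rw [← Units.val_mul, Ring.inverse_unit, Ring.inverse_unit]
  simp [mul_assoc]

variable {τ}

theorem prod_ofFn_conj {A : Type} [Ring A] {k : ℕ} (u : Aˣ) (v : Fin k → A) :
    (List.ofFn fun i => -(v i * ((u⁻¹ : Aˣ) : A))).prod
      = (-1) ^ k * (u * (List.ofFn fun i => ((u⁻¹ : Aˣ) : A) * v i).prod * ((u⁻¹ : Aˣ) : A)) := by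
  induction k with
  | zero => simp
  | succ k ih =>
    rw [List.ofFn_succ, List.prod_cons, ih, List.ofFn_succ, List.prod_cons, pow_succ]
    rcases neg_one_pow_eq_or A k with h | h <;> simp [h, mul_assoc]

/-- Inversion changes the sign of the bi-invariant forms of odd degree. -/
theorem unitForm_inverse (hτ : ∀ a b, τ (a * b) = τ (b * a)) {k : ℕ} (hk : Odd k) (u : Aˣ) :
    (unitForm τ k (Ring.inverse (u : A))).compContinuousLinearMap
        (-ContinuousLinearMap.mulLeftRight ℝ A ((u⁻¹ : Aˣ) : A) ((u⁻¹ : Aˣ) : A))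
      = -unitForm τ k (u : A) := by
  ext v
  rw [ContinuousAlternatingMap.compContinuousLinearMap_apply, unitForm_apply,
    ContinuousAlternatingMap.neg_apply, unitForm_apply, ← Finset.sum_neg_distrib]
  refine Finset.sum_congr rfl fun σ _ => ?_
  rw [Ring.inverse_unit, Ring.inverse_unit, inv_inv, ← smul_neg]
  congr 1
  have h : (fun i => (u : A) * ((⇑(-ContinuousLinearMap.mulLeftRight ℝ A ((u⁻¹ : Aˣ) : A)
      ((u⁻¹ : Aˣ) : A)) ∘ v) (σ i))) = fun i => -(v (σ i) * ((u⁻¹ : Aˣ) : A)) := by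
    funext i
    simp [mul_assoc]
  rw [h, prod_ofFn_conj u fun i => v (σ i), hk.neg_one_pow, neg_one_mul, map_neg, hτ]
  simp [← mul_assoc]

variable [FiniteDimensional ℝ A]

theorem contDiffOn_unitForm (k : ℕ) : ContDiffOn ℝ ∞ (unitForm τ k) {g : A | IsUnit g} := by
  have : CompleteSpace A := FiniteDimensional.complete ℝ A
  refine contDiffOn_alternating_iff.2 fun v => ?_
  simp only [unitForm_apply]
  refine ContDiffOn.sum fun σ _ => ContDiffOn.const_smul _ (τ.contDiff.comp_contDiffOn ?_)
  have hinv : ContDiffOn ℝ ∞ (Ring.inverse : A → A) {g : A | IsUnit g} := by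
    rintro _ ⟨u, rfl⟩
    exact (contDiffAt_ringInverse ℝ u).contDiffWithinAt
  exact (ContinuousMultilinearMap.mkPiAlgebraFin ℝ k A).contDiff.comp_contDiffOn
    (contDiffOn_pi.2 fun i => hinv.mul contDiffOn_const)

theorem contDiffAt_unitForm (k : ℕ) (u : Aˣ) : ContDiffAt ℝ ∞ (unitForm τ k) (u : A) :=
  have : CompleteSpace A := FiniteDimensional.complete ℝ A
  (contDiffOn_unitForm k).contDiffAt (Units.isOpen.mem_nhds u.isUnit)

/-- Bi-invariant forms of odd degree are closed: inversion acts on the form by `-1`, and on the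
value of its exterior derivative at `1`, which has even degree, by `+1`. -/
theorem extDeriv_unitForm (hτ : ∀ a b, τ (a * b) = τ (b * a)) {k : ℕ} (hk : Odd k) (u : Aˣ) :
    extDeriv (unitForm τ k) (u : A) = 0 := by
  have : CompleteSpace A := FiniteDimensional.complete ℝ A
  -- Compare the derivatives at `1` of both sides of `inv^* η = -η`.
  have hone : extDeriv (unitForm τ k) (1 : A) = 0 := by
    have h1 : (fun g : A => (unitForm τ k (Ring.inverse g)).compContinuousLinearMap
        (fderiv ℝ Ring.inverse g)) =ᶠ[𝓝 1] fun g => (-1 : ℝ) • unitForm τ k g := by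
      filter_upwards [Units.isOpen.mem_nhds (isUnit_one : IsUnit (1 : A))] with g hg
      obtain ⟨w, rfl⟩ := hg
      rw [(hasFDerivAt_ringInverse w).fderiv, unitForm_inverse hτ hk]
      ext v
      simp
    have h2 := h1.extDeriv_eq
    have hd : DifferentiableAt ℝ (unitForm τ k) (Ring.inverse (1 : A)) := by
      rw [Ring.inverse_one]
      exact (contDiffAt_unitForm k 1).differentiableAt (by simp)
    have h3 : fderiv ℝ Ring.inverse (1 : A) = -ContinuousLinearMap.id ℝ A := by
      have := (hasFDerivAt_ringInverse (𝕜 := ℝ) (1 : Aˣ)).fderiv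
      rw [Units.val_one] at this
      rw [this]
      ext a
      simp
    rw [extDeriv_pullback hd (contDiffAt_ringInverse ℝ (1 : Aˣ)) le_top, Ring.inverse_one,
      h3] at h2
    have h4 : extDeriv (fun g => (-1 : ℝ) • unitForm τ k g) (1 : A)
        = (-1 : ℝ) • extDeriv (unitForm τ k) 1 := extDeriv_smul _ _
    rw [h4] at h2
    ext v
    have h5 := congrArg (fun η : A [⋀^Fin (k + 1)]→L[ℝ] ℂ => η v) h2
    simp only [ContinuousAlternatingMap.compContinuousLinearMap_apply,
      ContinuousAlternatingMap.smul_apply] at h5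
    have h6 : (⇑(-ContinuousLinearMap.id ℝ A) ∘ v) = fun i => (-1 : ℝ) • v i := by
      funext i
      simp
    rw [h6, ContinuousAlternatingMap.map_smul_univ, Finset.prod_const, Finset.card_univ,
      Fintype.card_fin, hk.add_one.neg_one_pow, one_smul, neg_one_smul] at h5
    exact self_eq_neg.1 h5
  -- Translation by `u⁻¹` reduces the general case to the identity.
  have h1 : unitForm τ k =ᶠ[𝓝 (u : A)] fun g =>
      (unitForm τ k (((u⁻¹ : Aˣ) : A) * g)).compContinuousLinearMap
        (fderiv ℝ (fun g => ((u⁻¹ : Aˣ) : A) * g) g) := by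
    filter_upwards [Units.isOpen.mem_nhds u.isUnit] with g hg
    rw [← unitForm_mul τ k u⁻¹ hg]
    congr 1
    exact ((ContinuousLinearMap.mul ℝ A ((u⁻¹ : Aˣ) : A)).fderiv).symm
  have hd : DifferentiableAt ℝ (unitForm τ k) (((u⁻¹ : Aˣ) : A) * (u : A)) := by
    rw [Units.inv_mul]
    exact (contDiffAt_unitForm k 1).differentiableAt (by simp)
  rw [h1.extDeriv_eq, extDeriv_pullback (r := ∞) hd (by fun_prop)
    minSmoothness_two_le_infty, Units.inv_mul, hone]
  rfl

theorem extDerivWithin_unitForm_comp (hτ : ∀ a b, τ (a * b) = τ (b * a)) {k : ℕ} (hk : Odd k)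
    {V : Type} [NormedAddCommGroup V] [NormedSpace ℝ V] {C : Set V} (hC : IsConvexDomain C)
    {W : V → A} (hW : ContDiffOn ℝ ∞ W C) {x : V} (hx : x ∈ C) (hu : IsUnit (W x)) :
    extDerivWithin (fun y => (unitForm τ k (W y)).compContinuousLinearMap
      (fderivWithin ℝ W C y)) C x = 0 := by
  obtain ⟨u, hu⟩ := hu
  have hd : DifferentiableWithinAt ℝ (unitForm τ k) univ (W x) := by
    rw [← hu]
    exact ((contDiffAt_unitForm k u).differentiableAt (by simp)).differentiableWithinAt
  rw [extDerivWithin_pullback (r := ∞) hd (hW x hx)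
    minSmoothness_two_le_infty hC.uniqueDiffOn
    (hC.mem_closure_interior hx) hx (mapsTo_univ _ _), extDerivWithin_univ, ← hu,
    extDeriv_unitForm hτ hk]
  rfl

end UnitForm

/-! ### The odd Chern form is closed -/

/-- Mathlib puts no global norm on matrices; the operators on a Euclidean space provide a normed
algebra that is isomorphic to the algebra of matrices. -/
theorem exists_normedAlgebra_matrix (m : Type) [Fintype m] [DecidableEq m] :
    ∃ (A : Type) (_ : NormedRing A) (_ : NormedAlgebra ℝ A) (_ : FiniteDimensional ℝ A),
      Nonempty (A ≃ₐ[ℝ] Matrix m m ℂ) :=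
  ⟨EuclideanSpace ℂ m →L[ℂ] EuclideanSpace ℂ m, inferInstance, inferInstance,
    Module.Finite.equiv
      ((Matrix.toEuclideanCLM (n := m) (𝕜 := ℂ)).toAlgEquiv.restrictScalars ℝ).toLinearEquiv,
    ⟨((Matrix.toEuclideanCLM (n := m) (𝕜 := ℂ)).toAlgEquiv.restrictScalars ℝ).symm⟩⟩

/-- Near a point, the odd Chern form is the pullback of a bi-invariant form on the group of units of
a normed algebra. -/
theorem ChU_d_eq_zero {k : ℕ} {V : Type} [NormedAddCommGroup V] [NormedSpace ℝ V]
    [FiniteDimensional ℝ V] {C : Set V} {f : V → StableU} (hC : IsConvexDomain C)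
    (hf : ChenSpace.IsPlot C f) {x : V} (hx : x ∈ C) : ChU.d k V C f x = 0 := by
  cases k with
  | zero => rfl
  | succ k =>
    show extDerivWithin (ChU k V C f) C x = 0
    by_cases hk : Odd k
    · rw [isPlot_stableU_iff] at hf
      obtain ⟨p, hp⟩ := hf.1 x hx
      obtain ⟨A, _, _, _, ⟨e⟩⟩ := exists_normedAlgebra_matrix (Win p)
      let τ : A →L[ℝ] ℂ := LinearMap.toContinuousLinearMap
        ((oddCoeff (k / 2)) • ((Matrix.traceLinearMap (Win p) ℝ ℂ).comp e.toLinearMap))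
      have hτe : ∀ a, τ a = oddCoeff (k / 2) * (e a).trace := fun _ => rfl
      have hτ : ∀ a b, τ (a * b) = τ (b * a) := fun a b => by
        rw [hτe, hτe, map_mul, map_mul, Matrix.trace_mul_comm]
      let W : V → A := fun y => e.symm (window p (f y).1)
      have hW : ContDiffOn ℝ ∞ W C := by
        have h1 : W = fun y => ∑ a, ∑ b, (LinearMap.toContinuousLinearMap
            (e.symm.toLinearMap.comp (Matrix.singleLinearMap ℝ a b : ℂ →ₗ[ℝ] _)))
              ((f y).1 (a : Win p).1 (b : Win p).1) := by
          funext y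
          show e.symm (window p (f y).1) = _
          conv_lhs => rw [Matrix.matrix_eq_sum_single (window p (f y).1)]
          simp only [map_sum]
          rfl
        rw [h1]
        exact ContDiffOn.sum fun a _ => ContDiffOn.sum fun b _ =>
          (ContinuousLinearMap.contDiff _).comp_contDiffOn (hf.2 a.1 b.1)
      have hdW : ∀ y ∈ C, ∀ v, e (fderivWithin ℝ W C y v) = dMat p C (fun y => (f y).1) y v := by
        intro y hy v
        ext i j
        let L : A →L[ℝ] ℂ := LinearMap.toContinuousLinearMap
          ((Matrix.entryLinearMap ℝ ℂ i j).comp e.toLinearMap)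
        have h1 := (L.hasFDerivAt.comp_hasFDerivWithinAt y
          ((hW.differentiableOn (by simp)) y hy).hasFDerivWithinAt).fderivWithin
            (hC.uniqueDiffOn y hy)
        have h2 : L ∘ W = fun y => (f y).1 i.1 j.1 := by
          funext y
          show e (e.symm (window p (f y).1)) i j = _
          rw [e.apply_symm_apply]
          rfl
        rw [h2] at h1
        exact (congrArg (fun L : V →L[ℝ] ℂ => L v) h1).symm
      have hu : ∀ y, StableAt 1 p (f y).1 → ∃ u : Aˣ, (u : A) = W y ∧
          ((u⁻¹ : Aˣ) : A) = e.symm (window p (f y).1).conjTranspose := fun y hy => by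
        have h1 := (f y).conjTranspose_mul hy
        have h2 := mul_eq_one_comm.1 h1
        refine ⟨⟨W y, e.symm (window p (f y).1).conjTranspose, ?_, ?_⟩, rfl, rfl⟩
        · rw [← map_mul, h2, map_one]
        · rw [← map_mul, h1, map_one]
      have key : ChU k V C f =ᶠ[𝓝[C] x] fun y =>
          (unitForm τ k (W y)).compContinuousLinearMap (fderivWithin ℝ W C y) := by
        filter_upwards [eventually_eventually_nhdsWithin.2 hp, self_mem_nhdsWithin] with y hy hyC
        ext v
        obtain ⟨u, hu1, hu2⟩ := hu y (hy.self_of_nhdsWithin hyC)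
        rw [ChU_apply hyC hy hk, ContinuousAlternatingMap.compContinuousLinearMap_apply,
          unitForm_apply, altTrace, Finset.mul_sum]
        refine Finset.sum_congr rfl fun σ _ => ?_
        rw [← hu1, Ring.inverse_unit, hu2, hτe, map_list_prod, List.map_ofFn, one_mul,
          Units.smul_def, zsmul_eq_mul]
        have h3 : (⇑e ∘ fun i => e.symm (window p (f y).1).conjTranspose *
            (⇑(fderivWithin ℝ W C y) ∘ v) (σ i)) = fun i =>
            (window p (f y).1).conjTranspose * dMat p C (fun y => (f y).1) y (v (σ i)) := by
          funext i
          simp only [Function.comp, map_mul, e.apply_symm_apply, hdW y hyC]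
        rw [h3]
        ring
      rw [key.extDerivWithin_eq_of_mem hx]
      obtain ⟨u, hu1, -⟩ := hu x (hp.self_of_nhdsWithin hx)
      exact extDerivWithin_unitForm_comp hτ hk hC hW hx (hu1 ▸ u.isUnit)
    · have h : ChU k V C f = fun _ => 0 := funext fun y => ChU_of_not_odd hk
      rw [h]
      ext v
      simp [extDerivWithin, ContinuousAlternatingMap.alternatizeUncurryFin_apply]

/-! ### Transgression -/

/-- For a closed form only the boundary terms of Stokes' theorem remain. -/
theorem DForm.IsForm.d_fiberInt_of_closed {X : Type*} [ChenSpace X]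
    {α : DForm (X × unitInterval)} (hα : α.IsForm)
    (hd : ∀ (k : ℕ) (V : Type) [NormedAddCommGroup V] [NormedSpace ℝ V] [FiniteDimensional ℝ V]
      (C : Set V) (f : V → X × unitInterval), IsConvexDomain C → ChenSpace.IsPlot C f →
      ∀ x ∈ C, α.d k V C f x = 0) :
    α.fiberInt.d.Same (α.pullback (fun z : X => (z, (1 : unitInterval)))
      - α.pullback (fun z : X => (z, (0 : unitInterval)))) := by
  intro k V _ _ _ C f hC hf x hx
  rw [hα.d_fiberInt k V C f hC hf x hx]
  have h : α.d.fiberInt k V C f x = 0 := by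
    rw [DForm.fiberInt_eq]
    refine (intervalIntegral.integral_congr (g := fun _ => 0) fun t ht => ?_).trans (by simp)
    rw [uIcc_of_le zero_le_one] at ht
    show contractFiber V k _ = 0
    rw [hd (k + 1) _ _ _ hC.prod_Icc (isPlot_cylinderPlot hC hf) _ ⟨hx, ht⟩, map_zero]
  exact (congrArg (fun η => _ - η) h).trans (sub_zero _)

/-- A map into a mapping space is smooth if it is jointly smooth. -/
theorem isSmooth_curry {X Y Z : Type*} [ChenSpace X] [ChenSpace Y] [ChenSpace Z]
    {G : X → SmoothMap Y Z} (h : IsSmooth fun z : X × Y => (G z.1).1 z.2) : IsSmooth G :=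
  fun _ _ _ _ _ _ hC hf V' _ _ _ C' _ p hC' hθ hm hp =>
    h V' C' (fun y => (_, p y)) hC' ⟨ChenSpace.comp hC hC' hf hθ hm, hp⟩

theorem isSmooth_eval {Y Z : Type*} [ChenSpace Y] [ChenSpace Z] :
    IsSmooth fun z : SmoothMap Y Z × Y => z.1.1 z.2 :=
  fun V _ _ _ C f hC hf => hf.1 V C id (fun y => (f y).2) hC contDiffOn_id (fun _ h => h) hf.2

theorem isSmooth_evalPath : IsSmooth fun z : PathU × unitInterval => z.1.1 z.2 := isSmooth_eval

theorem isSmooth_evalSquare :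
    IsSmooth fun z : (SquareU × unitInterval) × unitInterval => z.1.1.1 (z.1.2, z.2) :=
  isSmooth_eval.comp ((isSmooth_fst.comp isSmooth_fst).prodMk
    ((isSmooth_snd.comp isSmooth_fst).prodMk isSmooth_snd))

theorem CSForm_isForm : CSForm.IsForm := (ChU_isForm.pullback isSmooth_evalPath).fiberInt

theorem CSForm_isEven : CSForm.IsEven := (ChU_isOdd.pullback isSmooth_evalPath).fiberInt

theorem HForm_isForm : HForm.IsForm := (ChU_isForm.pullback isSmooth_evalSquare).fiberInt.fiberInt

theorem HForm_isOdd : HForm.IsOdd := (ChU_isOdd.pullback isSmooth_evalSquare).fiberInt.fiberInt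

/-- Stokes' theorem for the square, applied first to the integral over `s`, then to the integral
over `t` inside. -/
theorem HForm_d : (HForm.d).Same
    (CSForm.pullback (SquareU.vertical 1) - CSForm.pullback (SquareU.vertical 0)
      - CSForm.pullback (SquareU.horizontal 1) + CSForm.pullback (SquareU.horizontal 0)) := by
  set α : DForm ((SquareU × unitInterval) × unitInterval) :=
    ChU.pullback fun z => z.1.1.1 (z.1.2, z.2) with hα
  have hαF : α.IsForm := ChU_isForm.pullback isSmooth_evalSquare
  have hs : ∀ t : unitInterval,
      (α.pullback fun z : SquareU × unitInterval => (z, t)).IsForm := fun t =>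
    hαF.pullback (isSmooth_id.prodMk (isSmooth_const t))
  have h1 : α.fiberInt.d.Same (α.pullback (fun z => (z, (1 : unitInterval)))
      - α.pullback (fun z => (z, (0 : unitInterval)))) :=
    hαF.d_fiberInt_of_closed fun k V _ _ _ C f hC hf x hx =>
      ChU_d_eq_zero hC (isSmooth_evalSquare V C f hC hf) hx
  intro k V _ _ _ C f hC hf x hx
  have h2 := hαF.fiberInt.d_fiberInt k V C f hC hf x hx
  have h3 := h1.fiberInt k V C f hC hf x hx
  rw [(hs 1).fiberInt_sub (hs 0) k V C f hC hf x hx] at h3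
  have h4 : HForm.d k V C f x
      = CSForm.pullback (SquareU.vertical 1) k V C f x
        - CSForm.pullback (SquareU.vertical 0) k V C f x
        - (CSForm.pullback (SquareU.horizontal 1) k V C f x
        - CSForm.pullback (SquareU.horizontal 0) k V C f x) :=
    h2.trans (congrArg (fun η => _ - η) h3)
  rw [h4, ← sub_add]
  rfl

/-! ### Loops of the form `exp (2π i (t P + (1 - t) I_k))` -/

theorem isSmooth_coe_buz : IsSmooth fun P : BUZ => P.1 := fun _ _ _ _ _ _ _ hf => hf

/-- The path `t ↦ exp (2π i (t P + (1 - t) I_k))`. -/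
def shiftE (k : ℤ) (P : BUZ) : PathU :=
  ⟨fun t => expU (StableH.seg t P.1 (StableH.std k)),
    isSmooth_expU.comp (isSmooth_seg.comp
      ((isSmooth_id.prodMk (isSmooth_const P.1)).prodMk (isSmooth_const (StableH.std k))))⟩

theorem isSmooth_shiftE (k : ℤ) : IsSmooth (shiftE k) :=
  isSmooth_curry (isSmooth_expU.comp (isSmooth_seg.comp
    ((isSmooth_snd.prodMk (isSmooth_coe_buz.comp isSmooth_fst)).prodMk
      (isSmooth_const (StableH.std k)))))

theorem isSmooth_E : IsSmooth E := isSmooth_shiftE 0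

theorem isSmooth_expSquare (k : ℤ) : IsSmooth (expSquare k) :=
  isSmooth_curry (isSmooth_expU.comp (isSmooth_seg.comp
    (((isSmooth_snd.comp isSmooth_snd).prodMk (isSmooth_coe_buz.comp isSmooth_fst)).prodMk
      (isSmooth_seg.comp (((isSmooth_fst.comp isSmooth_snd).prodMk
        (isSmooth_const (StableH.std k))).prodMk (isSmooth_const (StableH.std (k - 1))))))))

theorem window_stdProj_neg (N : ℕ) : window N (stdProj (-(N : ℤ))) = 0 := by
  ext i j
  have hi := (Finset.mem_Ico.1 i.2).1
  rw [window, Matrix.submatrix_apply, stdProj, Matrix.diagonal_apply, if_neg (not_lt.2 hi)]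
  simp

theorem stableAt_stdProj {k : ℤ} {N : ℕ} (hk : k.natAbs ≤ N) :
    StableAt (stdProj 0) N (stdProj k) := by
  intro i j hij
  simp only [stdProj, Matrix.diagonal_apply]
  simp only [Finset.mem_Ico] at hij
  by_cases h : i = j
  · subst h
    have : i < k ↔ i < 0 := by omega
    simp only [this]
  · simp [h]

/-- `I_k` as a point of `BU × ℤ`. -/
def BUZ.std (k : ℤ) : BUZ :=
  ⟨StableH.std k, k.natAbs, stableAt_stdProj le_rfl, by
    show window _ (stdProj k) * window _ (stdProj k) = window _ (stdProj k)
    have h : window k.natAbs (stdProj k)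
        = Matrix.diagonal fun i : Win k.natAbs => if i.1 < k then (1 : ℂ) else 0 :=
      Matrix.submatrix_diagonal _ _ Subtype.val_injective
    rw [h, Matrix.diagonal_mul_diagonal]
    congr 1
    funext i
    split_ifs <;> simp⟩

theorem vertical_one_expSquare (k : ℤ) (P : BUZ) :
    SquareU.vertical 1 (expSquare k P) = shiftE k P := by
  refine Subtype.ext (funext fun t => ?_)
  show expU (StableH.seg t P.1 (StableH.seg 1 _ _)) = _
  rw [seg_one]
  rfl

theorem vertical_zero_expSquare (k : ℤ) (P : BUZ) :
    SquareU.vertical 0 (expSquare k P) = shiftE (k - 1) P := by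
  refine Subtype.ext (funext fun t => ?_)
  show expU (StableH.seg t P.1 (StableH.seg 0 _ _)) = _
  rw [seg_zero]
  rfl

theorem horizontal_zero_expSquare (k : ℤ) (P : BUZ) :
    SquareU.horizontal 0 (expSquare k P) = shiftE (k - 1) (BUZ.std k) := by
  refine Subtype.ext (funext fun s => ?_)
  show expU (StableH.seg 0 P.1 (StableH.seg s _ _)) = _
  rw [seg_zero]
  rfl

theorem seg_self (t : unitInterval) (a : StableH) : StableH.seg t a a = a :=
  Subtype.ext (by ext i j; simp [StableH.seg, ← add_mul])

theorem expU_projection (P : BUZ) : expU P.1 = StableU.one := by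
  obtain ⟨p, hs, hp⟩ := P.2
  exact Subtype.ext (expU_of_idempotent hs hp)

theorem horizontal_one_expSquare (k : ℤ) (P : BUZ) :
    SquareU.horizontal 1 (expSquare k P) = shiftE 0 (BUZ.std 0) := by
  refine Subtype.ext (funext fun s => ?_)
  show expU (StableH.seg 1 P.1 (StableH.seg s _ _))
    = expU (StableH.seg s (BUZ.std 0).1 (BUZ.std 0).1)
  rw [seg_one, seg_self, expU_projection, expU_projection]

theorem exp_smul_of_idempotent {m : Type} [Fintype m] [DecidableEq m] {X : Matrix m m ℂ}
    (hX : X * X = X) (c : ℂ) : NormedSpace.exp (c • X) = 1 + (Complex.exp c - 1) • X := by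
  ext i j
  have hpow : ∀ n : ℕ, X ^ (n + 1) = X := fun n => by
    induction n with
    | zero => simp
    | succ n ih => rw [pow_succ, ih, hX]
  have h2 := (NormedSpace.exp_series_hasSum_exp' (𝕂 := ℂ) c).mul_right (X i j)
  have h3 := h2.add (hasSum_ite_eq (0 : ℕ) ((1 : Matrix m m ℂ) i j - X i j))
  rw [← Complex.exp_eq_exp_ℂ] at h3
  refine (hasSum_exp_entry (c • X) i j).unique
    ((Eq.mp (congrArg (fun g : ℕ → ℂ => HasSum g _) (funext fun n => ?_)) h3)) |>.trans ?_
  · cases n with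
    | zero => simp
    | succ n => simp [smul_pow, hpow, mul_assoc]
  · simp only [Matrix.add_apply, Matrix.smul_apply, smul_eq_mul]
    ring

theorem expU_eq_padWin (h : StableH) {p : ℕ} (hp : StableAt (stdProj 0) p h.1) :
    (expU h).1 = padWin 1 p (expWin (window p h.1)) :=
  (padWin_expWin (stableAt_stage h) (Nat.sInf_le hp)).symm

/-- On a block where `P` is stable and `I_{-N}` vanishes, the loop is
`1 + (exp (2π i t) - 1) P`. -/
theorem shiftE_window {P : BUZ} {N : ℕ} (hP : StableAt (stdProj 0) N P.1.1) (t : unitInterval) :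
    StableAt 1 N ((shiftE (-(N : ℤ)) P).1 t).1 ∧ window N ((shiftE (-(N : ℤ)) P).1 t).1
      = 1 + (Complex.exp (2 * Real.pi * Complex.I * (t : ℝ)) - 1) • window N P.1.1 := by
  have hs : StableAt (stdProj 0) N (StableH.seg t P.1 (StableH.std (-(N : ℤ)))).1 := by
    intro i j hij
    have h1 := hP i j hij
    have h2 := stableAt_stdProj (k := -(N : ℤ)) (N := N) (by simp) i j hij
    show ((t : ℝ) : ℂ) * P.1.1 i j + ((1 - (t : ℝ) : ℝ) : ℂ) * stdProj (-(N : ℤ)) i j = _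
    rw [h1, h2]
    push_cast
    ring
  have hw : window N (StableH.seg t P.1 (StableH.std (-(N : ℤ)))).1
      = ((t : ℝ) : ℂ) • window N P.1.1 := by
    ext i j
    have h0 : stdProj (-(N : ℤ)) i.1 j.1 = 0 :=
      congrFun (congrFun (window_stdProj_neg N) i) j
    show ((t : ℝ) : ℂ) * P.1.1 i.1 j.1 + ((1 - (t : ℝ) : ℝ) : ℂ) * stdProj (-(N : ℤ)) i.1 j.1 = _
    rw [h0, mul_zero, add_zero]
    rfl
  have he : ((shiftE (-(N : ℤ)) P).1 t).1
      = padWin 1 N (expWin (((t : ℝ) : ℂ) • window N P.1.1)) := by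
    rw [← hw]
    exact expU_eq_padWin _ hs
  rw [he]
  refine ⟨stableAt_padWin _ _ _, ?_⟩
  rw [window_padWin, expWin, smul_smul, exp_smul_of_idempotent (P.window_mul_self hP)]

/-! ### The Chern-Simons form of the loops -/

/-- The loop `t ↦ exp (2π i t)` in the unit circle. -/
def circ (t : ℝ) : ℂ := Complex.exp (2 * Real.pi * Complex.I * t)

theorem star_circ (t : ℝ) : star (circ t) = Complex.exp (-(2 * Real.pi * Complex.I * t)) := by
  rw [circ, Complex.star_def, ← Complex.exp_conj]
  simp [Complex.conj_ofNat]

theorem star_circ_mul (t : ℝ) : star (circ t) * circ t = 1 := by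
  rw [star_circ, circ, ← Complex.exp_add, neg_add_cancel, Complex.exp_zero]

theorem sq_circ_sub_one (t : ℝ) :
    (circ t - 1) ^ 2 * star (circ t) = -4 * (Real.sin (Real.pi * t) : ℂ) ^ 2 := by
  have h1 : (circ t - 1) ^ 2 * star (circ t) = circ t + star (circ t) - 2 := by
    linear_combination (circ t - 2) * star_circ_mul t
  have h2 : circ t + star (circ t) = 2 * Complex.cos (2 * (Real.pi * t)) := by
    rw [star_circ, circ, Complex.cos]
    ring_nf
  rw [h1, h2, Complex.cos_two_mul]
  push_cast
  linear_combination 4 * Complex.sin_sq_add_cos_sq ((Real.pi : ℂ) * t)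

theorem hasDerivAt_circ (t : ℝ) : HasDerivAt circ (2 * Real.pi * Complex.I * circ t) t := by
  have h1 : HasDerivAt (fun t : ℝ => (2 * Real.pi * Complex.I * (t : ℂ)))
      (2 * Real.pi * Complex.I) t := by
    simpa using (Complex.ofRealCLM.hasDerivAt (x := t)).const_mul (2 * Real.pi * Complex.I)
  exact h1.cexp.congr_deriv (mul_comm _ _)

/-- Wallis' integral. -/
theorem integral_sin_pi_mul_pow (n : ℕ) :
    ∫ t in (0 : ℝ)..1, Real.sin (Real.pi * t) ^ (2 * n)
      = ((2 * n).factorial : ℝ) / (4 ^ n * (n.factorial : ℝ) ^ 2) := by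
  have h := intervalIntegral.integral_comp_mul_left (a := 0) (b := 1)
    (fun u => Real.sin u ^ (2 * n)) Real.pi_ne_zero
  rw [h, mul_zero, mul_one, integral_sin_pow_even, smul_eq_mul,
    inv_mul_cancel_left₀ Real.pi_ne_zero]
  induction n with
  | zero => simp
  | succ n ih =>
    have h0 : (n.factorial : ℝ) ≠ 0 := by positivity
    rw [Finset.prod_range_succ, ih (intervalIntegral.integral_comp_mul_left (a := 0) (b := 1)
      (fun u => Real.sin u ^ (2 * n)) Real.pi_ne_zero), show 2 * (n + 1) = 2 * n + 1 + 1 from rfl,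
      Nat.factorial_succ, Nat.factorial_succ, Nat.factorial_succ]
    push_cast
    field_simp
    ring

/-- The integral over the circle that turns the coefficients of the odd Chern form into those of
the even one. -/
theorem integral_oddCoeff (n : ℕ) :
    ∫ t in (0 : ℝ)..1, oddCoeff n * ((2 * n + 1) * (2 * Real.pi * Complex.I *
      ((circ t - 1) ^ 2 * star (circ t)) ^ n)) = evenCoeff n := by
  have h1 : ∀ t : ℝ, oddCoeff n * ((2 * n + 1) * (2 * Real.pi * Complex.I *
      ((circ t - 1) ^ 2 * star (circ t)) ^ n)) =
      (oddCoeff n * ((2 * n + 1) * (2 * Real.pi * Complex.I * (-4) ^ n))) *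
        ((Real.sin (Real.pi * t) ^ (2 * n) : ℝ) : ℂ) := fun t => by
    rw [sq_circ_sub_one, mul_pow, ← pow_mul]
    push_cast
    ring
  simp only [h1]
  rw [intervalIntegral.integral_const_mul, intervalIntegral.integral_ofReal,
    integral_sin_pi_mul_pow, oddCoeff, evenCoeff, Nat.factorial_succ, neg_pow (4 : ℂ)]
  have h2 : (2 * Real.pi * Complex.I : ℂ) ≠ 0 := Complex.two_pi_I_ne_zero
  generalize (2 * Real.pi * Complex.I : ℂ) = c at h2
  have h3 : ((2 * n).factorial : ℂ) ≠ 0 := by exact_mod_cast (2 * n).factorial_ne_zero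
  have h4 : (n.factorial : ℂ) ≠ 0 := by exact_mod_cast n.factorial_ne_zero
  have h5 : (2 * n + 1 : ℂ) ≠ 0 := by exact_mod_cast (2 * n).succ_ne_zero
  have h6 : ((-1 : ℂ) ^ n) * (-1) ^ n = 1 := by rw [← mul_pow]; simp
  push_cast
  field_simp
  linear_combination c ^ n * c * h6

section Loops

variable {V W : Type} [NormedAddCommGroup V] [NormedSpace ℝ V]
  [NormedAddCommGroup W] [NormedSpace ℝ W] {p : ℕ}

/-- The derivative of a family of the form `G = 1 + φ F + ψ e` with constant `e`. -/
theorem dMat_of_window_eventuallyEq {D : Set W} {y : W} (hD : UniqueDiffWithinAt ℝ D y)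
    (hy : y ∈ D) {G F : W → Matrix ℤ ℤ ℂ} {φ ψ : W → ℂ} {φ' ψ' : W →L[ℝ] ℂ}
    (hF : ∀ i j, DifferentiableWithinAt ℝ (fun z => F z i j) D y)
    (hφ : HasFDerivWithinAt φ φ' D y) (hψ : HasFDerivWithinAt ψ ψ' D y)
    {e : Matrix (Win p) (Win p) ℂ}
    (h : ∀ᶠ z in 𝓝[D] y, window p (G z) = 1 + φ z • window p (F z) + ψ z • e) (w : W) :
    dMat p D G y w = φ y • dMat p D F y w + φ' w • window p (F y) + ψ' w • e := by
  ext i j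
  have h1 : ∀ᶠ z in 𝓝[D] y, G z i.1 j.1
      = (1 : Matrix (Win p) (Win p) ℂ) i j + φ z * F z i.1 j.1 + ψ z * e i j :=
    h.mono fun z hz => congrFun (congrFun hz i) j
  have h2 := (((hφ.mul (hF i.1 j.1).hasFDerivWithinAt).const_add
    ((1 : Matrix (Win p) (Win p) ℂ) i j)).add (hψ.mul_const (e i j))).congr_of_eventuallyEq h1
    (h1.self_of_nhdsWithin hy)
  rw [dMat_apply_apply, h2.fderivWithin hD]
  simp only [add_apply, smul_apply, smul_eq_mul, Matrix.add_apply, Matrix.smul_apply,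
    dMat_apply_apply, window, Matrix.submatrix_apply]
  simp [mul_comm]

/-- The derivative of a family on a product that depends on the first factor only. -/
theorem dMat_fst {C : Set V} {D : Set W} (hC : UniqueDiffOn ℝ C) (hD : UniqueDiffOn ℝ D)
    {F : V → Matrix ℤ ℤ ℂ} {z : V × W} (hz : z ∈ C ×ˢ D)
    (hF : ∀ i j, DifferentiableWithinAt ℝ (fun y => F y i j) C z.1) (w : V × W) :
    dMat p (C ×ˢ D) (fun y => F y.1) z w = dMat p C F z.1 w.1 := by
  rw [dMat_comp (C := C) (F := F) (F' := fun y => F y.1) (θ := Prod.fst)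
    (hC.prod hD) hF differentiableWithinAt_fst
    (fun y hy => hy.1) (fun _ _ => rfl) hz, fderivWithin_fst ((hC.prod hD) z hz)]
  rfl

theorem eventually_nhdsWithin_fst {V W : Type} [TopologicalSpace V] [TopologicalSpace W]
    {C : Set V} {D : Set W} {z : V × W} {Q : V → Prop}
    (h : ∀ᶠ y in 𝓝[C] z.1, Q y) : ∀ᶠ y in 𝓝[C ×ˢ D] z, Q y.1 :=
  (continuous_fst.continuousWithinAt.tendsto_nhdsWithin (fun _ hy => hy.1)).eventually h

end Loops

section CSLoops

variable {V : Type} [NormedAddCommGroup V] [NormedSpace ℝ V] [FiniteDimensional ℝ V]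
  {C : Set V} {f : V → BUZ} {x : V} {N : ℕ}

/-- The integrand of the form `CS` of the loops `g = 1 + (z - 1) P`, with `z = exp (2π i t)`. -/
theorem ChU_shiftE (hC : IsConvexDomain C) (hf : ChenSpace.IsPlot C f) (hx : x ∈ C)
    (hN : ∀ᶠ y in 𝓝[C] x, StableAt (stdProj 0) N (f y).1.1) {t : ℝ} (ht : t ∈ Icc (0 : ℝ) 1)
    (n : ℕ) (v : Fin (2 * n) → V) :
    ChU (2 * n + 1) (V × ℝ) (C ×ˢ Icc (0 : ℝ) 1)
      (fun y => (shiftE (-(N : ℤ)) (f y.1)).1 (projIcc 0 1 zero_le_one y.2)) (x, t)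
      (Fin.cons (0, 1) fun i => (v i, 0)) =
    oddCoeff n * ((2 * n + 1) * (2 * Real.pi * Complex.I *
      ((circ t - 1) ^ 2 * star (circ t)) ^ n)) *
      altTrace (window N (f x).1.1) (fun i => dMat N C (fun y => (f y).1.1) x (v i)) := by
  have hxt : (x, t) ∈ C ×ˢ Icc (0 : ℝ) 1 := ⟨hx, ht⟩
  have hF : StableSmoothOn (stdProj 0) C fun y => (f y).1.1 := hf
  have hdF := fun i j => hF.differentiableWithinAt hx i j
  have hI := uniqueDiffOn_Icc (zero_lt_one (α := ℝ))
  have hD := hC.uniqueDiffOn.prod hI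
  have hst : ∀ᶠ y in 𝓝[C ×ˢ Icc (0 : ℝ) 1] (x, t), StableAt (stdProj 0) N (f y.1).1.1 :=
    eventually_nhdsWithin_fst (Q := fun y => StableAt (stdProj 0) N (f y).1.1) hN
  set g : V × ℝ → StableU :=
    fun y => (shiftE (-(N : ℤ)) (f y.1)).1 (projIcc 0 1 zero_le_one y.2) with hg
  have hw : ∀ᶠ y in 𝓝[C ×ˢ Icc (0 : ℝ) 1] (x, t), window N (g y).1
      = 1 + (circ y.2 - 1) • window N (f y.1).1.1
        + (0 : ℂ) • (0 : Matrix (Win N) (Win N) ℂ) := by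
    filter_upwards [hst, self_mem_nhdsWithin] with y hy hyD
    rw [hg, (shiftE_window hy _).2, projIcc_of_mem _ hyD.2, smul_zero, add_zero]
    rfl
  have hP := (f x).window_mul_self (hN.self_of_nhdsWithin hx)
  have hdP := fun w => projection_mul_dMat (hC.uniqueDiffOn x hx) hdF hx hN w
  have hφ : HasFDerivWithinAt (fun y : V × ℝ => circ y.2 - 1)
      ((2 * Real.pi * Complex.I * circ t) •
        (Complex.ofRealCLM.comp (ContinuousLinearMap.snd ℝ V ℝ)))
      (C ×ˢ Icc (0 : ℝ) 1) (x, t) := by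
    have h := ((hasDerivAt_circ t).hasFDerivAt.comp (x, t)
      (hasFDerivAt_snd (𝕜 := ℝ) (E := V) (F := ℝ))).sub_const (1 : ℂ)
    refine h.hasFDerivWithinAt.congr_fderiv ?_
    ext w <;> simp [mul_comm]
  have hdG : ∀ w, dMat N (C ×ˢ Icc (0 : ℝ) 1) (fun y => (g y).1) (x, t) w
      = (circ t - 1) • dMat N C (fun y => (f y).1.1) x w.1
        + (2 * Real.pi * Complex.I * circ t * (w.2 : ℂ)) • window N (f x).1.1 := fun w => by
    rw [dMat_of_window_eventuallyEq (hD _ hxt) hxt (F := fun y => (f y.1).1.1)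
      (fun i j => DifferentiableWithinAt.comp (g := fun y => (f y).1.1 i j) (t := C) (x, t)
        (hdF i j) differentiableWithinAt_fst fun y hy => hy.1) hφ
      (hasFDerivWithinAt_const _ _ _) hw, dMat_fst hC.uniqueDiffOn hI hxt hdF]
    simp
  have hgx : (window N (g (x, t)).1).conjTranspose
      = 1 + (star (circ t) - 1) • window N (f x).1.1 := by
    rw [hw.self_of_nhdsWithin hxt]
    simp [Matrix.conjTranspose_add, Matrix.conjTranspose_smul, (f x).conjTranspose_window]
  have hstab : ∀ᶠ y in 𝓝[C ×ˢ Icc (0 : ℝ) 1] (x, t), StableAt 1 N (g y).1 :=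
    hst.mono fun y hy => (shiftE_window hy _).1
  have hz := star_circ_mul t
  rw [ChU_apply hxt hstab ⟨n, rfl⟩, show (2 * n + 1) / 2 = n by omega]
  -- `g⁻¹dg` is `2π i P` on `∂/∂t`, and `(z - 1) dP + (z - 1) (z̄ - 1) P dP` on the directions
  -- of `V`.
  have hX : (fun i => (window N (g (x, t)).1).conjTranspose *
      dMat N (C ×ˢ Icc (0 : ℝ) 1) (fun y => (g y).1) (x, t)
        ((Fin.cons (0, 1) fun i => (v i, 0) : Fin (2 * n + 1) → V × ℝ) i))
      = Fin.cons ((2 * Real.pi * Complex.I : ℂ) • window N (f x).1.1)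
        (fun i => (circ t - 1) • dMat N C (fun y => (f y).1.1) x (v i)
          + ((circ t - 1) * (star (circ t) - 1)) •
            (window N (f x).1.1 * dMat N C (fun y => (f y).1.1) x (v i))) := by
    funext i
    rw [hgx, hdG]
    refine Fin.cases ?_ (fun i => ?_) i
    · simp only [Fin.cons_zero, map_zero, smul_zero, zero_add, Complex.ofReal_one, mul_one,
        add_mul, one_mul, Matrix.smul_mul, Matrix.mul_smul, hP, smul_smul, ← add_smul]
      congr 1
      linear_combination (2 * Real.pi * Complex.I : ℂ) * hz
    · simp only [Fin.cons_succ, Complex.ofReal_zero, mul_zero, zero_smul, add_zero, add_mul,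
        one_mul, Matrix.smul_mul, Matrix.mul_smul, smul_smul]
  rw [hX, altTrace_one_cons (even_two_mul n), altTrace_twisted hP _ _ _ fun i => hdP _]
  have : (circ t - 1 + (circ t - 1) * (star (circ t) - 1)) * (circ t - 1)
      = (circ t - 1) ^ 2 * star (circ t) := by ring
  rw [this]
  push_cast
  ring

theorem CSForm_apply {φ : V → PathU} (hC : IsConvexDomain C) (hφ : ChenSpace.IsPlot C φ)
    (hx : x ∈ C) (k : ℕ) (v : Fin k → V) :
    CSForm k V C φ x v = ∫ t in (0 : ℝ)..1, ChU (k + 1) (V × ℝ) (C ×ˢ Icc (0 : ℝ) 1)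
      (fun y => (φ y.1).1 (projIcc 0 1 zero_le_one y.2)) (x, t)
      (Fin.cons (0, 1) fun i => (v i, 0)) :=
  (ChU_isForm.pullback isSmooth_evalPath).fiberInt_apply k hC hφ hx v

/-- On a block where `P` is stable and `I_{-N}` vanishes, the form `CS` of the loops
`exp (2π i (t P + (1 - t) I_{-N}))` is the even Chern form of `P`, except that its component of
degree `0` is the trace of the block of `P` instead of the rank, which is smaller by `N`. -/
theorem CSForm_shiftE (hC : IsConvexDomain C) (hf : ChenSpace.IsPlot C f) (hx : x ∈ C)
    (hN : ∀ᶠ y in 𝓝[C] x, StableAt (stdProj 0) N (f y).1.1) {k : ℕ} (hk : Even k)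
    (v : Fin k → V) :
    CSForm k V C (shiftE (-(N : ℤ)) ∘ f) x v = evenCoeff (k / 2) *
      altTrace (window N (f x).1.1) (fun i => dMat N C (fun y => (f y).1.1) x (v i)) := by
  obtain ⟨n, rfl⟩ := even_iff_exists_two_mul.1 hk
  rw [CSForm_apply hC (isSmooth_shiftE _ V C f hC hf) hx, Nat.mul_div_cancel_left n two_pos,
    ← integral_oddCoeff, ← intervalIntegral.integral_mul_const]
  refine intervalIntegral.integral_congr fun t ht => ?_
  rw [uIcc_of_le zero_le_one] at ht
  exact ChU_shiftE hC hf hx hN ht n v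

end CSLoops

/-! ### The boundary of the squares -/

section Edges

variable {V : Type} [NormedAddCommGroup V] [NormedSpace ℝ V] [FiniteDimensional ℝ V]
  {C : Set V} {x : V}

theorem altTrace_zero {m : Type} [Fintype m] [DecidableEq m] (A : Matrix m m ℂ)
    (X : Fin 0 → Matrix m m ℂ) : altTrace A X = A.trace := by
  simp [altTrace]

/-- The loop `exp (2π i (t I_0 + (1 - t) I_0))` is constant at the identity; it lies in the stage
of size `0`. -/
theorem CSForm_shiftE_std_zero (hC : IsConvexDomain C) (hx : x ∈ C) (k : ℕ) :
    CSForm k V C (fun _ => shiftE 0 (BUZ.std 0)) x = 0 := by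
  by_cases hk : Even k
  · ext v
    have : IsEmpty (Win 0) := ⟨fun i => by have := Finset.mem_Ico.1 i.2; omega⟩
    refine (CSForm_shiftE (N := 0) (f := fun _ => BUZ.std 0) hC (ChenSpace.const C _) hx
      (Eventually.of_forall fun _ => stableAt_stdProj le_rfl) hk v).trans ?_
    rw [altTrace_eq_zero fun _ => Subsingleton.elim _ _, mul_zero]
    rfl
  · exact CSForm_isEven k V C _ hC (ChenSpace.const C _) (Nat.not_even_iff_odd.1 hk) x hx

/-- The loop `exp (2π i (t I_{-j} + (1 - t) I_{-j-1}))` winds once around the circle, in the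
direction of a single basis vector. -/
theorem CSForm_shiftE_std (hC : IsConvexDomain C) (hx : x ∈ C) (j k : ℕ) (v : Fin k → V) :
    CSForm k V C (fun _ => shiftE (-(j : ℤ) - 1) (BUZ.std (-(j : ℤ)))) x v
      = if k = 0 then 1 else 0 := by
  have hj : -(j : ℤ) - 1 = -((j + 1 : ℕ) : ℤ) := by push_cast; ring
  by_cases hk : Even k
  · rw [hj]
    refine (CSForm_shiftE (N := j + 1) (f := fun _ => BUZ.std (-(j : ℤ))) hC
      (ChenSpace.const C _) hx
      (Eventually.of_forall fun _ => stableAt_stdProj (by omega)) hk v).trans ?_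
    by_cases hk0 : k = 0
    · subst hk0
      have h := trace_window_stdProj (p := j) (q := j + 1)
        (stableAt_stdProj (k := -(j : ℤ)) (by omega)) (Nat.le_succ j)
      rw [window_stdProj_neg, Matrix.trace_zero] at h
      have h' : (window (j + 1) (BUZ.std (-(j : ℤ))).1.1).trace = 1 := by
        have : (BUZ.std (-(j : ℤ))).1.1 = stdProj (-(j : ℤ)) := rfl
        rw [this]
        push_cast at h
        linear_combination h
      rw [altTrace_zero, h']
      simp [evenCoeff]
    · rw [if_neg hk0, altTrace_eq_zero_of_apply ⟨0, Nat.pos_of_ne_zero hk0⟩, mul_zero]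
      ext a b
      rw [dMat_apply_apply, fderivWithin_fun_const]
      rfl
  · rw [CSForm_isEven k V C _ hC (ChenSpace.const C _) (Nat.not_even_iff_odd.1 hk) x hx,
      if_neg (by rintro rfl; exact hk ⟨0, rfl⟩)]
    rfl

/-- The boundary of the square `exp ∘ h_{-j}`: two of its edges are constant, and contribute to
degree `0` only. -/
theorem HForm_d_expSquare {f : V → BUZ} (hC : IsConvexDomain C) (hf : ChenSpace.IsPlot C f)
    (hx : x ∈ C) (j k : ℕ) (v : Fin k → V) :
    HForm.d k V C (expSquare (-(j : ℤ)) ∘ f) x v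
      = CSForm k V C (shiftE (-(j : ℤ)) ∘ f) x v
        - CSForm k V C (shiftE (-((j + 1 : ℕ) : ℤ)) ∘ f) x v + if k = 0 then 1 else 0 := by
  have hj : -((j + 1 : ℕ) : ℤ) = -(j : ℤ) - 1 := by push_cast; ring
  rw [HForm_d k V C _ hC (isSmooth_expSquare _ V C f hC hf) x hx, hj,
    ← CSForm_shiftE_std hC hx j k v]
  have h1 : SquareU.vertical 1 ∘ expSquare (-(j : ℤ)) ∘ f = shiftE (-(j : ℤ)) ∘ f :=
    funext fun y => vertical_one_expSquare _ _
  have h2 : SquareU.vertical 0 ∘ expSquare (-(j : ℤ)) ∘ f = shiftE (-(j : ℤ) - 1) ∘ f :=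
    funext fun y => vertical_zero_expSquare _ _
  have h3 : SquareU.horizontal 1 ∘ expSquare (-(j : ℤ)) ∘ f = fun _ => shiftE 0 (BUZ.std 0) :=
    funext fun y => horizontal_one_expSquare _ _
  have h4 : SquareU.horizontal 0 ∘ expSquare (-(j : ℤ)) ∘ f
      = fun _ => shiftE (-(j : ℤ) - 1) (BUZ.std (-(j : ℤ))) :=
    funext fun y => horizontal_zero_expSquare _ _
  show CSForm k V C (SquareU.vertical 1 ∘ _) x v - CSForm k V C (SquareU.vertical 0 ∘ _) x v
    - CSForm k V C (SquareU.horizontal 1 ∘ _) x v + CSForm k V C (SquareU.horizontal 0 ∘ _) x v = _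
  rw [h1, h2, h3, h4, CSForm_shiftE_std_zero hC hx]
  simp

end Edges

/-! ### Squares far away from the support -/

theorem window_stdProj (q : ℕ) (k : ℤ) : window q (stdProj k)
    = Matrix.diagonal fun i : Win q => if i.1 < k then (1 : ℂ) else 0 :=
  Matrix.submatrix_diagonal _ _ Subtype.val_injective

section Far

variable {j : ℕ} {P : Matrix ℤ ℤ ℂ}

/-- Outside of its stage `j`, on the basis vectors `e_i` with `i < -j`, the matrix is the
identity. -/
theorem apply_eq_ite_of_lt_neg (hP : StableAt (stdProj 0) j P) {i l : ℤ}
    (h : i < -(j : ℤ) ∨ l < -(j : ℤ)) : P i l = if i = l then 1 else 0 := by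
  rw [hP i l (by simp only [Finset.mem_Ico]; omega), stdProj, Matrix.diagonal_apply]
  by_cases hil : i = l
  · rw [if_pos hil, if_pos hil, if_pos (by omega)]
  · rw [if_neg hil, if_neg hil]

theorem window_mul_window_stdProj_neg (hP : StableAt (stdProj 0) j P) (q : ℕ) :
    window q P * window q (stdProj (-(j : ℤ))) = window q (stdProj (-(j : ℤ))) := by
  rw [window_stdProj]
  ext i l
  rw [Matrix.mul_diagonal, Matrix.diagonal_apply, window, Matrix.submatrix_apply]
  by_cases hl : l.1 < -(j : ℤ)
  · rw [apply_eq_ite_of_lt_neg hP (Or.inr hl), if_pos hl, mul_one]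
    by_cases hil : i = l
    · subst hil
      simp [hl]
    · rw [if_neg fun h => hil (Subtype.ext h), if_neg hil]
  · rw [if_neg hl, mul_zero]
    split_ifs with h1 h2
    · exact absurd (h1 ▸ h2) hl
    · rfl
    · rfl

theorem window_stdProj_neg_mul_window (hP : StableAt (stdProj 0) j P) (q : ℕ) :
    window q (stdProj (-(j : ℤ))) * window q P = window q (stdProj (-(j : ℤ))) := by
  rw [window_stdProj]
  ext i l
  rw [Matrix.diagonal_mul, Matrix.diagonal_apply, window, Matrix.submatrix_apply]
  by_cases hl : i.1 < -(j : ℤ)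
  · rw [apply_eq_ite_of_lt_neg hP (Or.inl hl), if_pos hl, one_mul]
    by_cases hil : i = l
    · subst hil
      simp
    · rw [if_neg fun h => hil (Subtype.ext h), if_neg hil]
  · rw [if_neg hl, zero_mul, ite_self]

theorem extendZero_zero (p q : ℕ) : extendZero q (0 : Matrix (Win p) (Win p) ℂ) = 0 := by
  ext i l
  simp [extendZero_apply]

theorem extendZero_mul_window_stdProj_neg (q : ℕ) (X : Matrix (Win j) (Win j) ℂ) :
    extendZero q X * window q (stdProj (-(j : ℤ))) = 0 := by
  rw [window_stdProj]
  ext i l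
  rw [Matrix.mul_diagonal, extendZero_apply, Matrix.zero_apply]
  by_cases hl : l.1 < -(j : ℤ)
  · rw [dif_neg (by simp only [Finset.mem_Ico]; omega), zero_mul]
  · rw [if_neg hl, mul_zero]

theorem window_stdProj_neg_mul_extendZero (q : ℕ) (X : Matrix (Win j) (Win j) ℂ) :
    window q (stdProj (-(j : ℤ))) * extendZero q X = 0 := by
  rw [window_stdProj]
  ext i l
  rw [Matrix.diagonal_mul, extendZero_apply, Matrix.zero_apply]
  by_cases hl : i.1 < -(j : ℤ)
  · rw [dif_neg (by simp only [Finset.mem_Ico]; omega), mul_zero]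
  · rw [if_neg hl, zero_mul]

end Far

theorem window_stdProj_neg_mul_self (j q : ℕ) :
    window q (stdProj (-(j : ℤ))) * window q (stdProj (-(j : ℤ)))
    = window q (stdProj (-(j : ℤ))) := by
  rw [window_stdProj, Matrix.diagonal_mul_diagonal]
  congr 1
  funext i
  split_ifs <;> simp

/-- The coefficient `w - z`, as a function of `(s, t)`, where `w = exp (2π i (t + (1 - t) s))` is
the value of the square `exp ∘ h_{-j}` on the basis vector `e_{-j-1}`, and `z = exp (2π i t)`. -/
def squareAngle (r : ℝ × ℝ) : ℂ := circ r.2 * (circ ((1 - r.2) * r.1) - 1)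

theorem differentiable_circ : Differentiable ℝ circ := fun t =>
  (hasDerivAt_circ t).differentiableAt

theorem differentiable_squareAngle : Differentiable ℝ squareAngle :=
  (differentiable_circ.comp differentiable_snd).mul
    ((differentiable_circ.comp (((differentiable_const 1).sub differentiable_snd).mul
      differentiable_fst)).sub_const 1)

/-- If `P` lies in the stage `j`, then on the block of size `j + 1` the square `exp ∘ h_{-j}` is
`1 + (z - 1) P + (w - z) e`, where `e = I_{-j}` is the projection onto the basis vector
`e_{-j-1}`. -/
theorem expSquare_window {P : BUZ} {j : ℕ} (hP : StableAt (stdProj 0) j P.1.1)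
    (s t : unitInterval) :
    StableAt 1 (j + 1) ((expSquare (-(j : ℤ)) P).1 (s, t)).1 ∧
      window (j + 1) ((expSquare (-(j : ℤ)) P).1 (s, t)).1
        = 1 + (circ t - 1) • window (j + 1) P.1.1
          + squareAngle (s, t) • window (j + 1) (stdProj (-(j : ℤ))) := by
  set h : StableH := StableH.seg t P.1
    (StableH.seg s (StableH.std (-(j : ℤ))) (StableH.std (-(j : ℤ) - 1))) with hh
  have hentry : ∀ a b : ℤ, h.1 a b = ((t : ℝ) : ℂ) * P.1.1 a b + ((1 - (t : ℝ) : ℝ) : ℂ) *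
      (((s : ℝ) : ℂ) * stdProj (-(j : ℤ)) a b
        + ((1 - (s : ℝ) : ℝ) : ℂ) * stdProj (-(j : ℤ) - 1) a b) := fun _ _ => rfl
  have hj : -(j : ℤ) - 1 = -((j + 1 : ℕ) : ℤ) := by push_cast; ring
  have hs : StableAt (stdProj 0) (j + 1) h.1 := by
    intro a b hab
    rw [hentry, hP.mono (Nat.le_succ j) a b hab,
      stableAt_stdProj (k := -(j : ℤ)) (N := j + 1) (by omega) a b hab,
      stableAt_stdProj (k := -(j : ℤ) - 1) (N := j + 1) (by omega) a b hab]
    push_cast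
    ring
  have hw : window (j + 1) h.1 = ((t : ℝ) : ℂ) • window (j + 1) P.1.1
      + (((1 - (t : ℝ)) * (s : ℝ) : ℝ) : ℂ) • window (j + 1) (stdProj (-(j : ℤ))) := by
    ext a b
    have h0 : stdProj (-(j : ℤ) - 1) a.1 b.1 = 0 := by
      rw [hj]
      exact congrFun (congrFun (window_stdProj_neg (j + 1)) a) b
    show h.1 a.1 b.1 = ((t : ℝ) : ℂ) * P.1.1 a.1 b.1 + _ * stdProj (-(j : ℤ)) a.1 b.1
    rw [hentry, h0]
    push_cast
    ring
  have he : ((expSquare (-(j : ℤ)) P).1 (s, t)).1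
      = padWin 1 (j + 1) (expWin (window (j + 1) h.1)) :=
    expU_eq_padWin h hs
  have hPe := window_mul_window_stdProj_neg hP (j + 1)
  rw [he]
  refine ⟨stableAt_padWin _ _ _, ?_⟩
  rw [window_padWin, expWin, hw, smul_add, smul_smul, smul_smul, Matrix.exp_add_of_commute,
    exp_smul_of_idempotent (P.window_mul_self (hP.mono (Nat.le_succ j))),
    exp_smul_of_idempotent (window_stdProj_neg_mul_self j _)]
  · show (1 + (circ t - 1) • _) * (1 + (circ ((1 - (t : ℝ)) * s) - 1) • _) = _
    simp only [add_mul, mul_add, one_mul, mul_one, Matrix.smul_mul, Matrix.mul_smul, hPe,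
      smul_smul, add_assoc, ← add_smul]
    congr 3
    simp only [squareAngle]
    ring
  · exact ((show Commute _ _ from
      hPe.trans (window_stdProj_neg_mul_window hP (j + 1)).symm).smul_left _).smul_right _

section Vanishing

variable {V : Type} [NormedAddCommGroup V] [NormedSpace ℝ V] [FiniteDimensional ℝ V]
  {C : Set V} {f : V → BUZ} {x : V} {j : ℕ}

theorem HForm_apply {φ : V → SquareU} (hC : IsConvexDomain C) (hφ : ChenSpace.IsPlot C φ)
    (hx : x ∈ C) (k : ℕ) (v : Fin k → V) :
    HForm k V C φ x v = ∫ s in (0 : ℝ)..1, ∫ t in (0 : ℝ)..1,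
      ChU (k + 2) ((V × ℝ) × ℝ) ((C ×ˢ Icc (0 : ℝ) 1) ×ˢ Icc (0 : ℝ) 1)
        (fun y => (φ y.1.1).1 (projIcc 0 1 zero_le_one y.1.2, projIcc 0 1 zero_le_one y.2))
        ((x, s), t) (Fin.cons (0, 1) fun i =>
          ((Fin.cons (0, 1) fun i => (v i, 0) : Fin (k + 1) → V × ℝ) i, 0)) := by
  have h := ChU_isForm.pullback isSmooth_evalSquare
  refine (h.fiberInt.fiberInt_apply k hC hφ hx v).trans ?_
  refine intervalIntegral.integral_congr fun s hs => ?_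
  rw [uIcc_of_le zero_le_one] at hs
  exact h.fiberInt_apply (k + 1) hC.prod_Icc (isPlot_cylinderPlot hC hφ) ⟨hx, hs⟩ _

/-- All values of `g⁻¹dg` commute with the projection `e` onto the basis vector
`e_{-j-1}`; the one on `∂/∂s` lives on its image, those on the directions of
`V` on its kernel. For odd `k` the arguments `∂/∂t, ∂/∂s, v_1, …, v_k` contain at least one `v_i`.
-/
theorem ChU_expSquare (hC : IsConvexDomain C) (hf : ChenSpace.IsPlot C f) (hx : x ∈ C)
    (hj : ∀ᶠ y in 𝓝[C] x, StableAt (stdProj 0) j (f y).1.1) {s t : ℝ}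
    (hs : s ∈ Icc (0 : ℝ) 1) (ht : t ∈ Icc (0 : ℝ) 1) {k : ℕ} (hk : Odd k) (v : Fin k → V) :
    ChU (k + 2) ((V × ℝ) × ℝ) ((C ×ˢ Icc (0 : ℝ) 1) ×ˢ Icc (0 : ℝ) 1)
      (fun y => (expSquare (-(j : ℤ)) (f y.1.1)).1
        (projIcc 0 1 zero_le_one y.1.2, projIcc 0 1 zero_le_one y.2))
      ((x, s), t) (Fin.cons (0, 1) fun i =>
        ((Fin.cons (0, 1) fun i => (v i, 0) : Fin (k + 1) → V × ℝ) i, 0)) = 0 := by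
  set D : Set ((V × ℝ) × ℝ) := (C ×ˢ Icc (0 : ℝ) 1) ×ˢ Icc (0 : ℝ) 1 with hDdef
  set z : (V × ℝ) × ℝ := ((x, s), t) with hz
  have hzD : z ∈ D := ⟨⟨hx, hs⟩, ht⟩
  have hF : StableSmoothOn (stdProj 0) C fun y => (f y).1.1 := hf
  have hdF := fun a b => hF.differentiableWithinAt hx a b
  have hI := uniqueDiffOn_Icc (zero_lt_one (α := ℝ))
  have hD := (hC.uniqueDiffOn.prod hI).prod hI
  have hdF1 : ∀ a b, DifferentiableWithinAt ℝ (fun y : V × ℝ => (f y.1).1.1 a b)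
      (C ×ˢ Icc (0 : ℝ) 1) (x, s) := fun a b =>
    DifferentiableWithinAt.comp (g := fun y => (f y).1.1 a b) (t := C) (x, s)
      (hdF a b) differentiableWithinAt_fst fun y hy => hy.1
  have hst : ∀ᶠ y in 𝓝[D] z, StableAt (stdProj 0) j (f y.1.1).1.1 :=
    eventually_nhdsWithin_fst (Q := fun y : V × ℝ => StableAt (stdProj 0) j (f y.1).1.1)
      (eventually_nhdsWithin_fst (Q := fun y => StableAt (stdProj 0) j (f y).1.1) hj)
  set g : (V × ℝ) × ℝ → StableU := fun y => (expSquare (-(j : ℤ)) (f y.1.1)).1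
    (projIcc 0 1 zero_le_one y.1.2, projIcc 0 1 zero_le_one y.2) with hg
  set e := window (j + 1) (stdProj (-(j : ℤ))) with he
  set P := window (j + 1) (f x).1.1 with hPdef
  -- The angles depend on `(s, t)` only.
  set π₂ : (V × ℝ) × ℝ →L[ℝ] ℝ × ℝ :=
    ((ContinuousLinearMap.snd ℝ V ℝ).comp (ContinuousLinearMap.fst ℝ (V × ℝ) ℝ)).prod
      (ContinuousLinearMap.snd ℝ (V × ℝ) ℝ) with hπ
  have hw : ∀ᶠ y in 𝓝[D] z, window (j + 1) (g y).1
      = 1 + (circ y.2 - 1) • window (j + 1) (f y.1.1).1.1 + squareAngle (π₂ y) • e := by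
    filter_upwards [hst, self_mem_nhdsWithin] with y hy hyD
    rw [hg, (expSquare_window hy _ _).2, projIcc_of_mem _ hyD.2, projIcc_of_mem _ hyD.1.2]
    rfl
  have hφ : HasFDerivWithinAt (fun y : (V × ℝ) × ℝ => circ y.2 - 1)
      ((fderiv ℝ circ t).comp (ContinuousLinearMap.snd ℝ (V × ℝ) ℝ)) D z :=
    (HasFDerivAt.sub_const (1 : ℂ) (HasFDerivAt.comp (g := circ) (f := Prod.snd) z
      (differentiable_circ t).hasFDerivAt hasFDerivAt_snd)).hasFDerivWithinAt
  have hψ : HasFDerivWithinAt (fun y => squareAngle (π₂ y))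
      ((fderiv ℝ squareAngle (π₂ z)).comp π₂) D z :=
    ((differentiable_squareAngle (π₂ z)).hasFDerivAt.comp z π₂.hasFDerivAt).hasFDerivWithinAt
  have hdG : ∀ w, dMat (j + 1) D (fun y => (g y).1) z w
      = (circ t - 1) • extendZero (j + 1) (dMat j C (fun y => (f y).1.1) x w.1.1)
        + fderiv ℝ circ t w.2 • P + fderiv ℝ squareAngle (π₂ z) (π₂ w) • e := fun w => by
    rw [dMat_of_window_eventuallyEq (hD _ hzD) hzD (F := fun y => (f y.1.1).1.1)
      (fun a b => DifferentiableWithinAt.comp (g := fun y : V × ℝ => (f y.1).1.1 a b)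
        (t := C ×ˢ Icc (0 : ℝ) 1) z (hdF1 a b) differentiableWithinAt_fst fun y hy => hy.1)
      hφ hψ hw,
      dMat_fst (F := fun y : V × ℝ => (f y.1).1.1) (hC.uniqueDiffOn.prod hI) hI hzD hdF1,
      dMat_fst (F := fun y => (f y).1.1) hC.uniqueDiffOn hI ⟨hx, hs⟩ hdF,
      ← dMat_eq_extendZero hj hx]
    rfl
  have hgz : (window (j + 1) (g z).1).conjTranspose
      = 1 + star (circ t - 1) • P + star (squareAngle (π₂ z)) • e := by
    rw [hw.self_of_nhdsWithin hzD]
    show (1 + (circ t - 1) • P + squareAngle (π₂ z) • e).conjTranspose = _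
    rw [Matrix.conjTranspose_add, Matrix.conjTranspose_add, Matrix.conjTranspose_smul,
      Matrix.conjTranspose_smul, Matrix.conjTranspose_one,
      show P.conjTranspose = P from (f x).conjTranspose_window _,
      show e.conjTranspose = e from (BUZ.std (-(j : ℤ))).conjTranspose_window _]
  have hstab : ∀ᶠ y in 𝓝[D] z, StableAt 1 (j + 1) (g y).1 :=
    hst.mono fun y hy => (expSquare_window hy _ _).1
  have hPj := hj.self_of_nhdsWithin hx
  have hPe : Commute P e := (window_mul_window_stdProj_neg hPj (j + 1)).trans
    (window_stdProj_neg_mul_window hPj (j + 1)).symm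
  have hge : Commute (window (j + 1) (g z).1).conjTranspose e := by
    rw [hgz]
    exact ((Commute.one_left e).add_left (hPe.smul_left _)).add_left
      ((Commute.refl e).smul_left _)
  have hXe : ∀ X : Matrix (Win j) (Win j) ℂ, Commute (extendZero (j + 1) X) e := fun X =>
    (extendZero_mul_window_stdProj_neg (j + 1) X).trans
      (window_stdProj_neg_mul_extendZero (j + 1) X).symm
  rw [ChU_apply hzD hstab (by rw [Nat.odd_add]; simp [hk])]
  have hk0 : 0 < k := hk.pos
  -- The arguments with indices `1` and `2` are `∂/∂s` and `v_1`.
  rw [altTrace_eq_zero_of_commute (e := e) (a := Fin.succ 0) (b := Fin.succ (Fin.succ ⟨0, hk0⟩)),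
    mul_zero]
  · intro i
    rw [hdG]
    exact hge.mul_left ((((hXe _).smul_left _).add_left (hPe.smul_left _)).add_left
      ((Commute.refl e).smul_left _))
  · show (_ * dMat (j + 1) D (fun y => (g y).1) z ((0, 1), 0)) * e
      = _ * dMat (j + 1) D (fun y => (g y).1) z ((0, 1), 0)
    rw [hdG]
    simp only [map_zero, zero_smul, add_zero, extendZero_zero, smul_zero, zero_add, mul_assoc,
      Matrix.smul_mul]
    rw [show e * e = e from window_stdProj_neg_mul_self j _]
  · show (_ * dMat (j + 1) D (fun y => (g y).1) z ((v ⟨0, hk0⟩, 0), 0)) * e = 0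
    rw [hdG, show π₂ ((v ⟨0, hk0⟩, 0), 0) = 0 from rfl]
    simp only [map_zero, zero_smul, add_zero, mul_assoc, Matrix.smul_mul]
    rw [he, extendZero_mul_window_stdProj_neg, smul_zero, mul_zero]

/-- The square `exp ∘ h_{-j}` of a family that lies in the stage `j` does not contribute: the
derivatives along the family and along `s` live in complementary blocks. -/
theorem HForm_expSquare_eq_zero (hC : IsConvexDomain C) (hf : ChenSpace.IsPlot C f) (hx : x ∈ C)
    (hj : ∀ᶠ y in 𝓝[C] x, StableAt (stdProj 0) j (f y).1.1) (k : ℕ) :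
    HForm k V C (expSquare (-(j : ℤ)) ∘ f) x = 0 := by
  have hpl := isSmooth_expSquare (-(j : ℤ)) V C f hC hf
  by_cases hk : Odd k
  · ext v
    rw [HForm_apply hC hpl hx]
    refine (intervalIntegral.integral_congr (g := fun _ => 0) fun s hs => ?_).trans (by simp)
    refine (intervalIntegral.integral_congr (g := fun _ => 0) fun t ht => ?_).trans (by simp)
    rw [uIcc_of_le zero_le_one] at hs ht
    exact ChU_expSquare hC hf hx hj hs ht hk v
  · exact HForm_isOdd k V C _ hC hpl (Nat.not_odd_iff_even.1 hk) x hx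

end Vanishing

/-! ### The form `β` -/

section Beta

theorem extDerivWithin_fun_sum {V : Type} [NormedAddCommGroup V] [NormedSpace ℝ V] {k : ℕ}
    {C : Set V} {x : V} (hC : UniqueDiffWithinAt ℝ C x) {ι : Type} (s : Finset ι)
    {η : ι → V → V [⋀^Fin k]→L[ℝ] ℂ} (h : ∀ i ∈ s, DifferentiableWithinAt ℝ (η i) C x) :
    extDerivWithin (fun y => ∑ i ∈ s, η i y) C x = ∑ i ∈ s, extDerivWithin (η i) C x := by
  classical
  induction s using Finset.induction_on with
  | empty =>
    simp only [Finset.sum_empty]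
    have := extDerivWithin_fun_smul (0 : ℝ) (fun _ : V => (0 : V [⋀^Fin k]→L[ℝ] ℂ)) hC
    simpa using this
  | insert a s ha ih =>
    simp only [Finset.sum_insert ha]
    rw [extDerivWithin_fun_add hC (h a (Finset.mem_insert_self a s))
      (DifferentiableWithinAt.fun_sum fun i hi => h i (Finset.mem_insert_of_mem hi)),
      ih fun i hi => h i (Finset.mem_insert_of_mem hi)]

/-- The form `β = ∑_{k ≤ 0} (exp ∘ h_k)^* H`. Near a point where a plot lies in the stage `p`
only the terms with `-p < k` can be non-zero, so that the sum is truncated at the least such `p`. -/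
def betaForm : DForm BUZ := fun k V _ _ _ C f x =>
  ∑ j ∈ Finset.range (localStage (stdProj 0) C (fun y => (f y).1.1) x),
    HForm.pullback (expSquare (-(j : ℤ))) k V C f x

variable {V : Type} [NormedAddCommGroup V] [NormedSpace ℝ V] [FiniteDimensional ℝ V]
  {C : Set V} {f : V → BUZ} {x : V} {N : ℕ}

theorem HForm_pullback_eq_zero (hC : IsConvexDomain C) (hf : ChenSpace.IsPlot C f) (hx : x ∈ C)
    (hN : ∀ᶠ y in 𝓝[C] x, StableAt (stdProj 0) N (f y).1.1) (k : ℕ) {j : ℕ} (hj : N ≤ j) :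
    HForm.pullback (expSquare (-(j : ℤ))) k V C f x = 0 :=
  HForm_expSquare_eq_zero hC hf hx (hN.mono fun _ h => h.mono hj) k

theorem betaForm_eq_sum (hC : IsConvexDomain C) (hf : ChenSpace.IsPlot C f) (hx : x ∈ C)
    (hN : ∀ᶠ y in 𝓝[C] x, StableAt (stdProj 0) N (f y).1.1) (k : ℕ) :
    betaForm k V C f x
      = ∑ j ∈ Finset.range N, HForm.pullback (expSquare (-(j : ℤ))) k V C f x := by
  obtain ⟨hle, hst⟩ := localStage_spec hN
  refine Finset.sum_subset (Finset.range_subset_range.2 hle) fun j _ hj => ?_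
  exact HForm_pullback_eq_zero hC hf hx hst k (not_lt.1 fun h => hj (Finset.mem_range.2 h))

theorem eventually_betaForm_eq_sum (hC : IsConvexDomain C) (hf : ChenSpace.IsPlot C f)
    (hN : ∀ᶠ y in 𝓝[C] x, StableAt (stdProj 0) N (f y).1.1) :
    ∀ᶠ y in 𝓝[C] x, ∀ k, betaForm k V C f y
      = ∑ j ∈ Finset.range N, HForm.pullback (expSquare (-(j : ℤ))) k V C f y := by
  filter_upwards [eventually_eventually_nhdsWithin.2 hN, self_mem_nhdsWithin] with y hy hyC k
  exact betaForm_eq_sum hC hf hyC hy k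

theorem HForm_pullback_isForm (j : ℕ) : (HForm.pullback (expSquare (-(j : ℤ)))).IsForm :=
  HForm_isForm.pullback (isSmooth_expSquare _)

theorem betaForm_isForm : betaForm.IsForm where
  smooth k V _ _ _ C f hC hf x hx := by
    obtain ⟨N, hN⟩ := (isPlot_buz_iff.1 hf).1 x hx
    refine (ContDiffWithinAt.sum (s := Finset.range N) fun j _ =>
      (HForm_pullback_isForm j).smooth k V C f hC hf x hx).congr_of_eventuallyEq
      ((eventually_betaForm_eq_sum hC hf hN).mono fun y hy => hy k) ?_
    exact betaForm_eq_sum hC hf hx hN k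
  real k V _ _ _ C f hC hf x hx v := by
    rw [betaForm, ContinuousAlternatingMap.sum_apply, Complex.im_sum]
    exact Finset.sum_eq_zero fun j _ => (HForm_pullback_isForm j).real k V C f hC hf x hx v
  natural k V V' _ _ _ _ _ _ C C' f f' θ hC hC' hf hf' hθ hm he x hx := by
    obtain ⟨N, hN⟩ := (isPlot_buz_iff.1 hf).1 (θ x) (hm hx)
    have hN' : ∀ᶠ y in 𝓝[C'] x, StableAt (stdProj 0) N (f' y).1.1 := by
      filter_upwards [((hθ.continuousOn x hx).tendsto_nhdsWithin hm).eventually hN,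
        self_mem_nhdsWithin] with y hy hyC
      rw [he hyC]
      exact hy
    rw [betaForm_eq_sum hC' hf' hx hN', betaForm_eq_sum hC hf (hm hx) hN]
    ext v
    rw [ContinuousAlternatingMap.compContinuousLinearMap_apply,
      ContinuousAlternatingMap.sum_apply, ContinuousAlternatingMap.sum_apply]
    refine Finset.sum_congr rfl fun j _ => ?_
    rw [(HForm_pullback_isForm j).natural k V V' C C' f f' θ hC hC' hf hf' hθ hm he x hx]
    rfl

theorem betaForm_isOdd : betaForm.IsOdd := fun k V _ _ _ C f hC hf hk x hx =>
  Finset.sum_eq_zero fun _ _ => HForm_isOdd.pullback (isSmooth_expSquare _) k V C f hC hf hk x hx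

theorem betaForm_isLocallyFiniteSum :
    DForm.IsLocallyFiniteSum (fun j : ℕ => HForm.pullback (expSquare (-(j : ℤ)))) betaForm := by
  intro V _ _ _ C f hC hf x hx
  obtain ⟨N, hN⟩ := (isPlot_buz_iff.1 hf).1 x hx
  refine ⟨N, ?_⟩
  filter_upwards [eventually_eventually_nhdsWithin.2 hN, self_mem_nhdsWithin] with y hy hyC k
  exact ⟨fun j hj => HForm_pullback_eq_zero hC hf hyC hy k hj, betaForm_eq_sum hC hf hyC hy k⟩

theorem betaForm_d_eq_sum (hC : IsConvexDomain C) (hf : ChenSpace.IsPlot C f) (hx : x ∈ C)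
    (hN : ∀ᶠ y in 𝓝[C] x, StableAt (stdProj 0) N (f y).1.1) (k : ℕ) :
    betaForm.d k V C f x
      = ∑ j ∈ Finset.range N, HForm.d k V C (expSquare (-(j : ℤ)) ∘ f) x := by
  cases k with
  | zero => exact (Finset.sum_const_zero (ι := ℕ)).symm
  | succ m =>
    have h : betaForm m V C f =ᶠ[𝓝[C] x] fun y =>
        ∑ j ∈ Finset.range N, HForm.pullback (expSquare (-(j : ℤ))) m V C f y :=
      (eventually_betaForm_eq_sum hC hf hN).mono fun y hy => hy m
    exact (h.extDerivWithin_eq_of_mem hx).trans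
      (extDerivWithin_fun_sum (hC.uniqueDiffOn x hx) _ fun j _ =>
      ((HForm_pullback_isForm j).smooth m V C f hC hf x hx).differentiableWithinAt (by simp))

/-- By `HForm_d_expSquare` the derivative of `β` is a telescoping sum. In degree
`0` every square contributes the constant `1`, which accounts for the difference between the trace
of a block and the rank. -/
theorem betaForm_d : (betaForm.d).Same (CSLoop.pullback E - ChBU) := by
  intro k V _ _ _ C f hC hf x hx
  obtain ⟨N, hN⟩ := (isPlot_buz_iff.1 hf).1 x hx
  show _ = CSForm k V C (shiftE 0 ∘ f) x - ChBU k V C f x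
  ext v
  rw [betaForm_d_eq_sum hC hf hx hN, ContinuousAlternatingMap.sum_apply,
    Finset.sum_congr rfl fun j _ => HForm_d_expSquare hC hf hx j k v, Finset.sum_add_distrib,
    Finset.sum_range_sub' (fun j : ℕ => CSForm k V C (shiftE (-(j : ℤ)) ∘ f) x v),
    Finset.sum_const, Finset.card_range, ContinuousAlternatingMap.sub_apply, sub_add]
  congr 1
  by_cases hk : Even k
  · rw [CSForm_shiftE hC hf hx hN hk]
    by_cases hk0 : k = 0
    · subst hk0
      rw [ChBU_zero_apply hx hN, altTrace_zero]
      simp [evenCoeff]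
    · rw [ChBU_apply hx hN hk hk0, if_neg hk0, smul_zero, sub_zero]
  · rw [CSForm_isEven k V C _ hC (isSmooth_shiftE _ V C f hC hf) (Nat.not_even_iff_odd.1 hk) x hx,
      ChBU_of_not_even hk, if_neg (by rintro rfl; exact hk ⟨0, rfl⟩), smul_zero, sub_zero]

end Beta

theorem isSmooth_ESharp {M : Type*} [ChenSpace M] {f : M → BUZ} (hf : IsSmooth f) :
    IsSmooth (ESharp f) :=
  isSmooth_expU.comp (isSmooth_seg.comp ((isSmooth_snd.prodMk
    (isSmooth_coe_buz.comp (hf.comp isSmooth_fst))).prodMk (isSmooth_const (StableH.std 0))))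

end

end BottForm

theorem mainTheorem6 :
    -- the maps and universal forms are well defined
    (IsSmooth E ∧ (∀ k : ℤ, IsSmooth (expSquare k)) ∧
      ChU.IsForm ∧ ChU.IsOdd ∧ ChBU.IsForm ∧ ChBU.IsEven ∧
      CSForm.IsForm ∧ CSForm.IsEven ∧ HForm.IsForm ∧ HForm.IsOdd) ∧
    -- `H` is a transgression form for the boundary of the square
    (HForm.d).Same
      (CSForm.pullback (SquareU.vertical 1) - CSForm.pullback (SquareU.vertical 0)
        - CSForm.pullback (SquareU.horizontal 1) + CSForm.pullback (SquareU.horizontal 0)) ∧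
    ∃ β : DForm BUZ,
      β.IsForm ∧ β.IsOdd ∧
      -- `β = ∑_{k ≤ 0} (exp ∘ h_k)^* H`, a locally finite sum
      DForm.IsLocallyFiniteSum (fun j : ℕ => HForm.pullback (expSquare (-(j : ℤ)))) β ∧
      -- `dβ = E^* CS - Ch`
      (β.d).Same (CSLoop.pullback E - ChBU) ∧
      -- `∫_{S¹} Ch(E^♯ f) - Ch(f) = d (f^* β)` on compact manifolds with corners
      ∀ (EM HM M : Type*) [NormedAddCommGroup EM] [NormedSpace ℝ EM] [FiniteDimensional ℝ EM]
        [TopologicalSpace HM] (I : ModelWithCorners ℝ EM HM)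
        [TopologicalSpace M] [ChartedSpace HM M] [IsManifold I ∞ M] [CompactSpace M] [T2Space M]
        (f : OfManifold I M → BUZ), IsSmooth f →
        IsSmooth (ESharp f) ∧ (∀ x, ESharp f (x, 0) = ESharp f (x, 1)) ∧
          (β.pullback f).IsForm ∧
          ((ChU.pullback (ESharp f)).fiberInt - ChBU.pullback f).Same ((β.pullback f).d) := by
  refine ⟨⟨isSmooth_E, isSmooth_expSquare, ChU_isForm, ChU_isOdd, ChBU_isForm, ChBU_isEven,
    CSForm_isForm, CSForm_isEven, HForm_isForm, HForm_isOdd⟩, HForm_d, betaForm, betaForm_isForm,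
    betaForm_isOdd, betaForm_isLocallyFiniteSum, betaForm_d, ?_⟩
  intro EM HM M _ _ _ _ I _ _ _ _ _ f hf
  refine ⟨isSmooth_ESharp hf, fun x => (E (f x)).2.1.trans (E (f x)).2.2.symm,
    betaForm_isForm.pullback hf, fun k V _ _ _ C g hC hg x hx => ?_⟩
  have h := betaForm_d k V C (f ∘ g) hC (hf V C g hC hg) x hx
  refine Eq.trans ?_ (h.symm.trans ?_)
  · rfl
  · cases k <;> rfl
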